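/- Let $n\ge 0$ and let $\pi$ be an absolutely continuous logconcave probability measure on $\mathbb{R}^n$, i.e. $\pi$ has a density $\rho:\mathbb{R}^n\to[0,\infty)$ with respect to Lebesgue measure such that $-\log\rho$ is convex (with values in $(-\infty,\infty]$). For $t>0$ let $\gamma_t$ be the centered Gaussian measure with covariance $tI_n$, $\gamma_0=\delta_0$, and let $\pi_t=\pi*\gamma_t$ for $t\ge 0$ (so $\pi_0=\pi$). Let $Q_tg=g*\gamma_t$ be the heat semigroup, viewed as an operator $L^2(\pi_t)\to L^2(\pi)$, and let $Q_t^*:L^2(\pi)\to L^2(\pi_t)$ be its adjoint; thus $Q_0^*f=f$ and, writing $\gamma_t$ also for the Gaussian density, for $t>0$ \[ Q_t^*f(y)=\frac{\int f(x)\,\gamma_t(y-x)\,\mathrm{d}\pi(x)}{\int\gamma_t(y-x)\,\mathrm{d}\pi(x)}\,. \] For a logconcave measure $\mu$ as above, $H^1(\mu)$ is the set of $f\in L^2(\mu)$ that have a weak gradient $\nabla f$ on the interior of the support of $\mu$ with $\nabla f\in L^2(\mu)$. Let $f\in H^1(\pi)$ and $f_t=Q_t^*f$. Then $f_t\in H^1(\pi_t)$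 for all $t\ge0$. If moreover $f$ is not $\pi$-a.e. zero, then $\|f_t\|_{L^2(\pi_t)}>0$ for all $t\ge 0$, the Rayleigh quotient \[ R_f(t)=\frac{\int\|\nabla f_t\|^2\,\mathrm{d}\pi_t}{\int f_t^2\,\mathrm{d}\pi_t} \] is non-increasing in $t\in[0,\infty)$, the function $t\mapsto\|f_t\|_{L^2(\pi_t)}$ is log-convex on $[0,\infty)$, and for all $h>0$ \[ \|Q_h^*f\|_{L^2(\pi_h)}^2\ \ge\ e^{-hR_f(0)}\,\|f\|_{L^2(\pi)}^2\,. \] Finally, for every $f\in H^1(\pi)$ and all $h>0$, \[ \int\|\nabla Q_h^*f\|^2\,\mathrm{d}\pi_h\ \le\ \int\|\nabla f\|^2\,\mathrm{d}\pi\,. \] -/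

import Mathlib

open MeasureTheory ProbabilityTheory Set
open scoped ContDiff

noncomputable section

namespace HeatAdjoint

/-- A function `ρ : ℝⁿ → [0, ∞)` is logconcave: `-log ρ` is convex as a function with values in
`(-∞, ∞]`. -/
def IsLogConcaveFun {n : ℕ} (ρ : EuclideanSpace ℝ (Fin n) → ℝ) : Prop :=
  (∀ x, 0 ≤ ρ x) ∧
    ∀ x y : EuclideanSpace ℝ (Fin n), ∀ a b : ℝ, 0 < a → 0 < b → a + b = 1 →
      ρ x ^ a * ρ y ^ b ≤ ρ (a • x + b • y)

/-- A measure on `ℝⁿ` is absolutely continuous and logconcave: it has a logconcave density with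
respect to the Lebesgue measure. -/
def IsLogConcave {n : ℕ} (π : Measure (EuclideanSpace ℝ (Fin n))) : Prop :=
  ∃ ρ : EuclideanSpace ℝ (Fin n) → ℝ, Measurable ρ ∧ IsLogConcaveFun ρ ∧
    π = volume.withDensity (fun x => ENNReal.ofReal (ρ x))

/-- The centered Gaussian measure `γ_t` on `ℝⁿ` with covariance matrix `t Iₙ`
(for `t = 0` this is the Dirac mass at `0`). -/
def gaussian (n : ℕ) (t : ℝ) : Measure (EuclideanSpace ℝ (Fin n)) :=
  multivariateGaussian 0 (t • (1 : Matrix (Fin n) (Fin n) ℝ))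

/-- The Lebesgue density of `γ_t`, for `t > 0`. -/
def gaussianDensity (n : ℕ) (t : ℝ) (z : EuclideanSpace ℝ (Fin n)) : ℝ :=
  (2 * Real.pi * t) ^ (-(n : ℝ) / 2) * Real.exp (-‖z‖ ^ 2 / (2 * t))

/-- The heat flow `π_t = π ∗ γ_t`. -/
def heatFlow {n : ℕ} (π : Measure (EuclideanSpace ℝ (Fin n))) (t : ℝ) :
    Measure (EuclideanSpace ℝ (Fin n)) :=
  Measure.conv π (gaussian n t)

/-- The heat semigroup `Q_t g = g ∗ γ_t`. -/
def heatSemigroup {n : ℕ} (t : ℝ) (g : EuclideanSpace ℝ (Fin n) → ℝ)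
    (x : EuclideanSpace ℝ (Fin n)) : ℝ :=
  ∫ z, g (x + z) ∂(gaussian n t)

/-- The adjoint `Q_t^* : L²(π) → L²(π_t)` of the heat semigroup `Q_t : L²(π_t) → L²(π)`:
`Q_0^* f = f` and `Q_t^* f = ((f π) ∗ γ_t) / (π ∗ γ_t)` for `t > 0`. The duality
`⟨f, Q_t g⟩_{L²(π)} = ⟨Q_t^* f, g⟩_{L²(π_t)}` is `integral_mul_heatSemigroup` below. -/
def heatAdjoint {n : ℕ} (π : Measure (EuclideanSpace ℝ (Fin n))) (t : ℝ)
    (f : EuclideanSpace ℝ (Fin n) → ℝ) (y : EuclideanSpace ℝ (Fin n)) : ℝ :=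
  if t = 0 then f y
  else (∫ x, f x * gaussianDensity n t (y - x) ∂π) / ∫ x, gaussianDensity n t (y - x) ∂π

/-- `G` is a weak gradient of `f` on the interior of the support of `π`: for all `C^∞` functions
`φ` with compact support in that open set and all directions `v`,
`∫ f ∂_v φ dx = - ∫ φ ⟨G, v⟩ dx`. -/
def HasWeakGradient {n : ℕ} (π : Measure (EuclideanSpace ℝ (Fin n)))
    (f : EuclideanSpace ℝ (Fin n) → ℝ)
    (G : EuclideanSpace ℝ (Fin n) → EuclideanSpace ℝ (Fin n)) : Prop :=
  ∀ φ : EuclideanSpace ℝ (Fin n) → ℝ, ContDiff ℝ ∞ φ → HasCompactSupport φ →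
    tsupport φ ⊆ interior π.support → ∀ v : EuclideanSpace ℝ (Fin n),
      ∫ x, f x * fderiv ℝ φ x v = - ∫ x, φ x * inner ℝ (G x) v

/-- The Sobolev space `H¹(π)`: functions in `L²(π)` with a weak gradient in `L²(π)`. -/
def MemH1 {n : ℕ} (π : Measure (EuclideanSpace ℝ (Fin n)))
    (f : EuclideanSpace ℝ (Fin n) → ℝ) : Prop :=
  MemLp f 2 π ∧ ∃ G : EuclideanSpace ℝ (Fin n) → EuclideanSpace ℝ (Fin n),
    MemLp G 2 π ∧ HasWeakGradient π f G

open Classical in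
/-- The (weak) gradient of `f ∈ H¹(π)`, as an element of `L²(π)`. -/
def weakGradient {n : ℕ} (π : Measure (EuclideanSpace ℝ (Fin n)))
    (f : EuclideanSpace ℝ (Fin n) → ℝ) : EuclideanSpace ℝ (Fin n) → EuclideanSpace ℝ (Fin n) :=
  if h : ∃ G : EuclideanSpace ℝ (Fin n) → EuclideanSpace ℝ (Fin n),
    MemLp G 2 π ∧ HasWeakGradient π f G then h.choose else 0

/-- The gradient energy `∫ ‖∇f‖² dπ`. -/
def gradEnergy {n : ℕ} (π : Measure (EuclideanSpace ℝ (Fin n)))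
    (f : EuclideanSpace ℝ (Fin n) → ℝ) : ℝ :=
  ∫ x, ‖weakGradient π f x‖ ^ 2 ∂π

/-- The norm `‖f‖_{L²(π)}`. -/
def l2Norm {n : ℕ} (π : Measure (EuclideanSpace ℝ (Fin n)))
    (f : EuclideanSpace ℝ (Fin n) → ℝ) : ℝ :=
  Real.sqrt (∫ x, f x ^ 2 ∂π)

/-- The Rayleigh quotient `R_f(t) = ∫ ‖∇f_t‖² dπ_t / ∫ f_t² dπ_t`, where `f_t = Q_t^* f`. -/
def rayleigh {n : ℕ} (π : Measure (EuclideanSpace ℝ (Fin n)))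
    (f : EuclideanSpace ℝ (Fin n) → ℝ) (t : ℝ) : ℝ :=
  gradEnergy (heatFlow π t) (heatAdjoint π t f) /
    ∫ x, heatAdjoint π t f x ^ 2 ∂(heatFlow π t)

instance {n : ℕ} (t : ℝ) : IsProbabilityMeasure (gaussian n t) := by
  unfold gaussian; infer_instance

lemma gaussian_zero (n : ℕ) : gaussian n 0 = Measure.dirac 0 := by
  refine Measure.ext_of_charFun ?_
  ext x
  unfold gaussian
  rw [charFun_multivariateGaussian (by simpa using Matrix.PosSemidef.zero)]
  simp [charFun_dirac]

lemma heatFlow_zero {n : ℕ} (π : Measure (EuclideanSpace ℝ (Fin n))) [SFinite π] :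
    heatFlow π 0 = π := by
  rw [heatFlow, gaussian_zero, Measure.conv_dirac_zero]

lemma gaussianDensity_pos {n : ℕ} {t : ℝ} (ht : 0 < t) (z : EuclideanSpace ℝ (Fin n)) :
    0 < gaussianDensity n t z := by
  unfold gaussianDensity; positivity

lemma continuous_gaussianDensity (n : ℕ) (t : ℝ) : Continuous (gaussianDensity n t) := by
  unfold gaussianDensity; fun_prop

/-- `gaussianDensity n t` is the density of `γ_t`. -/
lemma gaussian_eq_withDensity {n : ℕ} {t : ℝ} (ht : 0 < t) :
    gaussian n t = volume.withDensity (fun z => ENNReal.ofReal (gaussianDensity n t z)) := by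
  have hint : Integrable (gaussianDensity n t) := by
    have h := (GaussianFourier.integrable_cexp_neg_mul_sq_norm_add
      (V := EuclideanSpace ℝ (Fin n)) (b := ((1 / (2 * t) : ℝ) : ℂ))
      (by simpa using ht) 0 0).norm
    refine (h.const_mul ((2 * Real.pi * t) ^ (-(n : ℝ) / 2))).congr (ae_of_all _ fun z => ?_)
    simp only [gaussianDensity, Complex.norm_exp]
    congr 2
    norm_cast
    simp
    ring
  have : IsFiniteMeasure
      (volume.withDensity (fun z => ENNReal.ofReal (gaussianDensity n t z))) :=
    isFiniteMeasure_withDensity_ofReal hint.2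
  symm
  refine Measure.ext_of_charFun ?_
  ext x
  rw [charFun_apply, integral_withDensity_eq_integral_toReal_smul
    (continuous_gaussianDensity n t).measurable.ennreal_ofReal (by simp)]
  have key := GaussianFourier.integral_cexp_neg_mul_sq_norm_add
    (V := EuclideanSpace ℝ (Fin n)) (b := ((1 / (2 * t) : ℝ) : ℂ))
      (by simpa using ht) Complex.I x
  have e1 : ∀ z : EuclideanSpace ℝ (Fin n),
      (ENNReal.ofReal (gaussianDensity n t z)).toReal • Complex.exp (inner ℝ z x * Complex.I) =
      (((2 * Real.pi * t) ^ (-(n : ℝ) / 2) : ℝ) : ℂ) *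
        Complex.exp (-((1 / (2 * t) : ℝ) : ℂ) * ‖z‖ ^ 2 + Complex.I * inner ℝ x z) := by
    intro z
    rw [ENNReal.toReal_ofReal (gaussianDensity_pos ht z).le, gaussianDensity, Complex.exp_add,
      Complex.real_smul, Complex.ofReal_mul, Complex.ofReal_exp, real_inner_comm, mul_assoc]
    congr 2
    · congr 1
      push_cast
      ring
    · rw [mul_comm]
  simp_rw [e1]
  rw [integral_const_mul, key]
  unfold gaussian
  rw [charFun_multivariateGaussian (Matrix.PosSemidef.one.smul ht.le)]
  have e2 : ((Real.pi : ℂ) / ((1 / (2 * t) : ℝ) : ℂ)) ^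
      ((Module.finrank ℝ (EuclideanSpace ℝ (Fin n)) : ℂ) / 2) =
      (((2 * Real.pi * t) ^ ((n : ℝ) / 2) : ℝ) : ℂ) := by
    rw [Complex.ofReal_cpow (by positivity)]
    simp
    congr 1
    field_simp
  rw [e2, ← mul_assoc, ← Complex.ofReal_mul, ← Real.rpow_add (by positivity)]
  have e3 : (x.ofLp ⬝ᵥ x.ofLp : ℝ) = ‖x‖ ^ 2 := by
    rw [EuclideanSpace.norm_sq_eq]
    simp [dotProduct, sq]
  simp [Matrix.smul_mulVec, e3, neg_div]
  have : (t : ℂ) ≠ 0 := by exact_mod_cast ht.ne'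
  field_simp
  congr 1
  ring

/-- `Q_t^*` is the adjoint of `Q_t`. -/
lemma integral_mul_heatSemigroup {n : ℕ} (π : Measure (EuclideanSpace ℝ (Fin n)))
    [IsProbabilityMeasure π] {t : ℝ} (ht : 0 ≤ t) (f g : EuclideanSpace ℝ (Fin n) → ℝ)
    (hf : MemLp f 2 π) (hg : MemLp g 2 (heatFlow π t)) :
    ∫ x, f x * heatSemigroup t g x ∂π = ∫ y, heatAdjoint π t f y * g y ∂(heatFlow π t) := by
  rcases ht.eq_or_lt with rfl | ht
  · rw [heatFlow_zero]
    have h0 : gaussian n 0 = Measure.dirac 0 := gaussian_zero n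
    simp [heatSemigroup, heatAdjoint, h0]
  set k := gaussianDensity n t with hk
  have hkc : Continuous k := continuous_gaussianDensity n t
  have hkm : Measurable fun z => ENNReal.ofReal (k z) := hkc.measurable.ennreal_ofReal
  have hγ := gaussian_eq_withDensity (n := n) ht
  -- integrability of the joint integrand
  have h1 : Integrable (fun p : EuclideanSpace ℝ (Fin n) × EuclideanSpace ℝ (Fin n) =>
      f p.1 * g (p.1 + p.2)) (π.prod (gaussian n t)) :=
    MemLp.integrable_mul (hf.comp_measurePreserving measurePreserving_fst)
      (hg.comp_measurePreserving (f := fun p : EuclideanSpace ℝ (Fin n) ×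
        EuclideanSpace ℝ (Fin n) => p.1 + p.2) ⟨measurable_add, rfl⟩)
  rw [hγ, prod_withDensity_right hkm, integrable_withDensity_iff_integrable_smul'
    (f := fun p : EuclideanSpace ℝ (Fin n) × EuclideanSpace ℝ (Fin n) => ENNReal.ofReal (k p.2))
    (hkm.comp measurable_snd) (by simp)] at h1
  have hF : Integrable (fun p : EuclideanSpace ℝ (Fin n) × EuclideanSpace ℝ (Fin n) =>
      f p.1 * g p.2 * k (p.2 - p.1)) (π.prod volume) := by
    rw [← (measurePreserving_prod_add π (volume :
      Measure (EuclideanSpace ℝ (Fin n)))).integrable_comp_emb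
      (MeasurableEquiv.shearAddRight _).measurableEmbedding]
    refine h1.congr (ae_of_all _ fun p => ?_)
    simp only [Function.comp_apply, add_sub_cancel_left, smul_eq_mul]
    rw [ENNReal.toReal_ofReal (gaussianDensity_pos ht _).le]
    ring
  -- the semigroup as a convolution with the kernel
  have hQ : ∀ x, heatSemigroup t g x = ∫ y, g y * k (y - x) := by
    intro x
    rw [heatSemigroup, hγ, integral_withDensity_eq_integral_toReal_smul hkm (by simp),
      ← integral_add_left_eq_self (fun y => g y * k (y - x)) x]
    congr 1 with z
    rw [ENNReal.toReal_ofReal (gaussianDensity_pos ht _).le, add_sub_cancel_left, smul_eq_mul,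
      mul_comm]
  have hkint : ∀ y, Integrable (fun x => k (y - x)) π := by
    intro y
    refine Integrable.of_bound (C := (2 * Real.pi * t) ^ (-(n : ℝ) / 2))
      (by fun_prop) (ae_of_all _ fun x => ?_)
    rw [Real.norm_eq_abs, abs_of_pos (gaussianDensity_pos ht _)]
    refine mul_le_of_le_one_right (by positivity) (Real.exp_le_one_iff.2 ?_)
    rw [neg_div]
    exact neg_nonpos.2 (by positivity)
  -- the density of the flow
  set D : EuclideanSpace ℝ (Fin n) → ℝ := fun y => ∫ x, k (y - x) ∂π with hD
  have hDpos : ∀ y, 0 < D y := by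
    intro y
    refine (integral_pos_iff_support_of_nonneg
      (fun x => (gaussianDensity_pos ht _).le) (hkint y)).2 ?_
    have : (Function.support fun x => k (y - x)) = univ :=
      eq_univ_of_forall fun x => (gaussianDensity_pos ht _).ne'
    rw [this]
    simp
  have hDE : ∀ y, ENNReal.ofReal (D y) = ∫⁻ x, ENNReal.ofReal (k (y - x)) ∂π := fun y =>
    ofReal_integral_eq_lintegral_ofReal (hkint y)
      (ae_of_all _ fun x => (gaussianDensity_pos ht _).le)
  have hDm : Measurable fun y => ENNReal.ofReal (D y) := by
    simp_rw [hDE]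
    exact Measurable.lintegral_prod_right' (f := fun p : EuclideanSpace ℝ (Fin n) ×
      EuclideanSpace ℝ (Fin n) => ENNReal.ofReal (k (p.1 - p.2))) (by fun_prop)
  have hπt : heatFlow π t = volume.withDensity fun y => ENNReal.ofReal (D y) := by
    ext s hs
    rw [← lintegral_indicator_one hs, heatFlow, Measure.lintegral_conv
      (measurable_one.indicator hs), withDensity_apply _ hs, ← lintegral_indicator hs]
    have : ∀ x, ∫⁻ z, s.indicator (1 : EuclideanSpace ℝ (Fin n) → ENNReal) (x + z)
        ∂(gaussian n t) = ∫⁻ y, ENNReal.ofReal (k (y - x)) * s.indicator 1 y := by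
      intro x
      rw [hγ, lintegral_withDensity_eq_lintegral_mul _ hkm
        (g := fun z => s.indicator 1 (x + z))
        ((measurable_one.indicator hs).comp (measurable_const_add x)),
        ← lintegral_add_left_eq_self (fun y => ENNReal.ofReal (k (y - x)) * s.indicator 1 y) x]
      simp [hk]
    simp_rw [this]
    rw [lintegral_lintegral_swap]
    · congr 1 with y
      rw [lintegral_mul_const _ (by fun_prop), ← hDE]
      by_cases hy : y ∈ s <;> simp [hy]
    · refine (Measurable.mul (by fun_prop) ?_).aemeasurable
      exact (measurable_one.indicator hs).comp measurable_snd
  rw [hπt, integral_withDensity_eq_integral_toReal_smul hDm (by simp)]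
  have hR : ∀ y, (ENNReal.ofReal (D y)).toReal • (heatAdjoint π t f y * g y) =
      ∫ x, f x * g y * k (y - x) ∂π := by
    intro y
    rw [ENNReal.toReal_ofReal (hDpos y).le, heatAdjoint, if_neg ht.ne', smul_eq_mul]
    have : ∀ x, f x * g y * k (y - x) = f x * k (y - x) * g y := fun x => mul_right_comm _ _ _
    simp_rw [this]
    rw [integral_mul_const, ← mul_assoc, mul_div_cancel₀ _ (hDpos y).ne']
  have hL : ∀ x, f x * heatSemigroup t g x = ∫ y, f x * g y * k (y - x) := by
    intro x
    rw [hQ, ← integral_const_mul]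
    simp_rw [mul_assoc]
  simp_rw [hR, hL]
  exact integral_integral_swap hF

/-- For a function of class `C¹`, the classical gradient is a weak gradient. -/
lemma hasWeakGradient_gradient {n : ℕ} (π : Measure (EuclideanSpace ℝ (Fin n)))
    {f : EuclideanSpace ℝ (Fin n) → ℝ} (hf : ContDiff ℝ 1 f) :
    HasWeakGradient π f (gradient f) := by
  intro φ hφ hc _ v
  have hφ1 : ContDiff ℝ 1 φ := hφ.of_le (by norm_cast)
  have hdf : Continuous fun x => fderiv ℝ f x v := by fun_prop
  have hdφ : Continuous fun x => fderiv ℝ φ x v := by fun_prop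
  have hcφ : HasCompactSupport fun x => fderiv ℝ φ x v := by
    exact (hc.fderiv (𝕜 := ℝ)).comp_left (g := fun L => L v) (by simp)
  rw [integral_mul_fderiv_eq_neg_fderiv_mul_of_integrable
    ((hdf.mul hφ.continuous).integrable_of_hasCompactSupport hc.mul_left)
    ((hf.continuous.mul hdφ).integrable_of_hasCompactSupport hcφ.mul_left)
    ((hf.continuous.mul hφ.continuous).integrable_of_hasCompactSupport hc.mul_left)
    (fun x _ => hf.differentiable (by norm_num) x)
    (fun x _ => hφ1.differentiable (by norm_num) x)]
  congr 2 with x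
  rw [inner_gradient_left, mul_comm]

end HeatAdjoint

end

/-! Write N(t) = ‖f_t‖² and E(t) = ∫ ‖∇f_t‖² dπ_t, with norms in L²(π_t). Given that the heat flow
is at y at time t, the law of its starting point has density proportional to ρ(x) γ_t(y − x). Its
logarithm is at least as concave as that of the Gaussian factor, so it satisfies a Poincaré
inequality with constant t, uniformly in y (`poincare_posterior`). The value f_t(y) is the mean of f
under this posterior law, and N(0) − N(t) is the posterior variance of f averaged over y
(`integrable_heatNum_variance`).

This variance is used twice. The Poincaré inequality for f bounds it from above and gives N(t) −
N(t+h) ≤ h E(t) (`adjointNormSq_sub_le`). Conversely, ∇f_t(y) is 1/t times the posterior covariance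
of f and x. Cauchy–Schwarz together with the Poincaré inequality for linear functions gives h E(t+h)
≤ N(t) − N(t+h) (`mul_adjointEnergy_le`). Comparing the two bounds yields E(t+h) ≤ E(t), which is
the last claim of the theorem.

The remaining claims follow from log-convexity of N. For bounded f and boundedly supported π, all
functions involved are smooth with derivatives of polynomial growth. Formally N' = −E. Instead of
differentiating N twice, one bounds N(t+h) from below by 2⟨f_{t+h}, g⟩ − ‖g‖², where g is the
first-order Taylor polynomial of f_{t+h} in h. This quantity is differentiated by testing the heat
equation against fixed smooth functions. A Bochner computation (`integral_second_variation`) shows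
that its second derivative is ∫ (Lw)² dπ_t minus the Hessian of the log density of π_t applied to
∇w, with w = f_t and L the Langevin generator of π_t. Since π_t is logconcave, the second derivative
is at least S = ∫ (Lw)² dπ_t, and E = −⟨w, Lw⟩ gives E² ≤ N S. This is N N'' ≥ (N')² in a one-sided
sense (`exists_second_order_bound`). A maximum principle turns it into convexity of log N
(`convexOn_log_of_second_order`). Truncating f and conditioning π on large balls removes the
boundedness assumptions (`adjointNormSq_le_rpow_mul`).

Log-convexity also forces N > 0: a zero at t would make N vanish on (0, t), against N(0) − N(h) ≤ h
E(0). Finally, the difference bounds place the slope of log N over [s, t] between −E(s)/N(s) and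
−E(t)/N(t) (`log_sub_log_bounds`). This is monotonicity of the Rayleigh quotient, and s = 0 gives
the exponential lower bound.

The Poincaré inequality itself comes from Prékopa–Leindler by Maurey's argument (`poincare_smooth`),
followed by mollification and exhaustion to reach H¹ functions (`poincare_H1`). -/

noncomputable section

namespace HeatAdjoint
open Filter Topology
open scoped ENNReal NNReal Pointwise

/-! ### The Prékopa–Leindler inequality -/

section

/-- One-dimensional Brunn–Minkowski inequality for compact sets. -/
lemma brunnMinkowski_compact {a b : ℝ} (ha : 0 < a) (hb : 0 < b) {K L C : Set ℝ}
    (hK : IsCompact K) (hL : IsCompact L) (hK0 : K.Nonempty) (hL0 : L.Nonempty)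
    (hC : ∀ x ∈ K, ∀ y ∈ L, a * x + b * y ∈ C) :
    ENNReal.ofReal a * volume K + ENNReal.ofReal b * volume L ≤ volume C := by
  -- With k = max K and l = min L, the sets aK + bl and ak + bL lie in C and meet at most in ak +
  -- bl, so their measures add up.
  obtain ⟨k, hk⟩ := hK.exists_isGreatest hK0
  obtain ⟨l, hl⟩ := hL.exists_isLeast hL0
  have e1 : volume ((fun x => a * x + b * l) '' K) = ENNReal.ofReal a * volume K := by
    have : (fun x => a * x + b * l) '' K = (fun x => x + b * l) '' (a • K) := by
      rw [← image_smul, image_image]; rfl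
    rw [this, image_add_right, measure_preimage_add_right, Measure.addHaar_smul]
    simp [abs_of_pos ha]
  have e2 : volume ((fun y => a * k + b * y) '' L) = ENNReal.ofReal b * volume L := by
    have : (fun y => a * k + b * y) '' L = (fun x => a * k + x) '' (b • L) := by
      rw [← image_smul, image_image]; rfl
    rw [this, image_add_left, measure_preimage_add, Measure.addHaar_smul]
    simp [abs_of_pos hb]
  have hm : MeasurableSet ((fun y => a * k + b * y) '' L) :=
    (hL.image (by fun_prop)).measurableSet
  have hd : AEDisjoint volume ((fun x => a * x + b * l) '' K) ((fun y => a * k + b * y) '' L) := by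
    refine measure_mono_null (t := {a * k + b * l}) ?_ (by simp)
    rintro _ ⟨⟨x, hx, rfl⟩, ⟨y, hy, hxy⟩⟩
    have h1 := mul_le_mul_of_nonneg_left (hk.2 hx) ha.le
    have h2 := mul_le_mul_of_nonneg_left (hl.2 hy) hb.le
    simp only [mem_singleton_iff] at *
    linarith
  rw [← e1, ← e2, ← measure_union₀ hm.nullMeasurableSet hd]
  refine measure_mono ?_
  rintro _ (⟨x, hx, rfl⟩ | ⟨y, hy, rfl⟩)
  · exact hC x hx l hl.1
  · exact hC k hk.1 y hy

/-- One-dimensional Brunn–Minkowski inequality for measurable sets. -/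
lemma brunnMinkowski_real {a b : ℝ} (ha : 0 < a) (hb : 0 < b) {A B C : Set ℝ}
    (hA : MeasurableSet A) (hB : MeasurableSet B) (hA0 : A.Nonempty) (hB0 : B.Nonempty)
    (hC : ∀ x ∈ A, ∀ y ∈ B, a * x + b * y ∈ C) :
    ENNReal.ofReal a * volume A + ENNReal.ofReal b * volume B ≤ volume C := by
  -- Inner regularity, for one set at a time. Subtracting c needs d finite; d = ⊤ is trivial. A
  -- singleton inside S shows c ≤ d.
  have approx : ∀ {S : Set ℝ}, MeasurableSet S → S.Nonempty → ∀ {c d : ℝ≥0∞} {r : ℝ}, 0 < r →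
      (∀ K ⊆ S, IsCompact K → K.Nonempty → ENNReal.ofReal r * volume K + c ≤ d) →
      ENNReal.ofReal r * volume S + c ≤ d := by
    intro S hS ⟨x, hx⟩ c d r hr h
    have hr0 : ENNReal.ofReal r ≠ 0 := by simpa using hr
    by_cases hd : d = ⊤
    · simp [hd]
    have hcd : c ≤ d := le_trans le_add_self
      (h {x} (by simpa using hx) isCompact_singleton (singleton_nonempty x))
    have : volume S ≤ (d - c) / ENNReal.ofReal r := by
      refine le_of_forall_lt fun s hs => ?_
      obtain ⟨K, hKS, hK, hsK⟩ := hS.exists_lt_isCompact hs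
      refine hsK.trans_le ?_
      have hK0 : K.Nonempty := by
        rw [nonempty_iff_ne_empty]; rintro rfl; simp at hsK
      rw [ENNReal.le_div_iff_mul_le (Or.inl hr0) (Or.inl ENNReal.ofReal_ne_top), mul_comm]
      exact ENNReal.le_sub_of_add_le_right (ne_top_of_le_ne_top hd hcd) (h K hKS hK hK0)
    rw [ENNReal.le_div_iff_mul_le (Or.inl hr0) (Or.inl ENNReal.ofReal_ne_top), mul_comm] at this
    calc _ ≤ (d - c) + c := by gcongr
      _ = d := tsub_add_cancel_of_le hcd
  refine approx hA hA0 ha fun K hKA hK hK0 => ?_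
  rw [add_comm]
  refine approx hB hB0 hb fun L hLB hL hL0 => ?_
  rw [add_comm]
  exact brunnMinkowski_compact ha hb hK hL hK0 hL0 fun x hx y hy => hC x (hKA hx) y (hLB hy)

lemma ennreal_geom_mean_le_arith_mean {a b : ℝ} (ha : 0 < a) (hb : 0 < b) (hab : a + b = 1)
    (x y : ℝ≥0∞) : x ^ a * y ^ b ≤ ENNReal.ofReal a * x + ENNReal.ofReal b * y := by
  have ha0 : ENNReal.ofReal a ≠ 0 := by simpa using ha
  have hb0 : ENNReal.ofReal b ≠ 0 := by simpa using hb
  by_cases hx : x = ⊤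
  · simp [hx, ENNReal.mul_top ha0, ENNReal.top_rpow_of_pos ha]
  by_cases hy : y = ⊤
  · simp [hy, ENNReal.mul_top hb0]
  lift x to ℝ≥0 using hx
  lift y to ℝ≥0 using hy
  rw [← ENNReal.coe_rpow_of_nonneg _ ha.le, ← ENNReal.coe_rpow_of_nonneg _ hb.le]
  have := NNReal.geom_mean_le_arith_mean2_weighted a.toNNReal b.toNNReal x y
    (by rw [← Real.toNNReal_add ha.le hb.le, hab, Real.toNNReal_one])
  rw [Real.coe_toNNReal _ ha.le, Real.coe_toNNReal _ hb.le] at this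
  simp only [ENNReal.ofReal]
  exact_mod_cast this

/-- Prékopa–Leindler on the line, for functions with supremum one. -/
lemma prekopaLeindler_real_normalized {a b : ℝ} (ha : 0 < a) (hb : 0 < b) (hab : a + b = 1)
    {f g h : ℝ → ℝ≥0∞} (hf : Measurable f) (hg : Measurable g) (hh : Measurable h)
    (hf1 : ∀ x, f x ≤ 1) (hg1 : ∀ x, g x ≤ 1)
    (hfs : ∀ s < 1, ∃ x, s < f x) (hgs : ∀ s < 1, ∃ x, s < g x)
    (H : ∀ x y, f x ^ a * g y ^ b ≤ h (a * x + b * y)) :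
    (∫⁻ x, f x) ^ a * (∫⁻ x, g x) ^ b ≤ ∫⁻ x, h x := by
  have cake : ∀ {k : ℝ → ℝ≥0∞}, Measurable k → (∀ x, k x ≤ 1) →
      ∫⁻ x, k x = ∫⁻ t in Ioi 0, volume {x | ENNReal.ofReal t < k x} := by
    intro k hk hk1
    have hfin : ∀ x, k x ≠ ⊤ := fun x => ne_top_of_le_ne_top ENNReal.one_ne_top (hk1 x)
    have := lintegral_eq_lintegral_meas_lt (volume : Measure ℝ) (f := fun x => (k x).toReal)
      (ae_of_all _ fun x => ENNReal.toReal_nonneg) hk.ennreal_toReal.aemeasurable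
    simp only [ENNReal.ofReal_toReal (hfin _)] at this
    rw [this]
    refine setLIntegral_congr_fun measurableSet_Ioi fun t ht => ?_
    congr 1
    ext x
    simp only [mem_ofPred_eq]
    rw [ENNReal.ofReal_lt_iff_lt_toReal (le_of_lt ht) (hfin x)]
  -- The layer-cake formula `cake` requires the bound one. Truncating h loses nothing, since only
  -- levels below one contribute.
  set h' : ℝ → ℝ≥0∞ := fun x => min (h x) 1 with hh'
  have hm' : Measurable h' := hh.min measurable_const
  have key : ∀ t ∈ Ioi (0 : ℝ), ENNReal.ofReal a * volume {x | ENNReal.ofReal t < f x} +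
      ENNReal.ofReal b * volume {x | ENNReal.ofReal t < g x} ≤
      volume {x | ENNReal.ofReal t < h' x} := by
    intro t ht
    by_cases ht1 : ENNReal.ofReal t < 1
    -- The normalisation is used here: below level one both superlevel sets are nonempty, as
    -- Brunn–Minkowski requires.
    · refine brunnMinkowski_real ha hb (measurableSet_lt measurable_const hf)
        (measurableSet_lt measurable_const hg) (hfs _ ht1) (hgs _ ht1) fun x hx y hy => ?_
      simp only [mem_ofPred_eq, hh', lt_min_iff] at *
      refine ⟨lt_of_lt_of_le ?_ (H x y), ht1⟩
      have ht0 : ENNReal.ofReal t ≠ 0 := by simpa using ht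
      calc ENNReal.ofReal t = ENNReal.ofReal t ^ a * ENNReal.ofReal t ^ b := by
            rw [← ENNReal.rpow_add _ _ ht0 ENNReal.ofReal_ne_top, hab, ENNReal.rpow_one]
        _ < f x ^ a * g y ^ b := ENNReal.mul_lt_mul (ENNReal.rpow_lt_rpow hx ha)
            (ENNReal.rpow_lt_rpow hy hb)
    · have e1 : {x | ENNReal.ofReal t < f x} = ∅ := by
        ext x; simpa using (hf1 x).trans (not_lt.1 ht1)
      have e2 : {x | ENNReal.ofReal t < g x} = ∅ := by
        ext x; simpa using (hg1 x).trans (not_lt.1 ht1)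
      simp [e1, e2]
  have anti : ∀ k : ℝ → ℝ≥0∞, Measurable fun t : ℝ => volume {x | ENNReal.ofReal t < k x} := by
    intro k
    refine Antitone.measurable fun s t hst => measure_mono fun x hx => ?_
    exact lt_of_le_of_lt (ENNReal.ofReal_le_ofReal hst) hx
  calc (∫⁻ x, f x) ^ a * (∫⁻ x, g x) ^ b
      ≤ ENNReal.ofReal a * (∫⁻ x, f x) + ENNReal.ofReal b * ∫⁻ x, g x :=
        ennreal_geom_mean_le_arith_mean ha hb hab _ _
    _ = ∫⁻ t in Ioi 0, (ENNReal.ofReal a * volume {x | ENNReal.ofReal t < f x} +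
          ENNReal.ofReal b * volume {x | ENNReal.ofReal t < g x}) := by
        rw [lintegral_add_left ((anti f).const_mul _), lintegral_const_mul _ (anti f),
          lintegral_const_mul _ (anti g), ← cake hf hf1, ← cake hg hg1]
    _ ≤ ∫⁻ t in Ioi 0, volume {x | ENNReal.ofReal t < h' x} :=
        setLIntegral_mono (anti h') key
    _ = ∫⁻ x, h' x := (cake hm' fun x => min_le_right _ _).symm
    _ ≤ ∫⁻ x, h x := lintegral_mono fun x => min_le_left _ _

/-- Prékopa–Leindler on the line, for bounded functions. -/
lemma prekopaLeindler_real_bounded {a b : ℝ} (ha : 0 < a) (hb : 0 < b) (hab : a + b = 1)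
    {f g h : ℝ → ℝ≥0∞} (hf : Measurable f) (hg : Measurable g) (hh : Measurable h)
    (hf1 : ⨆ x, f x ≠ ⊤) (hg1 : ⨆ x, g x ≠ ⊤)
    (H : ∀ x y, f x ^ a * g y ^ b ≤ h (a * x + b * y)) :
    (∫⁻ x, f x) ^ a * (∫⁻ x, g x) ^ b ≤ ∫⁻ x, h x := by
  set S := ⨆ x, f x
  set T := ⨆ x, g x
  have hfS : ∀ x, f x ≤ S := le_iSup f
  have hgT : ∀ x, g x ≤ T := le_iSup g
  by_cases hS : S = 0
  · have : ∀ x, f x = 0 := fun x => le_antisymm (hS ▸ hfS x) bot_le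
    simp [this, ENNReal.zero_rpow_of_pos ha]
  by_cases hT : T = 0
  · have : ∀ x, g x = 0 := fun x => le_antisymm (hT ▸ hgT x) bot_le
    simp [this, ENNReal.zero_rpow_of_pos hb]
  have norm1 : ∀ {U : ℝ≥0∞}, U ≠ 0 → U ≠ ⊤ → U⁻¹ * U = 1 := fun h0 h1 => ENNReal.inv_mul_cancel h0 h1
  -- The hypothesis is homogeneous: dividing f by S and g by T divides h by S^a T^b.
  have key := prekopaLeindler_real_normalized ha hb hab (f := fun x => S⁻¹ * f x)
    (g := fun x => T⁻¹ * g x) (h := fun x => (S⁻¹ ^ a * T⁻¹ ^ b) * h x)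
    (hf.const_mul _) (hg.const_mul _) (hh.const_mul _)
    (fun x => (by gcongr; exact hfS x : S⁻¹ * f x ≤ S⁻¹ * S).trans_eq (norm1 hS hf1))
    (fun x => (by gcongr; exact hgT x : T⁻¹ * g x ≤ T⁻¹ * T).trans_eq (norm1 hT hg1))
    (fun s hs => by
      have : s * S < S := by
        calc s * S < 1 * S := ENNReal.mul_lt_mul_left hS hf1 hs
          _ = S := one_mul _
      obtain ⟨x, hx⟩ := lt_iSup_iff.1 this
      refine ⟨x, ?_⟩
      rw [mul_comm, ← div_eq_mul_inv, ENNReal.lt_div_iff_mul_lt (Or.inl hS) (Or.inl hf1)]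
      exact hx)
    (fun s hs => by
      have : s * T < T := by
        calc s * T < 1 * T := ENNReal.mul_lt_mul_left hT hg1 hs
          _ = T := one_mul _
      obtain ⟨x, hx⟩ := lt_iSup_iff.1 this
      refine ⟨x, ?_⟩
      rw [mul_comm, ← div_eq_mul_inv, ENNReal.lt_div_iff_mul_lt (Or.inl hT) (Or.inl hg1)]
      exact hx)
    (fun x y => by
      rw [ENNReal.mul_rpow_of_nonneg _ _ ha.le, ENNReal.mul_rpow_of_nonneg _ _ hb.le,
        mul_mul_mul_comm]
      gcongr
      exact H x y)
  rw [lintegral_const_mul _ hf, lintegral_const_mul _ hg, lintegral_const_mul _ hh,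
    ENNReal.mul_rpow_of_nonneg _ _ ha.le, ENNReal.mul_rpow_of_nonneg _ _ hb.le,
    mul_mul_mul_comm] at key
  refine (ENNReal.mul_le_mul_iff_right ?_ ?_).1 key
  · refine mul_ne_zero ?_ ?_
    · simp [ENNReal.rpow_eq_zero_iff, hf1, hS]
    · simp [ENNReal.rpow_eq_zero_iff, hg1, hT]
  · refine ENNReal.mul_ne_top ?_ ?_
    · simp [ENNReal.rpow_eq_top_iff, hf1, hS]
    · simp [ENNReal.rpow_eq_top_iff, hg1, hT]

/-- The Prékopa–Leindler inequality on the line. -/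
lemma prekopaLeindler_real {a b : ℝ} (ha : 0 < a) (hb : 0 < b) (hab : a + b = 1)
    {f g h : ℝ → ℝ≥0∞} (hf : Measurable f) (hg : Measurable g) (hh : Measurable h)
    (H : ∀ x y, f x ^ a * g y ^ b ≤ h (a * x + b * y)) :
    (∫⁻ x, f x) ^ a * (∫⁻ x, g x) ^ b ≤ ∫⁻ x, h x := by
  by_cases hf0 : ∫⁻ x, f x = 0
  · simp [hf0, ENNReal.zero_rpow_of_pos ha]
  by_cases hg0 : ∫⁻ x, g x = 0
  · simp [hg0, ENNReal.zero_rpow_of_pos hb]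
  have trunc : ∀ {k : ℝ → ℝ≥0∞}, Measurable k →
      Tendsto (fun N : ℕ => ∫⁻ x, min (k x) N) atTop (𝓝 (∫⁻ x, k x)) := by
    intro k hk
    refine lintegral_tendsto_of_tendsto_of_monotone (fun N => (hk.min measurable_const).aemeasurable)
      (ae_of_all _ fun x N M hNM => ?_) (ae_of_all _ fun x => ?_)
    · dsimp only
      gcongr
    · have : Tendsto (fun N : ℕ => min (k x) (N : ℝ≥0∞)) atTop (𝓝 (min (k x) ⊤)) :=
        tendsto_const_nhds.min ENNReal.tendsto_nat_nhds_top
      simpa using this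
  refine le_of_tendsto' (ENNReal.Tendsto.mul ((trunc hf).ennrpow_const a) (Or.inl ?_)
    ((trunc hg).ennrpow_const b) (Or.inl ?_)) fun N => ?_
  · simp [ENNReal.rpow_eq_zero_iff, hf0, ha.not_gt]
  · simp [ENNReal.rpow_eq_zero_iff, hg0, hb.not_gt]
  · have fin : ∀ k : ℝ → ℝ≥0∞, ⨆ x, min (k x) (N : ℝ≥0∞) ≠ ⊤ := fun k =>
      ne_top_of_le_ne_top (ENNReal.natCast_ne_top N) (iSup_le fun x => min_le_right _ _)
    refine prekopaLeindler_real_bounded ha hb hab (hf.min measurable_const)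
      (hg.min measurable_const) hh (fin f) (fin g) fun x y => le_trans ?_ (H x y)
    gcongr <;> exact min_le_left _ _

/-- The Prékopa–Leindler inequality on `Fin n → ℝ`. -/
lemma prekopaLeindler_pi {a b : ℝ} (ha : 0 < a) (hb : 0 < b) (hab : a + b = 1) (n : ℕ) :
    ∀ {f g h : (Fin n → ℝ) → ℝ≥0∞}, Measurable f → Measurable g → Measurable h →
    (∀ x y, f x ^ a * g y ^ b ≤ h (a • x + b • y)) →
    (∫⁻ x, f x) ^ a * (∫⁻ x, g x) ^ b ≤ ∫⁻ x, h x := by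
  induction n with
  | zero =>
    intro f g h hf hg hh H
    rw [volume_pi, Measure.pi_of_empty (x := 0)]
    simpa [lintegral_dirac] using H 0 0
  | succ n ih =>
    intro f g h hf hg hh H
    set e := (MeasurableEquiv.piFinSuccAbove (fun _ : Fin (n + 1) => ℝ) 0).symm
    have he := (volume_preserving_piFinSuccAbove (fun _ : Fin (n + 1) => ℝ) 0).symm
    have hlin : ∀ (s t : ℝ) (x y : Fin n → ℝ),
        e (a * s + b * t, a • x + b • y) = a • e (s, x) + b • e (t, y) := by
      intro s t x y
      ext i
      refine Fin.cases ?_ (fun j => ?_) i <;>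
        simp [e, MeasurableEquiv.piFinSuccAbove]
    have fub : ∀ {k : (Fin (n + 1) → ℝ) → ℝ≥0∞}, Measurable k →
        ∫⁻ x, k x = ∫⁻ s : ℝ, ∫⁻ x : Fin n → ℝ, k (e (s, x)) := by
      intro k hk
      rw [← he.lintegral_comp hk, Measure.volume_eq_prod]
      exact lintegral_prod _ (hk.comp e.measurable).aemeasurable
    have meas : ∀ {k : (Fin (n + 1) → ℝ) → ℝ≥0∞}, Measurable k →
        Measurable fun s : ℝ => ∫⁻ x : Fin n → ℝ, k (e (s, x)) := fun hk =>
      (hk.comp e.measurable).lintegral_prod_right'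
    have sl : ∀ {k : (Fin (n + 1) → ℝ) → ℝ≥0∞}, Measurable k → ∀ s : ℝ,
        Measurable fun x : Fin n → ℝ => k (e (s, x)) := fun hk s =>
      (hk.comp e.measurable).comp measurable_prodMk_left
    rw [fub hf, fub hg, fub hh]
    -- Fibre integrals over the first coordinate satisfy the one-dimensional hypothesis, by the
    -- induction hypothesis on each pair of fibres.
    refine prekopaLeindler_real ha hb hab (meas hf) (meas hg) (meas hh) fun s t => ?_
    refine ih (sl hf s) (sl hg t) (sl hh _) fun x y => ?_
    rw [hlin]
    exact H _ _

/-- The Prékopa–Leindler inequality on Euclidean space. -/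
theorem prekopaLeindler {n : ℕ} {a b : ℝ} (ha : 0 < a) (hb : 0 < b) (hab : a + b = 1)
    {f g h : EuclideanSpace ℝ (Fin n) → ℝ≥0∞} (hf : Measurable f) (hg : Measurable g)
    (hh : Measurable h) (H : ∀ x y, f x ^ a * g y ^ b ≤ h (a • x + b • y)) :
    (∫⁻ x, f x) ^ a * (∫⁻ x, g x) ^ b ≤ ∫⁻ x, h x := by
  have e := PiLp.volume_preserving_toLp (Fin n)
  rw [← e.lintegral_comp hf, ← e.lintegral_comp hg, ← e.lintegral_comp hh]
  refine prekopaLeindler_pi ha hb hab n (hf.comp e.measurable) (hg.comp e.measurable)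
    (hh.comp e.measurable) fun x y => ?_
  simpa using H (WithLp.toLp 2 x) (WithLp.toLp 2 y)

end

/-! ### Maurey's argument: the Poincaré inequality for C² functions -/

section

/-- The Prékopa–Leindler form of Maurey's property for a measure whose density is
`1/h`-strongly logconcave on a set `K`. -/
lemma lintegral_exp_mul_lintegral_exp_neg_le {n : ℕ} {h : ℝ}
    {K : Set (EuclideanSpace ℝ (Fin n))} (hK : MeasurableSet K) (hKc : Convex ℝ K)
    {σ : EuclideanSpace ℝ (Fin n) → ℝ} (hσ : Measurable σ) (hσ0 : ∀ x, 0 ≤ σ x)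
    (hlc : ∀ x ∈ K, ∀ y ∈ K, σ x ^ (1 / 2 : ℝ) * σ y ^ (1 / 2 : ℝ) ≤
      σ ((1 / 2 : ℝ) • x + (1 / 2 : ℝ) • y) * Real.exp (-‖x - y‖ ^ 2 / (8 * h)))
    {a b : EuclideanSpace ℝ (Fin n) → ℝ} (ha : Measurable a) (hb : Measurable b)
    (hab : ∀ x ∈ K, ∀ y ∈ K, a x - b y ≤ ‖x - y‖ ^ 2 / (4 * h)) :
    (∫⁻ x, ENNReal.ofReal (Real.exp (a x))
        ∂(volume.restrict K).withDensity fun x => ENNReal.ofReal (σ x)) ^ (1 / 2 : ℝ) *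
      (∫⁻ x, ENNReal.ofReal (Real.exp (-b x))
        ∂(volume.restrict K).withDensity fun x => ENNReal.ofReal (σ x)) ^ (1 / 2 : ℝ) ≤
      ((volume.restrict K).withDensity fun x => ENNReal.ofReal (σ x)) univ := by
  have hσm := hσ.ennreal_ofReal
  rw [lintegral_withDensity_eq_lintegral_mul _ hσm (by fun_prop),
    lintegral_withDensity_eq_lintegral_mul _ hσm (by fun_prop),
    withDensity_apply _ MeasurableSet.univ, Measure.restrict_univ,
    ← lintegral_indicator hK, ← lintegral_indicator hK, ← lintegral_indicator hK]
  -- Weights 1/2 and the functions σ e^a, σ e^(−b), σ cut off to K. Half of the bound in `hab` is ‖x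
  -- − y‖²/(8h), exactly the Gaussian gain in `hlc`.
  refine prekopaLeindler (by norm_num) (by norm_num) (by norm_num)
    (Measurable.indicator (by fun_prop) hK) (Measurable.indicator (by fun_prop) hK)
    (hσm.indicator hK) fun x y => ?_
  by_cases hx : x ∈ K
  swap
  · simp [hx]
  by_cases hy : y ∈ K
  swap
  · simp [hy]
  have hz : (1 / 2 : ℝ) • x + (1 / 2 : ℝ) • y ∈ K :=
    hKc hx hy (by norm_num) (by norm_num) (by norm_num)
  rw [indicator_of_mem hx, indicator_of_mem hy, indicator_of_mem hz]
  simp only [Pi.mul_apply]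
  rw [← ENNReal.ofReal_mul (hσ0 _), ← ENNReal.ofReal_mul (hσ0 _),
    ENNReal.ofReal_rpow_of_nonneg (mul_nonneg (hσ0 _) (Real.exp_pos _).le) (by norm_num),
    ENNReal.ofReal_rpow_of_nonneg (mul_nonneg (hσ0 _) (Real.exp_pos _).le) (by norm_num),
    ← ENNReal.ofReal_mul (by positivity [hσ0 x])]
  refine ENNReal.ofReal_le_ofReal ?_
  rw [Real.mul_rpow (hσ0 _) (Real.exp_pos _).le, Real.mul_rpow (hσ0 _) (Real.exp_pos _).le,
    ← Real.exp_mul, ← Real.exp_mul, mul_mul_mul_comm, ← Real.exp_add]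
  calc _ ≤ (σ ((1 / 2 : ℝ) • x + (1 / 2 : ℝ) • y) * Real.exp (-‖x - y‖ ^ 2 / (8 * h))) *
        Real.exp (‖x - y‖ ^ 2 / (8 * h)) := by
        refine mul_le_mul (hlc x hx y hy) (Real.exp_le_exp.2 ?_) (Real.exp_pos _).le
          (mul_nonneg (hσ0 _) (Real.exp_pos _).le)
        have := hab x hx y hy
        have e : ‖x - y‖ ^ 2 / (8 * h) = ‖x - y‖ ^ 2 / (4 * h) / 2 := by
          rw [div_div]; ring_nf
        rw [e]
        linarith
    _ = _ := by
        rw [mul_assoc, ← Real.exp_add, neg_div, neg_add_cancel, Real.exp_zero, mul_one]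

/-- Second-order Taylor bound on a compact convex set. -/
lemma exists_taylor_bound {E : Type*} [NormedAddCommGroup E] [NormedSpace ℝ E] {K : Set E}
    (hK : IsCompact K) (hKc : Convex ℝ K) {g : E → ℝ} (hg : ContDiff ℝ 2 g) :
    ∃ M : ℝ, 0 ≤ M ∧ ∀ x ∈ K, ∀ y ∈ K,
      |g y - g x - fderiv ℝ g x (y - x)| ≤ M * ‖y - x‖ ^ 2 := by
  have h1 : ContDiff ℝ 1 (fderiv ℝ g) := hg.fderiv_right (by norm_num)
  have h2 : Continuous fun x => ‖fderiv ℝ (fderiv ℝ g) x‖ :=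
    continuous_norm.comp (h1.continuous_fderiv (by norm_num))
  obtain ⟨M, hM⟩ := hK.exists_bound_of_continuousOn h2.continuousOn
  refine ⟨max M 0, le_max_right _ _, fun x hx y hy => ?_⟩
  have hseg : segment ℝ x y ⊆ K := hKc.segment_subset hx hy
  have hlip : ∀ z ∈ segment ℝ x y, ‖fderiv ℝ g z - fderiv ℝ g x‖ ≤ max M 0 * ‖y - x‖ := by
    intro z hz
    have := Convex.norm_image_sub_le_of_norm_fderiv_le (𝕜 := ℝ) (f := fderiv ℝ g) (s := K)
      (C := max M 0)
      (fun w _ => h1.differentiable (by norm_num) w) (fun w hw =>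
        ((norm_norm (fderiv ℝ (fderiv ℝ g) w)).symm.trans_le (hM w hw)).trans (le_max_left _ _))
      hKc hx (hseg hz)
    refine this.trans (mul_le_mul_of_nonneg_left ?_ (le_max_right _ _))
    obtain ⟨s, t, hs, ht, hst, rfl⟩ := hz
    have : s • x + t • y - x = t • (y - x) := by
      have : s = 1 - t := by linarith
      rw [this]; module
    rw [this, norm_smul, Real.norm_of_nonneg ht]
    exact mul_le_of_le_one_left (norm_nonneg _) (by linarith)
  have := Convex.norm_image_sub_le_of_norm_fderiv_le' (𝕜 := ℝ) (f := g) (φ := fderiv ℝ g x)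
    (s := segment ℝ x y) (fun w _ => hg.differentiable (by norm_num) w) hlip
    (convex_segment x y) (left_mem_segment ℝ x y) (right_mem_segment ℝ x y)
  rw [Real.norm_eq_abs] at this
  calc _ ≤ _ := this
    _ = _ := by ring

/-- Taylor's formula with a crude cubic remainder. It expands the exponentials in `poincare_smooth`
uniformly in the space variable. -/
lemma quadratic_sub_cube_le_exp {x : ℝ} (hx : |x| ≤ 1) :
    1 + x + x ^ 2 / 2 - |x| ^ 3 ≤ Real.exp x := by
  have := Real.exp_bound hx (n := 3) (by norm_num)
  norm_num [Finset.sum_range_succ, Nat.factorial] at this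
  have h2 := (abs_le.1 this).1
  have h3 : 0 ≤ |x| ^ 3 := by positivity
  linarith

/-- If the product of two quadratic lower bounds stays below `m²`, then so does its second-order
part. -/
lemma second_order_nonpos {m P Q C : ℝ} 
    (H : ∀ᶠ ε in 𝓝[>] (0 : ℝ),
      (m + ε ^ 2 * P - ε ^ 3 * C) * (m + ε ^ 2 * Q - ε ^ 3 * C) ≤ m ^ 2) :
    m * (P + Q) ≤ 0 := by
  -- The displayed function is (product − m²)/ε².
  have hlim : Tendsto (fun ε : ℝ => m * (P + Q) - 2 * m * C * ε +
      ε ^ 2 * ((P - ε * C) * (Q - ε * C))) (𝓝[>] 0) (𝓝 (m * (P + Q))) := by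
    have : Continuous fun ε : ℝ => m * (P + Q) - 2 * m * C * ε +
      ε ^ 2 * ((P - ε * C) * (Q - ε * C)) := by fun_prop
    have h := this.tendsto 0
    simp only [mul_zero, sub_zero, zero_mul, ne_eq, OfNat.ofNat_ne_zero, not_false_eq_true,
      zero_pow, add_zero] at h
    exact h.mono_left nhdsWithin_le_nhds
  refine le_of_tendsto hlim ?_
  filter_upwards [H, self_mem_nhdsWithin] with ε hε hε0
  have hε0 : 0 < ε := hε0
  have : ε ^ 2 * (m * (P + Q) - 2 * m * C * ε + ε ^ 2 * ((P - ε * C) * (Q - ε * C))) ≤ 0 := by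
    nlinarith
  exact nonpos_of_mul_nonpos_right this (by positivity)

set_option maxHeartbeats 800000 in
/-- The Poincaré inequality for a `1/h`-strongly logconcave measure on a compact convex set, for
functions of class `C²`. -/
lemma poincare_smooth {n : ℕ} {h : ℝ} (hh : 0 < h)
    {K : Set (EuclideanSpace ℝ (Fin n))} (hK : IsCompact K) (hKc : Convex ℝ K)
    {σ : EuclideanSpace ℝ (Fin n) → ℝ} (hσ : Measurable σ) (hσ0 : ∀ x, 0 ≤ σ x)
    (hlc : ∀ x ∈ K, ∀ y ∈ K, σ x ^ (1 / 2 : ℝ) * σ y ^ (1 / 2 : ℝ) ≤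
      σ ((1 / 2 : ℝ) • x + (1 / 2 : ℝ) • y) * Real.exp (-‖x - y‖ ^ 2 / (8 * h)))
    {μ : Measure (EuclideanSpace ℝ (Fin n))}
    (hμ : μ = (volume.restrict K).withDensity fun x => ENNReal.ofReal (σ x))
    [IsFiniteMeasure μ] {g : EuclideanSpace ℝ (Fin n) → ℝ} (hg : ContDiff ℝ 2 g) :
    μ.real univ * ∫ x, g x ^ 2 ∂μ - (∫ x, g x ∂μ) ^ 2 ≤
      h * (μ.real univ * ∫ x, ‖fderiv ℝ g x‖ ^ 2 ∂μ) := by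
  set m := μ.real univ with hm
  have hm0 : 0 ≤ m := measureReal_nonneg
  have hmem : ∀ᵐ x ∂μ, x ∈ K := by
    rw [hμ]
    exact (withDensity_absolutelyContinuous _ _) (ae_restrict_mem hK.measurableSet)
  have hint : ∀ {φ : EuclideanSpace ℝ (Fin n) → ℝ}, Continuous φ → Integrable φ μ := by
    intro φ hφ
    obtain ⟨C, hC⟩ := hK.exists_bound_of_continuousOn hφ.continuousOn
    exact Integrable.of_bound (C := C) hφ.aestronglyMeasurable (hmem.mono hC)
  -- reduction to mean zero
  suffices H : ∀ {g : EuclideanSpace ℝ (Fin n) → ℝ}, ContDiff ℝ 2 g → ∫ x, g x ∂μ = 0 →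
      ∀ k, h < k → m * ∫ x, g x ^ 2 ∂μ ≤ k * (m * ∫ x, ‖fderiv ℝ g x‖ ^ 2 ∂μ) by
    rcases hm0.eq_or_lt with h0 | h0
    · have : μ = 0 := by
        rw [← Measure.measure_univ_eq_zero]
        exact (measureReal_eq_zero_iff).1 h0.symm
      simp [this]
    set c := (∫ x, g x ∂μ) / m with hc
    have hgc : ContDiff ℝ 2 fun x => g x - c := hg.sub contDiff_const
    have e0 : ∫ x, (g x - c) ∂μ = 0 := by
      rw [integral_sub (hint hg.continuous) (integrable_const _), integral_const, smul_eq_mul,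
        ← hm, hc]
      field_simp
      ring
    have e1 : ∫ x, (g x - c) ^ 2 ∂μ = ∫ x, g x ^ 2 ∂μ - (∫ x, g x ∂μ) ^ 2 / m := by
      have : ∀ x, (g x - c) ^ 2 = g x ^ 2 - (2 * c) * g x + c ^ 2 := fun x => by ring
      simp_rw [this]
      have hgc := hg.continuous
      rw [integral_add (hint (by fun_prop)) (integrable_const _),
        integral_sub (hint (by fun_prop)) (hint (by fun_prop)),
        integral_const_mul, integral_const, smul_eq_mul, ← hm, hc]
      field_simp
      ring
    have e2 : ∀ x, fderiv ℝ (fun x => g x - c) x = fderiv ℝ g x := fun x => by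
      rw [fderiv_sub_const]
    have key := H hgc e0
    simp_rw [e2, e1] at key
    have e3 : m * (∫ x, g x ^ 2 ∂μ - (∫ x, g x ∂μ) ^ 2 / m) =
        m * ∫ x, g x ^ 2 ∂μ - (∫ x, g x ∂μ) ^ 2 := by field_simp
    rw [e3] at key
    have hlim : Tendsto (fun k : ℝ => k * (m * ∫ x, ‖fderiv ℝ g x‖ ^ 2 ∂μ)) (𝓝[>] h)
        (𝓝 (h * (m * ∫ x, ‖fderiv ℝ g x‖ ^ 2 ∂μ))) :=
      ((continuous_id.mul continuous_const).tendsto h).mono_left nhdsWithin_le_nhds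
    refine ge_of_tendsto hlim ?_
    filter_upwards [self_mem_nhdsWithin] with k hk using key k hk
  intro g hg hg0 k hk
  obtain ⟨M, hM0, hM⟩ := exists_taylor_bound hK hKc hg
  have hLc : Continuous fun x => ‖fderiv ℝ g x‖ := (hg.continuous_fderiv (by norm_num)).norm
  obtain ⟨B, hB⟩ := hK.exists_bound_of_continuousOn hg.continuous.continuousOn
  obtain ⟨D, hD⟩ := hK.exists_bound_of_continuousOn hLc.continuousOn
  -- To second order in ε this is the infimal convolution of εg with the cost ‖x − y‖²/(4k), whose
  -- minimum sits at distance 2kε‖∇g‖.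
  set a : ℝ → EuclideanSpace ℝ (Fin n) → ℝ := fun ε x => ε * g x - ε ^ 2 * (k * ‖fderiv ℝ g x‖ ^ 2)
    with ha
  have hac : ∀ ε, Continuous (a ε) := fun ε => by
    have := hg.continuous
    fun_prop
  set B' := |B| + k * D ^ 2 with hB'
  have hk0 : 0 < k := hh.trans hk
  have hB'0 : 0 ≤ B' := by positivity
  -- `B' ^ 3` covers the cubic remainders of both exponentials; the other summand covers the cross
  -- term in `a ε x ^ 2 / 2`.
  set C := B' ^ 3 + |B| * (k * D ^ 2) with hC
  have hC1 : |B| ^ 3 ≤ C := by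
    have : |B| ≤ B' := by rw [hB']; have : 0 ≤ k * D ^ 2 := by positivity
                          linarith
    have h1 := pow_le_pow_left₀ (abs_nonneg B) this 3
    have : 0 ≤ |B| * (k * D ^ 2) := by positivity
    linarith
  -- Maurey's inequality
  have main : ∀ᶠ ε in 𝓝[>] (0 : ℝ),
      (∫ x, Real.exp (a ε x) ∂μ) * ∫ x, Real.exp (-(ε * g x)) ∂μ ≤ m ^ 2 := by
    -- This smallness of ε makes the Taylor error εM‖y − x‖² fit into the gap between ‖y − x‖²/(4k)
    -- and ‖y − x‖²/(4h).
    have hev : ∀ᶠ ε in 𝓝[>] (0 : ℝ), h ≤ k * (1 - 4 * h * ε * M) := by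
      have : Tendsto (fun ε : ℝ => k * (1 - 4 * h * ε * M)) (𝓝[>] 0) (𝓝 k) := by
        have h1 : Continuous fun ε : ℝ => k * (1 - 4 * h * ε * M) := by fun_prop
        have h2 := h1.tendsto 0
        simp only [mul_zero, zero_mul, sub_zero, mul_one] at h2
        exact h2.mono_left nhdsWithin_le_nhds
      exact (this.eventually (lt_mem_nhds hk)).mono fun _ h => h.le
    filter_upwards [hev, self_mem_nhdsWithin] with ε hε hε0
    have hε0 : 0 < ε := hε0
    have hml := lintegral_exp_mul_lintegral_exp_neg_le hK.measurableSet hKc hσ hσ0 hlc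
      (a := a ε) (b := fun x => ε * g x) (hac ε).measurable
      (by have := hg.continuous; fun_prop) (fun x hx y hy => by
        have h1 := (abs_le.1 (hM x hx y hy)).1
        have h2 : |fderiv ℝ g x (y - x)| ≤ ‖fderiv ℝ g x‖ * ‖y - x‖ :=
          (fderiv ℝ g x).le_opNorm _
        have h3 := (abs_le.1 h2).1
        rw [norm_sub_rev x y]
        simp only [ha]
        set s := ‖y - x‖
        set l := ‖fderiv ℝ g x‖
        have h4 : ε * (g x - g y) ≤ ε * (l * s + M * s ^ 2) := by
          refine mul_le_mul_of_nonneg_left ?_ hε0.le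
          linarith
        have h5 : ε * l * s ≤ ε ^ 2 * (k * l ^ 2) + s ^ 2 / (4 * k) := by
          have : 0 ≤ (s - 2 * k * ε * l) ^ 2 / (4 * k) := by positivity
          have e : (s - 2 * k * ε * l) ^ 2 / (4 * k) =
            ε ^ 2 * (k * l ^ 2) + s ^ 2 / (4 * k) - ε * l * s := by
              field_simp
              ring
          linarith
        have h6 : s ^ 2 / (4 * k) + ε * M * s ^ 2 ≤ s ^ 2 / (4 * h) := by
          have e : s ^ 2 / (4 * h) - (s ^ 2 / (4 * k) + ε * M * s ^ 2) =
            s ^ 2 * (k * (1 - 4 * h * ε * M) - h) / (4 * h * k) := by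
              field_simp
              ring
          have : 0 ≤ s ^ 2 * (k * (1 - 4 * h * ε * M) - h) / (4 * h * k) := by
            have : 0 ≤ k * (1 - 4 * h * ε * M) - h := by linarith
            positivity
          linarith
        nlinarith)
    rw [← hμ, ← ofReal_integral_eq_lintegral_ofReal (hint (by have := hac ε; fun_prop))
        (ae_of_all _ fun x => (Real.exp_pos _).le),
      ← ofReal_integral_eq_lintegral_ofReal (hint (by have := hg.continuous; fun_prop))
        (ae_of_all _ fun x => (Real.exp_pos _).le),
      ← ENNReal.mul_rpow_of_nonneg _ _ (by norm_num),
      ← ENNReal.ofReal_mul (integral_nonneg fun x => (Real.exp_pos _).le)] at hml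
    have hml2 := ENNReal.rpow_le_rpow hml (z := 2) (by norm_num)
    rw [← ENNReal.rpow_mul] at hml2
    norm_num at hml2
    rw [← ENNReal.ofReal_toReal (measure_ne_top μ univ), ← ENNReal.ofReal_pow (by positivity)] at hml2
    exact (ENNReal.ofReal_le_ofReal_iff (by positivity)).1 hml2
  have low : ∀ᶠ ε in 𝓝[>] (0 : ℝ), 0 < ε ∧ ε < 1 ∧ ε * B' ≤ 1 := by
    have h1 : Tendsto (fun ε : ℝ => ε * B') (𝓝[>] 0) (𝓝 0) := by
      have h1 : Continuous fun ε : ℝ => ε * B' := by fun_prop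
      have h2 := h1.tendsto 0
      simp only [zero_mul] at h2
      exact h2.mono_left nhdsWithin_le_nhds
    filter_upwards [self_mem_nhdsWithin, (h1.eventually (gt_mem_nhds one_pos)),
      nhdsWithin_le_nhds (gt_mem_nhds (one_pos (α := ℝ)))] with ε h0 h3 h4
    exact ⟨h0, h4, h3.le⟩
  set A := ∫ x, g x ^ 2 ∂μ
  set J := ∫ x, ‖fderiv ℝ g x‖ ^ 2 ∂μ
  have hgc := hg.continuous
  -- Multiplying the two lower bounds requires one of them to be nonnegative. For m = 0 the measure
  -- is zero and the expression vanishes.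
  have hpos : ∀ᶠ ε in 𝓝[>] (0 : ℝ), 0 ≤ m + ε ^ 2 * (A / 2) - ε ^ 3 * (C * m) := by
    have hc : Continuous fun ε : ℝ => m + ε ^ 2 * (A / 2) - ε ^ 3 * (C * m) := by fun_prop
    have hc2 := hc.tendsto 0
    simp only [ne_eq, OfNat.ofNat_ne_zero, not_false_eq_true, zero_pow, zero_mul, add_zero,
      sub_zero] at hc2
    rcases hm0.eq_or_lt with h0 | h0
    · have : μ = 0 := by
        rw [← Measure.measure_univ_eq_zero]
        exact (measureReal_eq_zero_iff).1 h0.symm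
      have hA : A = 0 := by simp [A, this]
      simp [hA, ← h0]
    · exact nhdsWithin_le_nhds ((hc2.eventually (lt_mem_nhds h0)).mono fun _ h => h.le)
  have hfin := second_order_nonpos (m := m) (P := A / 2 - k * J) (Q := A / 2) (C := C * m) (by
    filter_upwards [main, low, hpos] with ε hε ⟨hε0, hε1, hεB⟩ hpos
    refine le_trans ?_ hε
    have b2 : m + ε ^ 2 * (A / 2) - ε ^ 3 * (C * m) ≤ ∫ x, Real.exp (-(ε * g x)) ∂μ := by
      have : ∫ x, (1 - ε * g x + ε ^ 2 / 2 * g x ^ 2 - ε ^ 3 * C) ∂μ =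
          m + ε ^ 2 * (A / 2) - ε ^ 3 * (C * m) := by
        rw [integral_sub (hint (by fun_prop)) (hint (by fun_prop)),
          integral_add (hint (by fun_prop)) (hint (by fun_prop)),
          integral_sub (hint (by fun_prop)) (hint (by fun_prop)),
          integral_const_mul, integral_const_mul, hg0, integral_const, integral_const,
          smul_eq_mul, smul_eq_mul, ← hm]
        ring
      rw [← this]
      refine integral_mono_ae (hint (by fun_prop)) (hint (by fun_prop)) ?_
      filter_upwards [hmem] with x hx
      have hgx : |g x| ≤ |B| := (hB x hx).trans (le_abs_self B)
      have h1 : |-(ε * g x)| ≤ ε * |B| := by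
        rw [abs_neg, abs_mul, abs_of_pos hε0]; gcongr
      have h2 : ε * |B| ≤ ε * B' := by
        gcongr; rw [hB']; have : 0 ≤ k * D ^ 2 := by positivity
        linarith
      have h3 := quadratic_sub_cube_le_exp (h1.trans (h2.trans hεB))
      have h4 : |-(ε * g x)| ^ 3 ≤ ε ^ 3 * C := by
        calc _ ≤ (ε * |B|) ^ 3 := by gcongr
          _ = ε ^ 3 * |B| ^ 3 := by ring
          _ ≤ _ := by gcongr
      linarith
    have b1 : m + ε ^ 2 * (A / 2 - k * J) - ε ^ 3 * (C * m) ≤ ∫ x, Real.exp (a ε x) ∂μ := by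
      have : ∫ x, (1 + ε * g x + (ε ^ 2 / 2 * g x ^ 2 - ε ^ 2 * k * ‖fderiv ℝ g x‖ ^ 2)
            - ε ^ 3 * C) ∂μ =
          m + ε ^ 2 * (A / 2 - k * J) - ε ^ 3 * (C * m) := by
        rw [integral_sub (hint (by fun_prop)) (hint (by fun_prop)),
          integral_add (hint (by fun_prop)) (hint (by fun_prop)),
          integral_add (hint (by fun_prop)) (hint (by fun_prop)),
          integral_sub (hint (by fun_prop)) (hint (by fun_prop)),
          integral_const_mul, integral_const_mul, integral_const_mul, hg0, integral_const,
          integral_const, smul_eq_mul, smul_eq_mul, ← hm]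
        ring
      rw [← this]
      refine integral_mono_ae (hint (by fun_prop)) (hint (by have := hac ε; fun_prop)) ?_
      filter_upwards [hmem] with x hx
      have hgx : |g x| ≤ |B| := (hB x hx).trans (le_abs_self B)
      have hLx : ‖fderiv ℝ g x‖ ≤ D := by simpa using hD x hx
      set l := ‖fderiv ℝ g x‖ with hl
      have hl0 : 0 ≤ l := norm_nonneg _
      have hkl : k * l ^ 2 ≤ k * D ^ 2 := by gcongr
      have h1 : |a ε x| ≤ ε * B' := by
        simp only [ha, ← hl]
        calc _ ≤ |ε * g x| + |ε ^ 2 * (k * l ^ 2)| := abs_sub _ _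
          _ = ε * |g x| + ε ^ 2 * (k * l ^ 2) := by
            rw [abs_mul, abs_of_pos hε0, abs_of_nonneg (by positivity : 0 ≤ ε ^ 2 * (k * l ^ 2))]
          _ ≤ ε * |B| + ε * (k * D ^ 2) := by
            have : ε ^ 2 ≤ ε := by nlinarith
            gcongr
          _ = _ := by rw [hB']; ring
      have h3 := quadratic_sub_cube_le_exp (h1.trans hεB)
      have h4 : |a ε x| ^ 3 ≤ ε ^ 3 * B' ^ 3 := by
        calc _ ≤ (ε * B') ^ 3 := by gcongr
          _ = _ := by ring
      have h5 : ε ^ 2 * g x ^ 2 - 2 * (ε ^ 3 * (|B| * (k * D ^ 2))) ≤ a ε x ^ 2 := by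
        simp only [ha, ← hl]
        have h6 : g x * (k * l ^ 2) ≤ |B| * (k * D ^ 2) := by
          calc _ ≤ |g x| * (k * l ^ 2) := by gcongr; exact le_abs_self _
            _ ≤ _ := by gcongr
        have h7 : 0 ≤ (ε ^ 2 * (k * l ^ 2)) ^ 2 := by positivity
        have h8 := mul_le_mul_of_nonneg_left h6 (by positivity : 0 ≤ ε ^ 3)
        nlinarith
      have h9 : a ε x = ε * g x - ε ^ 2 * k * l ^ 2 := by simp only [ha, ← hl]; ring
      rw [hC]
      linarith
    have hexp : 0 ≤ ∫ x, Real.exp (a ε x) ∂μ := integral_nonneg fun x => (Real.exp_pos _).le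
    exact mul_le_mul b1 b2 hpos hexp)
  nlinarith

end

/-! ### Mollification in L² -/

section

/-- Dominated convergence with converging dominating functions, for functions tending to zero. -/
lemma tendsto_lintegral_zero_of_dominated {α : Type*} [MeasurableSpace α] {μ : Measure α}
    {D B : ℕ → α → ℝ≥0∞} {b : α → ℝ≥0∞} (hD : ∀ k, Measurable (D k)) (hB : ∀ k, Measurable (B k))
    (hb : Measurable b) (hDB : ∀ k x, D k x ≤ B k x)
    (hD0 : ∀ᵐ x ∂μ, Tendsto (fun k => D k x) atTop (𝓝 0))
    (hBb : ∀ᵐ x ∂μ, Tendsto (fun k => B k x) atTop (𝓝 (b x)))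
    (hint : ∀ k, ∫⁻ x, B k x ∂μ = ∫⁻ x, b x ∂μ) (hfin : ∫⁻ x, b x ∂μ ≠ ⊤) :
    Tendsto (fun k => ∫⁻ x, D k x ∂μ) atTop (𝓝 0) := by
  -- Pointwise D ≤ min(D, b) + (B − min(B, b)). The first integral tends to zero by dominated
  -- convergence, the second because B and b have equal integrals and min(B, b) → b.
  have h1 : Tendsto (fun k => ∫⁻ x, min (D k x) (b x) ∂μ) atTop (𝓝 0) := by
    have := tendsto_lintegral_of_dominated_convergence (μ := μ) (F := fun k x => min (D k x) (b x))
      (f := fun _ => 0) b (fun k => (hD k).min hb) (fun k => ae_of_all _ fun x => min_le_right _ _)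
      hfin (by
        filter_upwards [hD0] with x hx
        simpa using hx.min (tendsto_const_nhds (x := b x)))
    simpa using this
  have h2 : Tendsto (fun k => ∫⁻ x, min (B k x) (b x) ∂μ) atTop (𝓝 (∫⁻ x, b x ∂μ)) :=
    tendsto_lintegral_of_dominated_convergence b (fun k => (hB k).min hb)
      (fun k => ae_of_all _ fun x => min_le_right _ _) hfin (by
        filter_upwards [hBb] with x hx
        simpa using hx.min (tendsto_const_nhds (x := b x)))
  have h3 : Tendsto (fun k => ∫⁻ x, b x ∂μ - ∫⁻ x, min (B k x) (b x) ∂μ) atTop (𝓝 0) := by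
    have := ENNReal.Tendsto.sub (tendsto_const_nhds (x := ∫⁻ x, b x ∂μ) (f := atTop (α := ℕ))) h2
      (Or.inl hfin)
    simpa using this
  have h4 := h1.add h3
  rw [add_zero] at h4
  refine tendsto_of_tendsto_of_tendsto_of_le_of_le tendsto_const_nhds h4 (fun _ => bot_le)
    fun k => ?_
  have hfk : ∫⁻ x, min (B k x) (b x) ∂μ ≠ ⊤ :=
    ne_top_of_le_ne_top hfin (lintegral_mono fun x => min_le_right _ _)
  calc ∫⁻ x, D k x ∂μ ≤ ∫⁻ x, (min (D k x) (b x) + (B k x - min (B k x) (b x))) ∂μ := by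
        refine lintegral_mono fun x => ?_
        dsimp only
        rcases le_total (D k x) (b x) with h | h
        · rw [min_eq_left h]; exact le_self_add
        · rw [min_eq_right h, min_eq_right (h.trans (hDB k x))]
          rw [add_tsub_cancel_of_le (h.trans (hDB k x))]
          exact hDB k x
    _ = ∫⁻ x, min (D k x) (b x) ∂μ + (∫⁻ x, B k x ∂μ - ∫⁻ x, min (B k x) (b x) ∂μ) := by
        rw [lintegral_add_left ((hD k).min hb), lintegral_sub ((hB k).min hb) hfk
          (ae_of_all _ fun x => min_le_left _ _)]
    _ = _ := by rw [hint k]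

section Mollify

open ContinuousLinearMap Convolution

variable {n : ℕ} {F : Type*} [NormedAddCommGroup F] [InnerProductSpace ℝ F] [CompleteSpace F]

/-- Jensen's inequality for the square norm of a mollified function. -/
lemma norm_sq_convolution_le (φ : ContDiffBump (0 : EuclideanSpace ℝ (Fin n)))
    {g : EuclideanSpace ℝ (Fin n) → F} (hg : Integrable g)
    (hg2 : Integrable fun x => ‖g x‖ ^ 2) (x : EuclideanSpace ℝ (Fin n)) :
    ‖(φ.normed volume ⋆[lsmul ℝ ℝ, volume] g) x‖ ^ 2 ≤
      (φ.normed volume ⋆[lsmul ℝ ℝ, volume] fun x => ‖g x‖ ^ 2) x := by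
  rw [convolution_lsmul_swap, convolution_lsmul_swap]
  set ψ : EuclideanSpace ℝ (Fin n) → ℝ := fun t => φ.normed volume (x - t) with hψ
  have hψc : Continuous ψ := φ.continuous_normed.comp (by fun_prop)
  have hψ0 : ∀ t, 0 ≤ ψ t := fun t => φ.nonneg_normed _
  have hψ1 : ∫ t, ψ t = 1 := by
    rw [← φ.integral_normed (μ := volume)]
    exact integral_sub_left_eq_self (fun t => φ.normed volume t) volume x
  have hψi : Integrable ψ := (φ.integrable_normed (μ := volume)).comp_sub_left x
  obtain ⟨C, hC⟩ : ∃ C, ∀ t, ‖ψ t‖ ≤ C := by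
    obtain ⟨C, hC⟩ := φ.continuous_normed.bounded_above_of_compact_support
      (φ.hasCompactSupport_normed (μ := (volume : Measure (EuclideanSpace ℝ (Fin n)))))
    exact ⟨C, fun t => hC _⟩
  have i1 : Integrable fun t => ψ t • g t :=
    hg.bdd_smul C hψc.aestronglyMeasurable (ae_of_all _ hC)
  have i2 : Integrable fun t => ψ t • ‖g t‖ ^ 2 :=
    hg2.bdd_smul C hψc.aestronglyMeasurable (ae_of_all _ hC)
  set c := ∫ t, ψ t • g t with hc
  have i3 : Integrable fun t => inner ℝ c (ψ t • g t) := i1.const_inner c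
  -- Jensen by expanding the variance of g under the probability density ψ, whose mean is c.
  have h0 : 0 ≤ ∫ t, ψ t * ‖g t - c‖ ^ 2 :=
    integral_nonneg fun t => mul_nonneg (hψ0 t) (by positivity)
  have e : ∀ t, ψ t * ‖g t - c‖ ^ 2 =
      ψ t • ‖g t‖ ^ 2 - 2 * inner ℝ c (ψ t • g t) + ψ t * ‖c‖ ^ 2 := by
    intro t
    rw [norm_sub_sq_real, inner_smul_right, real_inner_comm, smul_eq_mul]
    ring
  simp_rw [e] at h0
  have i4 : Integrable fun t => ψ t • ‖g t‖ ^ 2 - 2 * inner ℝ c (ψ t • g t) :=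
    i2.sub (i3.const_mul 2)
  rw [integral_add i4 (hψi.mul_const _), integral_sub i2 (i3.const_mul 2),
    integral_const_mul, integral_mul_const, hψ1, integral_inner i1, ← hc,
    real_inner_self_eq_norm_sq] at h0
  linarith

/-- Mollifications converge in `L²`. -/
lemma tendsto_lintegral_convolution_sub {φ : ℕ → ContDiffBump (0 : EuclideanSpace ℝ (Fin n))}
    (hφ : Tendsto (fun k => (φ k).rOut) atTop (𝓝 0)) (hφ' : ∀ k, (φ k).rOut ≤ 2 * (φ k).rIn)
    {g : EuclideanSpace ℝ (Fin n) → F} (hg : Integrable g)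
    (hg2 : Integrable fun x => ‖g x‖ ^ 2) :
    Tendsto (fun k => ∫⁻ x, ‖((φ k).normed volume ⋆[lsmul ℝ ℝ, volume] g) x - g x‖ₑ ^ 2) atTop
      (𝓝 0) := by
  obtain ⟨g', hg'm, hgg'⟩ := hg.aestronglyMeasurable
  -- A mollification depends only on the almost-everywhere class of g, so a strongly measurable
  -- representative may be used.
  wlog hgm : StronglyMeasurable g generalizing g
  · have hconv : ∀ k x, ((φ k).normed volume ⋆[lsmul ℝ ℝ, volume] g) x =
        ((φ k).normed volume ⋆[lsmul ℝ ℝ, volume] g') x := by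
      intro k x
      rw [convolution_lsmul_swap, convolution_lsmul_swap]
      exact integral_congr_ae (hgg'.mono fun t ht => by simp only [ht])
    have := this (hg.congr hgg') (hg2.congr (hgg'.mono fun t ht => by simp only [ht]))
      ae_eq_rfl hg'm
    refine this.congr fun k => lintegral_congr_ae (hgg'.mono fun t ht => ?_)
    simp only [hconv, ht]
  set G2 : EuclideanSpace ℝ (Fin n) → ℝ := fun x => ‖g x‖ ^ 2 with hG2
  have hcm : ∀ k, Continuous ((φ k).normed volume ⋆[lsmul ℝ ℝ, volume] g) := fun k =>
    (φ k).hasCompactSupport_normed.continuous_convolution_left _ (φ k).continuous_normed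
      hg.locallyIntegrable
  have hcm2 : ∀ k, Continuous ((φ k).normed volume ⋆[lsmul ℝ ℝ, volume] G2) := fun k =>
    (φ k).hasCompactSupport_normed.continuous_convolution_left _ (φ k).continuous_normed
      hg2.locallyIntegrable
  have hG2m : Measurable G2 := (hgm.norm.pow 2).measurable
  have hnn : ∀ k x, 0 ≤ ((φ k).normed volume ⋆[lsmul ℝ ℝ, volume] G2) x := fun k x =>
    (sq_nonneg _).trans (norm_sq_convolution_le (φ k) hg hg2 x)
  have hi : ∀ k, Integrable ((φ k).normed volume ⋆[lsmul ℝ ℝ, volume] G2) := fun k =>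
    ((φ k).integrable_normed).integrable_convolution _ hg2
  have hint : ∀ k, ∫ x, ((φ k).normed volume ⋆[lsmul ℝ ℝ, volume] G2) x = ∫ x, G2 x := by
    intro k
    rw [integral_convolution _ (φ k).integrable_normed hg2, (φ k).integral_normed]
    simp
  -- By Jensen the squared difference is at most 2 φ_k ⋆ |g|² + 2|g|². These majorants converge
  -- almost everywhere to 4|g|² and all have its integral.
  refine tendsto_lintegral_zero_of_dominated
    (B := fun k x => ENNReal.ofReal (2 * ((φ k).normed volume ⋆[lsmul ℝ ℝ, volume] G2) x +
      2 * G2 x)) (b := fun x => ENNReal.ofReal (4 * G2 x))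
    (fun k => ((hcm k).stronglyMeasurable.sub hgm).enorm.pow_const 2)
    (fun k => (((hcm2 k).measurable.const_mul 2).add (hG2m.const_mul 2)).ennreal_ofReal)
    (hG2m.const_mul 4).ennreal_ofReal ?_ ?_ ?_ ?_ ?_
  · intro k x
    rw [← ofReal_norm, ← ENNReal.ofReal_pow (norm_nonneg _)]
    refine ENNReal.ofReal_le_ofReal ?_
    have h1 := norm_sq_convolution_le (φ k) hg hg2 x
    have h2 := norm_sub_le (((φ k).normed volume ⋆[lsmul ℝ ℝ, volume] g) x) (g x)
    set u := ‖((φ k).normed volume ⋆[lsmul ℝ ℝ, volume] g) x‖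
    have h3 : ‖((φ k).normed volume ⋆[lsmul ℝ ℝ, volume] g) x - g x‖ ^ 2 ≤ (u + ‖g x‖) ^ 2 := by
      gcongr
    have h4 : 0 ≤ (u - ‖g x‖) ^ 2 := sq_nonneg _
    simp only [hG2] at h1 ⊢
    nlinarith
  · filter_upwards [ContDiffBump.ae_convolution_tendsto_right_of_locallyIntegrable hφ
      (Eventually.of_forall hφ') hg.locallyIntegrable] with x hx
    have := ENNReal.Tendsto.pow (n := 2) (hx.sub_const (g x)).enorm
    simpa using this
  · filter_upwards [ContDiffBump.ae_convolution_tendsto_right_of_locallyIntegrable hφ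
      (Eventually.of_forall hφ') hg2.locallyIntegrable] with x hx
    refine ENNReal.tendsto_ofReal ?_
    have := (hx.const_mul 2).add_const (2 * G2 x)
    convert this using 2
    simp only [hG2]
    ring
  · intro k
    have hi2 : Integrable fun x => 2 * ((φ k).normed volume ⋆[lsmul ℝ ℝ, volume] G2) x +
        2 * G2 x := ((hi k).const_mul 2).add (hg2.const_mul 2)
    rw [← ofReal_integral_eq_lintegral_ofReal hi2
        (ae_of_all _ fun x => by
          have := hnn k x
          simp only [Pi.zero_apply, hG2]; positivity),
      ← ofReal_integral_eq_lintegral_ofReal (hg2.const_mul 4)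
        (ae_of_all _ fun x => by simp only [Pi.zero_apply, hG2]; positivity),
      integral_add ((hi k).const_mul 2) (hg2.const_mul 2), integral_const_mul, integral_const_mul,
      integral_const_mul, hint]
    congr 1
    simp only [hG2]
    ring
  · exact (hg2.const_mul 4).lintegral_lt_top.ne

end Mollify

/-- Square norms and means converge along `L²`-convergent sequences. -/
lemma tendsto_integral_norm_sq {α F : Type*} [MeasurableSpace α] {μ : Measure α}
    [NormedAddCommGroup F] [InnerProductSpace ℝ F] {u : ℕ → α → F} {g : α → F}
    (hu : ∀ k, MemLp (u k) 2 μ) (hg : MemLp g 2 μ)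
    (h : Tendsto (fun k => ∫⁻ x, ‖u k x - g x‖ₑ ^ 2 ∂μ) atTop (𝓝 0)) :
    Tendsto (fun k => ∫ x, ‖u k x‖ ^ 2 ∂μ) atTop (𝓝 (∫ x, ‖g x‖ ^ 2 ∂μ)) ∧
    ∀ w, MemLp w 2 μ → Tendsto (fun k => ∫ x, inner ℝ (w x) (u k x) ∂μ) atTop
      (𝓝 (∫ x, inner ℝ (w x) (g x) ∂μ)) := by
  have hLp : Tendsto (fun k => (hu k).toLp (u k)) atTop (𝓝 (hg.toLp g)) := by
    rw [Lp.tendsto_Lp_iff_tendsto_eLpNorm'']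
    have := h.ennrpow_const (1 / 2)
    rw [ENNReal.zero_rpow_of_pos (by norm_num)] at this
    refine this.congr fun k => ?_
    rw [eLpNorm_eq_lintegral_rpow_enorm_toReal (by norm_num) (by norm_num)]
    simp
  have hin : ∀ {v w : α → F} (hv : MemLp v 2 μ) (hw : MemLp w 2 μ),
      inner ℝ (hv.toLp v) (hw.toLp w) = ∫ x, inner ℝ (v x) (w x) ∂μ := by
    intro v w hv hw
    rw [L2.inner_def]
    refine integral_congr_ae ?_
    filter_upwards [hv.coeFn_toLp, hw.coeFn_toLp] with x h1 h2
    rw [h1, h2]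
  refine ⟨?_, fun w hw => ?_⟩
  · have := hLp.norm.pow 2
    simpa only [← real_inner_self_eq_norm_sq, hin] using this
  · have := (tendsto_const_nhds (x := hw.toLp w)).inner hLp (𝕜 := ℝ)
    simpa only [hin] using this

end

/-! ### Logconcave densities and mollified weak gradients -/

section

section LogConcave

variable {n : ℕ} {ρ : EuclideanSpace ℝ (Fin n) → ℝ}

lemma IsLogConcaveFun.convex_pos (hρ : IsLogConcaveFun ρ) : Convex ℝ {x | 0 < ρ x} := by
  intro x hx y hy a b ha hb hab
  rcases ha.eq_or_lt with rfl | ha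
  · simp only [zero_add] at hab; simpa [hab] using hy
  rcases hb.eq_or_lt with rfl | hb
  · simp only [add_zero] at hab; simpa [hab] using hx
  exact (mul_pos (Real.rpow_pos_of_pos hx _) (Real.rpow_pos_of_pos hy _)).trans_le
    (hρ.2 x y a b ha hb hab)

/-- The logarithm is concave on the convex positivity set, and finite-dimensional concave functions
are continuous in the interior. -/
lemma IsLogConcaveFun.continuousOn_interior (hρ : IsLogConcaveFun ρ) :
    ContinuousOn ρ (interior {x | 0 < ρ x}) := by
  have hc : ConcaveOn ℝ {x | 0 < ρ x} (fun x => Real.log (ρ x)) := by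
    refine ⟨hρ.convex_pos, fun x hx y hy a b ha hb hab => ?_⟩
    rcases ha.eq_or_lt with rfl | ha
    · simp only [zero_add] at hab; simp [hab]
    rcases hb.eq_or_lt with rfl | hb
    · simp only [add_zero] at hab; simp [hab]
    have hx : 0 < ρ x := hx
    have hy : 0 < ρ y := hy
    have := Real.log_le_log (mul_pos (Real.rpow_pos_of_pos hx _) (Real.rpow_pos_of_pos hy _))
      (hρ.2 x y a b ha hb hab)
    rwa [Real.log_mul (Real.rpow_pos_of_pos hx _).ne' (Real.rpow_pos_of_pos hy _).ne',
      Real.log_rpow hx, Real.log_rpow hy] at this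
  refine (hc.continuousOn_interior.rexp).congr fun x hx => ?_
  have hx' : x ∈ {x | 0 < ρ x} := interior_subset hx
  exact (Real.exp_log hx').symm

/-- The positivity set is convex, so its frontier is Lebesgue null. -/
lemma IsLogConcaveFun.ae_eq_zero (hρ : IsLogConcaveFun ρ) :
    ∀ᵐ x, x ∉ interior {x | 0 < ρ x} → ρ x = 0 := by
  have h0 : volume (frontier {x | 0 < ρ x}) = 0 := hρ.convex_pos.addHaar_frontier volume
  filter_upwards [measure_eq_zero_iff_ae_notMem.1 h0] with x hx hxU
  by_contra h
  exact hx ⟨subset_closure ((hρ.1 x).lt_of_ne' h), hxU⟩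

/-- Weak gradients are tested on the interior of the support, while the Poincaré argument lives
where the density is positive. The inclusion makes test functions of the latter kind admissible. -/
lemma interior_pos_subset_interior_support (hm : Measurable ρ) :
    interior {x | 0 < ρ x} ⊆
      interior (volume.withDensity fun x => ENNReal.ofReal (ρ x)).support := by
  refine interior_maximal (fun x hx => ?_) isOpen_interior
  rw [Measure.mem_support_iff_forall]
  intro V hV
  rw [pos_iff_ne_zero]
  intro h0
  have h1 : interior V ∩ interior {x | 0 < ρ x} ⊆ V := inter_subset_left.trans interior_subset
  have h2 : x ∈ interior V ∩ interior {x | 0 < ρ x} := ⟨mem_interior_iff_mem_nhds.2 hV, hx⟩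
  have ho : IsOpen (interior V ∩ interior {x | 0 < ρ x}) := isOpen_interior.inter isOpen_interior
  have h3 := measure_mono_null h1 h0
  rw [withDensity_apply_eq_zero hm.ennreal_ofReal] at h3
  have h4 : ({x | ENNReal.ofReal (ρ x) ≠ 0} ∩ (interior V ∩ interior {x | 0 < ρ x})) =
      interior V ∩ interior {x | 0 < ρ x} := by
    refine inter_eq_right.2 fun z hz => ?_
    have hz' : z ∈ {x | 0 < ρ x} := interior_subset hz.2
    simpa using hz'
  rw [h4] at h3
  exact (ho.measure_pos volume ⟨x, h2⟩).ne' h3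

/-- Multiplying a logconcave function with a Gaussian density makes it strongly logconcave. -/
lemma IsLogConcaveFun.mul_gaussianDensity (hρ : IsLogConcaveFun ρ) {h : ℝ} (hh : 0 < h)
    (y x x' : EuclideanSpace ℝ (Fin n)) :
    (ρ x * gaussianDensity n h (y - x)) ^ (1 / 2 : ℝ) *
      (ρ x' * gaussianDensity n h (y - x')) ^ (1 / 2 : ℝ) ≤
      (ρ ((1 / 2 : ℝ) • x + (1 / 2 : ℝ) • x') *
        gaussianDensity n h (y - ((1 / 2 : ℝ) • x + (1 / 2 : ℝ) • x'))) *
        Real.exp (-‖x - x'‖ ^ 2 / (8 * h)) := by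
  rw [Real.mul_rpow (hρ.1 _) (gaussianDensity_pos hh _).le,
    Real.mul_rpow (hρ.1 _) (gaussianDensity_pos hh _).le, mul_mul_mul_comm,
    mul_assoc (ρ ((1 / 2 : ℝ) • x + (1 / 2 : ℝ) • x'))]
  -- Only logconcavity of ρ loses anything: for the Gaussian factor the parallelogram law gives an
  -- equality.
  refine mul_le_mul (hρ.2 x x' _ _ (by norm_num) (by norm_num) (by norm_num)) (le_of_eq ?_)
    (mul_nonneg (Real.rpow_nonneg (gaussianDensity_pos hh _).le _)
      (Real.rpow_nonneg (gaussianDensity_pos hh _).le _)) (hρ.1 _)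
  unfold gaussianDensity
  set c := (2 * Real.pi * h) ^ (-(n : ℝ) / 2)
  have hc : 0 < c := by positivity
  rw [Real.mul_rpow hc.le (Real.exp_pos _).le, Real.mul_rpow hc.le (Real.exp_pos _).le,
    mul_mul_mul_comm, ← Real.rpow_add hc, ← Real.exp_mul, ← Real.exp_mul, ← Real.exp_add,
    mul_assoc, ← Real.exp_add]
  rw [show (1 / 2 + 1 / 2 : ℝ) = 1 by norm_num, Real.rpow_one]
  congr 2
  have e1 : y - ((1 / 2 : ℝ) • x + (1 / 2 : ℝ) • x') = (1 / 2 : ℝ) • ((y - x) + (y - x')) := by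
    module
  have e2 : x - x' = (y - x') - (y - x) := by abel
  rw [e1, e2, norm_smul, mul_pow]
  have p := parallelogram_law_with_norm ℝ (y - x') (y - x)
  rw [add_comm (y - x)]
  rw [show ‖(1 / 2 : ℝ)‖ = 1 / 2 by norm_num]
  have e3 : ‖y - x' + (y - x)‖ ^ 2 = 2 * (‖y - x'‖ ^ 2 + ‖y - x‖ ^ 2) -
    ‖y - x' - (y - x)‖ ^ 2 := by linarith
  rw [e3]
  field_simp
  ring

end LogConcave

section Poincare

open ContinuousLinearMap Convolution

variable {n : ℕ}

/-- The derivative of a mollification is the mollification of the weak gradient. -/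
lemma norm_fderiv_convolution_eq {π : Measure (EuclideanSpace ℝ (Fin n))}
    {f : EuclideanSpace ℝ (Fin n) → ℝ} {G : EuclideanSpace ℝ (Fin n) → EuclideanSpace ℝ (Fin n)}
    (hfG : HasWeakGradient π f G) {K' : Set (EuclideanSpace ℝ (Fin n))} (hK' : MeasurableSet K')
    (hK'U : K' ⊆ interior π.support) (hf : IntegrableOn f K') (hG : IntegrableOn G K')
    (φ : ContDiffBump (0 : EuclideanSpace ℝ (Fin n))) {x : EuclideanSpace ℝ (Fin n)}
    (hx : Metric.closedBall x φ.rOut ⊆ K') :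
    ‖fderiv ℝ (φ.normed volume ⋆[lsmul ℝ ℝ, volume] K'.indicator f) x‖ =
      ‖(φ.normed volume ⋆[lsmul ℝ ℝ, volume] K'.indicator G) x‖ := by
  have hf' : Integrable (K'.indicator f) := (integrable_indicator_iff hK').2 hf
  have hG' : Integrable (K'.indicator G) := (integrable_indicator_iff hK').2 hG
  have hφc : ContDiff ℝ 1 (φ.normed (volume : Measure (EuclideanSpace ℝ (Fin n)))) :=
    φ.contDiff_normed
  have hcs := φ.hasCompactSupport_normed (μ := (volume : Measure (EuclideanSpace ℝ (Fin n))))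
  have hD := hcs.hasFDerivAt_convolution_left (lsmul ℝ ℝ) hφc hf'.locallyIntegrable x
  rw [hD.fderiv]
  have hconv : ConvolutionExistsAt (fderiv ℝ (φ.normed volume)) (K'.indicator f) x
      ((lsmul ℝ ℝ : ℝ →L[ℝ] ℝ →L[ℝ] ℝ).precompL (EuclideanSpace ℝ (Fin n))) volume :=
    (hcs.fderiv (𝕜 := ℝ)).convolutionExists_left _ (hφc.continuous_fderiv (by norm_num))
      hf'.locallyIntegrable x
  set w := (φ.normed volume ⋆[lsmul ℝ ℝ, volume] K'.indicator G) x with hw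
  -- The reflected bump t ↦ φ(x − t) is supported in K', hence admissible in `HasWeakGradient`.
  -- Testing with it moves the derivative from the bump onto f.
  set ψ : EuclideanSpace ℝ (Fin n) → ℝ := fun t => φ.normed volume (x - t) with hψ
  have hts : tsupport ψ ⊆ Metric.closedBall x φ.rOut := by
    refine closure_minimal (fun t ht => ?_) Metric.isClosed_closedBall
    have : x - t ∈ Function.support (φ.normed volume) := ht
    rw [φ.support_normed_eq, mem_ball_zero_iff] at this
    rw [mem_closedBall_iff_norm, norm_sub_rev]
    exact this.le
  have hψd : ∀ t v, fderiv ℝ ψ t v = - fderiv ℝ (φ.normed volume) (x - t) v := by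
    intro t v
    have h1 : HasFDerivAt (fun t => x - t) (-ContinuousLinearMap.id ℝ _) t := by
      simpa using (hasFDerivAt_id t).const_sub x
    have h2 := ((hφc.differentiable (by norm_num) (x - t)).hasFDerivAt).comp t h1
    rw [HasFDerivAt.fderiv (f := ψ) h2]
    simp
  have h0 : ∀ t ∉ K', ψ t = 0 ∧ fderiv ℝ ψ t = 0 := by
    intro t ht
    have h1 : t ∉ tsupport ψ := fun h => ht (hx (hts h))
    exact ⟨image_eq_zero_of_notMem_tsupport h1, fderiv_of_notMem_tsupport ℝ h1⟩
  have key : ∀ v, (fderiv ℝ (φ.normed volume)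
      ⋆[(lsmul ℝ ℝ : ℝ →L[ℝ] ℝ →L[ℝ] ℝ).precompL (EuclideanSpace ℝ (Fin n)), volume]
      K'.indicator f) x v = inner ℝ w v := by
    intro v
    have hw2 := hfG ψ (φ.contDiff_normed.comp (by fun_prop))
      (HasCompactSupport.of_support_subset_isCompact (isCompact_closedBall x φ.rOut)
        (subset_closure.trans hts)) ((hts.trans hx).trans hK'U) v
    rw [convolution_eq_swap]
    have hi := hconv.integrable_swap
    rw [ContinuousLinearMap.integral_apply hi]
    have e1 : ∀ t, ((lsmul ℝ ℝ : ℝ →L[ℝ] ℝ →L[ℝ] ℝ).precompL (EuclideanSpace ℝ (Fin n))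
        (fderiv ℝ (φ.normed volume) (x - t)) (K'.indicator f t)) v =
        -(f t * fderiv ℝ ψ t v) := by
      intro t
      rw [precompL_apply, hψd, lsmul_apply, smul_eq_mul]
      by_cases ht : t ∈ K'
      · rw [indicator_of_mem ht]; ring
      · have := (h0 t ht).2
        have h3 := hψd t v
        rw [this] at h3
        rw [indicator_of_notMem ht, ← h3]; simp
    simp_rw [e1]
    rw [integral_neg, hw2, neg_neg, hw, convolution_lsmul_swap, real_inner_comm, ← integral_inner]
    · refine integral_congr_ae (ae_of_all _ fun t => ?_)
      dsimp only
      rw [inner_smul_right]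
      by_cases ht : t ∈ K'
      · rw [indicator_of_mem ht, real_inner_comm]
      · rw [(h0 t ht).1, indicator_of_notMem ht]
        have : φ.normed volume (x - t) = 0 := (h0 t ht).1
        simp
    · have := (hcs.convolutionExists_left (lsmul ℝ ℝ : ℝ →L[ℝ] _ →L[ℝ] _) φ.continuous_normed
        hG'.locallyIntegrable x).integrable_swap
      exact this
  have : (fderiv ℝ (φ.normed volume)
      ⋆[(lsmul ℝ ℝ : ℝ →L[ℝ] ℝ →L[ℝ] ℝ).precompL (EuclideanSpace ℝ (Fin n)), volume]
      K'.indicator f) x = innerSL ℝ w := by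
    ext v
    rw [key, innerSL_apply_apply]
  rw [this, innerSL_apply_norm]

end Poincare

end

/-! ### The Poincaré inequality for H¹ functions -/

section

section PoincareH1

open ContinuousLinearMap Convolution

variable {n : ℕ} {ρ : EuclideanSpace ℝ (Fin n) → ℝ}

/-- The Poincaré inequality for `H¹` functions on compact convex subsets of the support. -/
lemma poincare_compact (hρ : IsLogConcaveFun ρ) (hm : Measurable ρ) {h : ℝ} (hh : 0 < h)
    (y : EuclideanSpace ℝ (Fin n)) {μ : Measure (EuclideanSpace ℝ (Fin n))} [IsFiniteMeasure μ]
    (hμ : μ = volume.withDensity fun x => ENNReal.ofReal (ρ x * gaussianDensity n h (y - x)))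
    {K : Set (EuclideanSpace ℝ (Fin n))} (hK : IsCompact K) (hKc : Convex ℝ K)
    (hKU : K ⊆ interior {x | 0 < ρ x}) {f : EuclideanSpace ℝ (Fin n) → ℝ}
    {G : EuclideanSpace ℝ (Fin n) → EuclideanSpace ℝ (Fin n)} (hf : MemLp f 2 μ) (hG : MemLp G 2 μ)
    (hfG : HasWeakGradient (volume.withDensity fun x => ENNReal.ofReal (ρ x)) f G) :
    μ.real K * ∫ x in K, f x ^ 2 ∂μ - (∫ x in K, f x ∂μ) ^ 2 ≤
      h * (μ.real K * ∫ x in K, ‖G x‖ ^ 2 ∂μ) := by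
  -- At points of K, mollifications of radius at most δ see only the thickening K'. There the
  -- density is continuous and positive on a compact set, so L²(μ) and Lebesgue L² are comparable.
  obtain ⟨δ, hδ, hδU⟩ := hK.exists_cthickening_subset_open isOpen_interior hKU
  set K' := Metric.cthickening δ K with hK'
  have hK'c : IsCompact K' := hK.cthickening
  have hKK' : K ⊆ K' := Metric.self_subset_cthickening K
  set σ : EuclideanSpace ℝ (Fin n) → ℝ := fun x => ρ x * gaussianDensity n h (y - x) with hσ
  have hgc : Continuous fun x => gaussianDensity n h (y - x) :=
    (continuous_gaussianDensity n h).comp (by fun_prop)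
  have hσm : Measurable σ := hm.mul hgc.measurable
  have hσc : ContinuousOn σ K' := (hρ.continuousOn_interior.mono hδU).mul hgc.continuousOn
  have hσpos : ∀ x ∈ K', 0 < σ x := fun x hx => by
    have : x ∈ {x | 0 < ρ x} := interior_subset (hδU hx)
    exact mul_pos this (gaussianDensity_pos hh _)
  obtain ⟨S, hS⟩ := hK'c.exists_bound_of_continuousOn hσc
  obtain ⟨c, hc0, hc⟩ : ∃ c : ℝ, 0 < c ∧ ∀ x ∈ K', c ≤ σ x := by
    rcases K'.eq_empty_or_nonempty with he | hne
    · exact ⟨1, one_pos, by simp [he]⟩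
    · obtain ⟨x0, hx0, hmin⟩ := hK'c.exists_isMinOn hne hσc
      exact ⟨σ x0, hσpos x0 hx0, fun x hx => hmin hx⟩
  -- comparison of the measures
  have hle1 : volume.restrict K' ≤ ENNReal.ofReal c⁻¹ • μ := by
    calc volume.restrict K' = (volume.restrict K').withDensity 1 := (withDensity_one).symm
      _ ≤ (volume.restrict K').withDensity
          (ENNReal.ofReal c⁻¹ • fun x => ENNReal.ofReal (σ x)) := by
          refine withDensity_mono ?_
          filter_upwards [ae_restrict_mem hK'c.measurableSet] with x hx
          simp only [Pi.one_apply, Pi.smul_apply, smul_eq_mul]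
          rw [← ENNReal.ofReal_mul (by positivity), ← ENNReal.ofReal_one]
          refine ENNReal.ofReal_le_ofReal ?_
          rw [inv_mul_eq_div, le_div_iff₀ hc0, one_mul]
          exact hc x hx
      _ = ENNReal.ofReal c⁻¹ • μ.restrict K' := by
          rw [withDensity_smul _ hσm.ennreal_ofReal, hμ, restrict_withDensity hK'c.measurableSet]
      _ ≤ ENNReal.ofReal c⁻¹ • μ := by
          gcongr
          exact Measure.restrict_le_self
  have hμK : μ.restrict K = (volume.restrict K).withDensity fun x => ENNReal.ofReal (σ x) := by
    rw [hμ, restrict_withDensity hK.measurableSet]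
  have hle2 : μ.restrict K ≤ ENNReal.ofReal S • (volume : Measure (EuclideanSpace ℝ (Fin n))) := by
    calc μ.restrict K ≤ (volume.restrict K).withDensity (ENNReal.ofReal S • 1) := by
          rw [hμK]
          refine withDensity_mono ?_
          filter_upwards [ae_restrict_mem hK.measurableSet] with x hx
          simp only [Pi.one_apply, Pi.smul_apply, smul_eq_mul, mul_one]
          exact ENNReal.ofReal_le_ofReal ((le_abs_self _).trans (hS x (hKK' hx)))
      _ = ENNReal.ofReal S • volume.restrict K := by
          rw [withDensity_smul _ measurable_one, withDensity_one]
      _ ≤ _ := by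
          gcongr
          exact Measure.restrict_le_self
  have hf' : MemLp f 2 (volume.restrict K') := hf.of_measure_le_smul ENNReal.ofReal_ne_top hle1
  have hG' : MemLp G 2 (volume.restrict K') := hG.of_measure_le_smul ENNReal.ofReal_ne_top hle1
  have : IsFiniteMeasure (volume.restrict K') := ⟨by
    rw [Measure.restrict_apply_univ]; exact hK'c.measure_lt_top⟩
  set u : EuclideanSpace ℝ (Fin n) → ℝ := K'.indicator f with hu
  set W : EuclideanSpace ℝ (Fin n) → EuclideanSpace ℝ (Fin n) := K'.indicator G with hW
  have hK'm := hK'c.measurableSet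
  have hui : Integrable u := (integrable_indicator_iff hK'm).2 (hf'.integrable (by norm_num))
  have hWi : Integrable W := (integrable_indicator_iff hK'm).2 (hG'.integrable (by norm_num))
  have hu2 : Integrable fun x => ‖u x‖ ^ 2 :=
    ((memLp_indicator_iff_restrict hK'm).2 hf').integrable_norm_pow (by norm_num)
  have hW2 : Integrable fun x => ‖W x‖ ^ 2 :=
    ((memLp_indicator_iff_restrict hK'm).2 hG').integrable_norm_pow (by norm_num)
  set φ : ℕ → ContDiffBump (0 : EuclideanSpace ℝ (Fin n)) := fun k =>
    ⟨δ / (2 * (k + 1)), δ / (k + 1), by positivity, by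
      gcongr
      have : (0 : ℝ) < k + 1 := by positivity
      linarith⟩ with hφ
  have hφ0 : Tendsto (fun k => (φ k).rOut) atTop (𝓝 0) := by
    have := (tendsto_one_div_add_atTop_nhds_zero_nat (𝕜 := ℝ)).const_mul δ
    simp only [mul_zero, mul_one_div] at this
    exact this
  have hφ2 : ∀ k, (φ k).rOut ≤ 2 * (φ k).rIn := fun k => by
    simp only [hφ]
    rw [← mul_div_assoc, mul_div_mul_left _ _ two_ne_zero]
  have hφδ : ∀ k, (φ k).rOut ≤ δ := fun k => by
    simp only [hφ]
    exact div_le_self hδ.le (by simp)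
  have hxK : ∀ k, ∀ x ∈ K, Metric.closedBall x (φ k).rOut ⊆ K' := fun k x hx z hz =>
    Metric.mem_cthickening_of_dist_le z x δ K hx ((Metric.mem_closedBall.1 hz).trans (hφδ k))
  set uk : ℕ → EuclideanSpace ℝ (Fin n) → ℝ := fun k =>
    (φ k).normed volume ⋆[lsmul ℝ ℝ, volume] u with huk
  set Wk : ℕ → EuclideanSpace ℝ (Fin n) → EuclideanSpace ℝ (Fin n) := fun k =>
    (φ k).normed volume ⋆[lsmul ℝ ℝ, volume] W with hWk
  have hukd : ∀ k, ContDiff ℝ 2 (uk k) := fun k =>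
    HasCompactSupport.contDiff_convolution_left (n := 2) _ (φ k).hasCompactSupport_normed
      (φ k).contDiff_normed hui.locallyIntegrable
  have hWkc : ∀ k, Continuous (Wk k) := fun k =>
    (φ k).hasCompactSupport_normed.continuous_convolution_left _ (φ k).continuous_normed
      hWi.locallyIntegrable
  have hmemK : ∀ᵐ x ∂(μ.restrict K), x ∈ K := ae_restrict_mem hK.measurableSet
  -- the inequality for the mollifications
  have step : ∀ k, μ.real K * ∫ x in K, ‖uk k x‖ ^ 2 ∂μ - (∫ x in K, inner ℝ 1 (uk k x) ∂μ) ^ 2 ≤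
      h * (μ.real K * ∫ x in K, ‖Wk k x‖ ^ 2 ∂μ) := by
    intro k
    have := poincare_smooth hh hK hKc hσm (fun x => mul_nonneg (hρ.1 x) (gaussianDensity_pos hh _).le)
      (fun x _ x' _ => hρ.mul_gaussianDensity hh y x x') hμK (hukd k)
    rw [measureReal_restrict_apply_univ] at this
    have e1 : ∫ x in K, ‖fderiv ℝ (uk k) x‖ ^ 2 ∂μ = ∫ x in K, ‖Wk k x‖ ^ 2 ∂μ := by
      refine integral_congr_ae (hmemK.mono fun x hx => ?_)
      dsimp only
      rw [norm_fderiv_convolution_eq hfG hK'm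
        (hδU.trans (interior_pos_subset_interior_support hm)) (hf'.integrable (by norm_num))
        (hG'.integrable (by norm_num)) (φ k) (hxK k x hx)]
    rw [e1] at this
    simpa using this
  have hbK : ∀ {F : Type} [NormedAddCommGroup F] (v : EuclideanSpace ℝ (Fin n) → F),
      Continuous v → AEStronglyMeasurable v (μ.restrict K) → MemLp v 2 (μ.restrict K) := by
    intro F _ v hv hvm
    obtain ⟨C, hC⟩ := hK.exists_bound_of_continuousOn hv.continuousOn
    exact MemLp.of_bound hvm C (hmemK.mono hC)
  have conv : ∀ {F : Type} [NormedAddCommGroup F] (v : ℕ → EuclideanSpace ℝ (Fin n) → F)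
      (g : EuclideanSpace ℝ (Fin n) → F),
      Tendsto (fun k => ∫⁻ x, ‖v k x - g x‖ₑ ^ 2) atTop (𝓝 0) →
      Tendsto (fun k => ∫⁻ x in K, ‖v k x - g x‖ₑ ^ 2 ∂μ) atTop (𝓝 0) := by
    intro F _ v g hv
    have h1 := ENNReal.Tendsto.const_mul (a := ENNReal.ofReal S) hv (Or.inr ENNReal.ofReal_ne_top)
    rw [mul_zero] at h1
    refine tendsto_of_tendsto_of_tendsto_of_le_of_le tendsto_const_nhds h1 (fun _ => bot_le)
      fun k => ?_
    calc _ ≤ ∫⁻ x, ‖v k x - g x‖ₑ ^ 2 ∂(ENNReal.ofReal S • volume) :=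
          lintegral_mono' hle2 le_rfl
      _ = _ := by rw [lintegral_smul_measure, smul_eq_mul]
  have hfu : ∀ᵐ x ∂(μ.restrict K), u x = f x :=
    hmemK.mono fun x hx => indicator_of_mem (hKK' hx) f
  have hGW : ∀ᵐ x ∂(μ.restrict K), W x = G x :=
    hmemK.mono fun x hx => indicator_of_mem (hKK' hx) G
  have huL : MemLp u 2 (μ.restrict K) := (hf.restrict K).ae_eq (hfu.mono fun x hx => hx.symm)
  have hWL : MemLp W 2 (μ.restrict K) := (hG.restrict K).ae_eq (hGW.mono fun x hx => hx.symm)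
  obtain ⟨l1, l2⟩ := tendsto_integral_norm_sq
    (fun k => hbK _ (hukd k).continuous (hukd k).continuous.aestronglyMeasurable) huL
    (conv uk u (tendsto_lintegral_convolution_sub hφ0 hφ2 hui hu2))
  obtain ⟨l3, -⟩ := tendsto_integral_norm_sq
    (fun k => hbK _ (hWkc k) (hWkc k).aestronglyMeasurable) hWL
    (conv Wk W (tendsto_lintegral_convolution_sub hφ0 hφ2 hWi hW2))
  have l4 := l2 (fun _ => 1) (memLp_const 1)
  have := le_of_tendsto_of_tendsto' ((l1.const_mul (μ.real K)).sub (l4.pow 2))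
    ((l3.const_mul (μ.real K)).const_mul h) step
  have e1 : ∫ x in K, ‖u x‖ ^ 2 ∂μ = ∫ x in K, f x ^ 2 ∂μ :=
    integral_congr_ae (hfu.mono fun x hx => by simp [hx])
  have e2 : ∫ x in K, inner ℝ 1 (u x) ∂μ = ∫ x in K, f x ∂μ :=
    integral_congr_ae (hfu.mono fun x hx => by simp [hx])
  have e3 : ∫ x in K, ‖W x‖ ^ 2 ∂μ = ∫ x in K, ‖G x‖ ^ 2 ∂μ :=
    integral_congr_ae (hGW.mono fun x hx => by simp [hx])
  rwa [e1, e2, e3] at this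

/-- The Poincaré inequality for `H¹` functions, for the product of a logconcave function and a
Gaussian density of variance `h`. -/
theorem poincare_H1 (hρ : IsLogConcaveFun ρ) (hm : Measurable ρ) {h : ℝ} (hh : 0 < h)
    (y : EuclideanSpace ℝ (Fin n)) {μ : Measure (EuclideanSpace ℝ (Fin n))} [IsFiniteMeasure μ]
    (hμ : μ = volume.withDensity fun x => ENNReal.ofReal (ρ x * gaussianDensity n h (y - x)))
    {f : EuclideanSpace ℝ (Fin n) → ℝ}
    {G : EuclideanSpace ℝ (Fin n) → EuclideanSpace ℝ (Fin n)} (hf : MemLp f 2 μ) (hG : MemLp G 2 μ)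
    (hfG : HasWeakGradient (volume.withDensity fun x => ENNReal.ofReal (ρ x)) f G) :
    μ.real univ * ∫ x, f x ^ 2 ∂μ - (∫ x, f x ∂μ) ^ 2 ≤
      h * (μ.real univ * ∫ x, ‖G x‖ ^ 2 ∂μ) := by
  set U := interior {x | 0 < ρ x} with hU
  -- Compact exhaustion of U. The points at distance at least 1/(k+1) from the complement form a
  -- convex set because U is convex.
  set K : ℕ → Set (EuclideanSpace ℝ (Fin n)) := fun k =>
    {x | Metric.ball x (1 / ((k : ℝ) + 1)) ⊆ U} ∩ Metric.closedBall 0 k with hK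
  have hUc : Convex ℝ U := hρ.convex_pos.interior
  have hcl : ∀ r : ℝ, IsClosed {x | Metric.ball x r ⊆ U} := by
    intro r
    refine isClosed_of_closure_subset fun x hx z hz => ?_
    rw [Metric.mem_closure_iff] at hx
    obtain ⟨w, hw, hxw⟩ := hx (r - dist z x) (by simpa using hz)
    refine hw ?_
    rw [Metric.mem_ball]
    calc dist z w ≤ dist z x + dist x w := dist_triangle _ _ _
      _ < r := by linarith
  have hcv : ∀ r : ℝ, Convex ℝ {x | Metric.ball x r ⊆ U} := by
    intro r x hx x' hx' a b ha hb hab z hz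
    set d := z - (a • x + b • x') with hd
    have hdr : ‖d‖ < r := by simpa [hd, dist_eq_norm] using hz
    have e : z = a • (x + d) + b • (x' + d) := by
      have : a • (x + d) + b • (x' + d) = (a • x + b • x') + (a + b) • d := by module
      rw [this, hab, one_smul, hd]; abel
    rw [e]
    exact hUc (hx (by simpa using hdr)) (hx' (by simpa using hdr)) ha hb hab
  have hKcomp : ∀ k, IsCompact (K k) := fun k =>
    (isCompact_closedBall 0 (k : ℝ)).inter_left (hcl _)
  have hKconv : ∀ k, Convex ℝ (K k) := fun k => (hcv _).inter (convex_closedBall 0 _)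
  have hKU : ∀ k, K k ⊆ U := fun k x hx => hx.1 (Metric.mem_ball_self (by positivity))
  have hmono : Monotone K := by
    intro k l hkl x hx
    refine ⟨(Metric.ball_subset_ball ?_).trans hx.1, Metric.closedBall_subset_closedBall ?_ hx.2⟩
    · gcongr
    · exact_mod_cast hkl
  have hunion : ⋃ k, K k = U := by
    refine subset_antisymm (iUnion_subset hKU) fun x hx => ?_
    obtain ⟨r, hr, hrU⟩ := Metric.isOpen_iff.1 isOpen_interior x hx
    obtain ⟨k1, hk1⟩ := exists_nat_one_div_lt hr
    obtain ⟨k2, hk2⟩ := exists_nat_ge ‖x‖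
    refine mem_iUnion.2 ⟨max k1 k2, (Metric.ball_subset_ball ?_).trans hrU, ?_⟩
    · refine le_trans ?_ hk1.le
      gcongr
      exact le_max_left _ _
    · rw [mem_closedBall_zero_iff]
      refine hk2.trans ?_
      exact_mod_cast le_max_right _ _
  have hae : ∀ᵐ x ∂μ, x ∈ U := by
    have hgm : Measurable fun x => gaussianDensity n h (y - x) :=
      (continuous_gaussianDensity n h).measurable.comp (by fun_prop)
    rw [hμ, ae_withDensity_iff (by fun_prop)]
    filter_upwards [hρ.ae_eq_zero] with x hx h0
    by_contra hxU
    simp [hx hxU] at h0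
  have hlim : ∀ φ : EuclideanSpace ℝ (Fin n) → ℝ, Integrable φ μ →
      Tendsto (fun k => ∫ x in K k, φ x ∂μ) atTop (𝓝 (∫ x, φ x ∂μ)) := by
    intro φ hφ
    have := tendsto_setIntegral_of_monotone (μ := μ) (f := φ)
      (fun k => (hKcomp k).measurableSet) hmono hφ.integrableOn
    rwa [hunion, setIntegral_eq_integral_of_ae_compl_eq_zero
      (hae.mono fun x hx hx' => absurd hx hx')] at this
  have hlim1 : Tendsto (fun k => μ.real (K k)) atTop (𝓝 (μ.real univ)) := by
    simpa using hlim (fun _ => 1) (integrable_const _)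
  have i1 : Integrable (fun x => f x ^ 2) μ := hf.integrable_sq
  have i2 : Integrable (fun x => ‖G x‖ ^ 2) μ := hG.integrable_norm_pow (by norm_num)
  exact le_of_tendsto_of_tendsto' ((hlim1.mul (hlim _ i1)).sub
    ((hlim _ (hf.integrable (by norm_num))).pow 2))
    ((hlim1.mul (hlim _ i2)).const_mul h)
    fun k => poincare_compact hρ hm hh y hμ (hKcomp k) (hKconv k) (hKU k) hf hG hfG

end PoincareH1

end

/-! ### The heat kernel, its semigroup property and differentiation under the integral -/

section

section Kernel

variable {n : ℕ}

lemma gaussianDensity_le (n : ℕ) {t : ℝ} (ht : 0 < t) (z : EuclideanSpace ℝ (Fin n)) :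
    gaussianDensity n t z ≤ (2 * Real.pi * t) ^ (-(n : ℝ) / 2) := by
  refine mul_le_of_le_one_right (by positivity) (Real.exp_le_one_iff.2 ?_)
  rw [neg_div]
  exact neg_nonpos.2 (by positivity)

lemma norm_gaussianDensity_le (n : ℕ) {t : ℝ} (ht : 0 < t) (z : EuclideanSpace ℝ (Fin n)) :
    ‖gaussianDensity n t z‖ ≤ (2 * Real.pi * t) ^ (-(n : ℝ) / 2) := by
  rw [Real.norm_of_nonneg (gaussianDensity_pos ht _).le]
  exact gaussianDensity_le n ht z

/-- Follows from u e^(−u) ≤ 1 with u = ‖z‖²/(2t). Such bounds, uniform in the centre, provide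
dominating functions and finite posterior second moments without moment assumptions on π. -/
lemma norm_sq_mul_gaussianDensity_le (n : ℕ) {t : ℝ} (ht : 0 < t) (z : EuclideanSpace ℝ (Fin n)) :
    ‖z‖ ^ 2 * gaussianDensity n t z ≤ (2 * Real.pi * t) ^ (-(n : ℝ) / 2) * (2 * t) := by
  unfold gaussianDensity
  rw [mul_left_comm]
  refine mul_le_mul_of_nonneg_left ?_ (by positivity)
  have h1 := Real.add_one_le_exp (‖z‖ ^ 2 / (2 * t))
  have h2 : ‖z‖ ^ 2 = (2 * t) * (‖z‖ ^ 2 / (2 * t)) := by field_simp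
  rw [neg_div, Real.exp_neg, ← div_eq_mul_inv, div_le_iff₀ (Real.exp_pos _)]
  nlinarith

lemma norm_mul_gaussianDensity_le (n : ℕ) {t : ℝ} (ht : 0 < t) (z : EuclideanSpace ℝ (Fin n)) :
    ‖z‖ * gaussianDensity n t z ≤ (2 * Real.pi * t) ^ (-(n : ℝ) / 2) * (2 * t + 1) := by
  have h1 := norm_sq_mul_gaussianDensity_le n ht z
  have h2 := gaussianDensity_le n ht z
  have h3 := (gaussianDensity_pos ht z).le
  have h4 : ‖z‖ ≤ ‖z‖ ^ 2 + 1 := by nlinarith [sq_nonneg (‖z‖ - 1), norm_nonneg z]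
  nlinarith

lemma integrable_gaussianDensity (n : ℕ) {t : ℝ} (ht : 0 < t) :
    Integrable (gaussianDensity n t) := by
  have h1 : IsProbabilityMeasure (gaussian n t) := inferInstance
  rw [gaussian_eq_withDensity ht] at h1
  refine ⟨(continuous_gaussianDensity n t).aestronglyMeasurable, ?_⟩
  rw [hasFiniteIntegral_iff_ofReal (ae_of_all _ fun z => (gaussianDensity_pos ht z).le)]
  have := h1.measure_univ
  rw [withDensity_apply _ MeasurableSet.univ, Measure.restrict_univ] at this
  rw [this]
  exact ENNReal.one_lt_top

lemma integral_gaussianDensity (n : ℕ) {t : ℝ} (ht : 0 < t) :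
    ∫ z, gaussianDensity n t z = 1 := by
  have h1 : IsProbabilityMeasure (gaussian n t) := inferInstance
  rw [gaussian_eq_withDensity ht] at h1
  have := h1.measure_univ
  rw [withDensity_apply _ MeasurableSet.univ, Measure.restrict_univ,
    ← ofReal_integral_eq_lintegral_ofReal (integrable_gaussianDensity n ht)
      (ae_of_all _ fun z => (gaussianDensity_pos ht z).le)] at this
  rwa [ENNReal.ofReal_eq_one] at this

/-- Completing the square in the product of two Gaussian densities. -/
lemma gaussianDensity_mul {s t : ℝ} (hs : 0 < s) (ht : 0 < t) (w Y : EuclideanSpace ℝ (Fin n)) :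
    gaussianDensity n s w * gaussianDensity n t (Y - w) =
      gaussianDensity n (s + t) Y *
        gaussianDensity n (s * t / (s + t)) (w - (s / (s + t)) • Y) := by
  unfold gaussianDensity
  rw [mul_mul_mul_comm, mul_mul_mul_comm ((2 * Real.pi * (s + t)) ^ (-(n : ℝ) / 2)), ← Real.exp_add, ← Real.exp_add,
    ← Real.mul_rpow (by positivity) (by positivity), ← Real.mul_rpow (by positivity) (by positivity)]
  have hst : 0 < s + t := by positivity
  congr 2
  · field_simp
  · rw [norm_sub_sq_real, norm_sub_sq_real, norm_smul, inner_smul_right, real_inner_comm w Y,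
      Real.norm_of_nonneg (by positivity)]
    field_simp
    ring

/-- After completing the square, the z-dependence is a translated Gaussian density of mass one. -/
lemma integral_gaussianDensity_mul {s t : ℝ} (hs : 0 < s) (ht : 0 < t)
    (x y : EuclideanSpace ℝ (Fin n)) :
    ∫ z, gaussianDensity n s (z - x) * gaussianDensity n t (y - z) =
      gaussianDensity n (s + t) (y - x) := by
  have e : ∀ z, gaussianDensity n s (z - x) * gaussianDensity n t (y - z) =
      gaussianDensity n (s + t) (y - x) *
        gaussianDensity n (s * t / (s + t)) (z - (x + (s / (s + t)) • (y - x))) := by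
    intro z
    rw [← sub_sub z, ← gaussianDensity_mul hs ht]
    congr 2
    abel
  simp_rw [e]
  rw [integral_const_mul, integral_sub_right_eq_self (gaussianDensity n (s * t / (s + t))),
    integral_gaussianDensity n (by positivity), mul_one]

lemma gaussian_conv_gaussian (n : ℕ) {s t : ℝ} (hs : 0 ≤ s) (ht : 0 ≤ t) :
    Measure.conv (gaussian n s) (gaussian n t) = gaussian n (s + t) := by
  refine Measure.ext_of_charFun ?_
  ext x
  rw [charFun_conv]
  unfold gaussian
  rw [charFun_multivariateGaussian (Matrix.PosSemidef.one.smul hs),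
    charFun_multivariateGaussian (Matrix.PosSemidef.one.smul ht),
    charFun_multivariateGaussian (Matrix.PosSemidef.one.smul (add_nonneg hs ht)),
    ← Complex.exp_add]
  congr 1
  simp [Matrix.smul_mulVec]
  ring

variable (π : Measure (EuclideanSpace ℝ (Fin n)))

instance (t : ℝ) [IsProbabilityMeasure π] : IsProbabilityMeasure (heatFlow π t) := by
  unfold heatFlow; infer_instance

lemma heatFlow_heatFlow [SFinite π] {s t : ℝ} (hs : 0 ≤ s) (ht : 0 ≤ t) :
    heatFlow (heatFlow π s) t = heatFlow π (s + t) := by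
  unfold heatFlow
  rw [Measure.conv_assoc, gaussian_conv_gaussian n hs ht]

/-- The heat kernel applied to the signed measure `a π`. -/
def heatNum (t : ℝ) (a : EuclideanSpace ℝ (Fin n) → ℝ) (y : EuclideanSpace ℝ (Fin n)) : ℝ :=
  ∫ x, a x * gaussianDensity n t (y - x) ∂π

/-- The Lebesgue density of the heat flow. -/
def heatMass (t : ℝ) (y : EuclideanSpace ℝ (Fin n)) : ℝ :=
  ∫ x, gaussianDensity n t (y - x) ∂π

lemma heatAdjoint_of_pos {t : ℝ} (ht : 0 < t) (f : EuclideanSpace ℝ (Fin n) → ℝ)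
    (y : EuclideanSpace ℝ (Fin n)) : heatAdjoint π t f y = heatNum π t f y / heatMass π t y := by
  rw [heatAdjoint, if_neg ht.ne']; rfl

lemma heatNum_one (t : ℝ) (y : EuclideanSpace ℝ (Fin n)) :
    heatNum π t (fun _ => 1) y = heatMass π t y := by
  simp [heatNum, heatMass]

variable {π}

lemma integrable_mul_gaussianDensity {t : ℝ} (ht : 0 < t) {a : EuclideanSpace ℝ (Fin n) → ℝ}
    (ha : Integrable a π) (y : EuclideanSpace ℝ (Fin n)) :
    Integrable (fun x => a x * gaussianDensity n t (y - x)) π :=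
  ha.mul_bdd ((continuous_gaussianDensity n t).comp (by fun_prop)).aestronglyMeasurable
    (ae_of_all _ fun x => norm_gaussianDensity_le n ht (y - x))

/-- The measure-preserving shear (x, z) ↦ (x, x + z) turns the integrand into a product of
integrable functions. -/
lemma integrable_prod_gaussianDensity [SFinite π] {t : ℝ} (ht : 0 < t)
    {a : EuclideanSpace ℝ (Fin n) → ℝ} (ha : Integrable a π) :
    Integrable (fun p : EuclideanSpace ℝ (Fin n) × EuclideanSpace ℝ (Fin n) =>
      a p.1 * gaussianDensity n t (p.2 - p.1)) (π.prod volume) := by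
  rw [← (measurePreserving_prod_add π (volume :
      Measure (EuclideanSpace ℝ (Fin n)))).integrable_comp_emb
      (MeasurableEquiv.shearAddRight _).measurableEmbedding]
  refine (ha.mul_prod (integrable_gaussianDensity n ht)).congr (ae_of_all _ fun p => ?_)
  simp

lemma integrable_heatNum [SFinite π] {t : ℝ} (ht : 0 < t) {a : EuclideanSpace ℝ (Fin n) → ℝ}
    (ha : Integrable a π) : Integrable (heatNum π t a) :=
  (integrable_prod_gaussianDensity ht ha).integral_prod_right

lemma integral_heatNum [SFinite π] {t : ℝ} (ht : 0 < t) {a : EuclideanSpace ℝ (Fin n) → ℝ}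
    (ha : Integrable a π) : ∫ y, heatNum π t a y = ∫ x, a x ∂π := by
  unfold heatNum
  rw [← integral_integral_swap (f := fun x y => a x * gaussianDensity n t (y - x))
    (integrable_prod_gaussianDensity ht ha)]
  refine integral_congr_ae (ae_of_all _ fun x => ?_)
  dsimp only
  rw [integral_const_mul, integral_sub_right_eq_self (gaussianDensity n t),
    integral_gaussianDensity n ht, mul_one]

/-- Fubini and the convolution identity for Gaussian densities; applied to f and to 1, it yields the
semigroup law for the adjoint. -/
lemma integral_heatNum_mul [SFinite π] {s t : ℝ} (hs : 0 < s) (ht : 0 < t)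
    {a : EuclideanSpace ℝ (Fin n) → ℝ} (ha : Integrable a π) (y : EuclideanSpace ℝ (Fin n)) :
    ∫ z, heatNum π s a z * gaussianDensity n t (y - z) = heatNum π (s + t) a y := by
  have h1 : Integrable (fun p : EuclideanSpace ℝ (Fin n) × EuclideanSpace ℝ (Fin n) =>
      a p.1 * gaussianDensity n s (p.2 - p.1) * gaussianDensity n t (y - p.2)) (π.prod volume) :=
    (integrable_prod_gaussianDensity hs ha).mul_bdd
      ((continuous_gaussianDensity n t).comp (by fun_prop)).aestronglyMeasurable
      (ae_of_all _ fun p => norm_gaussianDensity_le n ht (y - p.2))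
  unfold heatNum
  simp_rw [← integral_mul_const]
  rw [← integral_integral_swap (f := fun x z => a x * gaussianDensity n s (z - x) *
    gaussianDensity n t (y - z)) h1]
  refine integral_congr_ae (ae_of_all _ fun x => ?_)
  dsimp only
  simp_rw [mul_assoc]
  rw [integral_const_mul, integral_gaussianDensity_mul hs ht]

lemma heatMass_pos [IsProbabilityMeasure π] {t : ℝ} (ht : 0 < t) (y : EuclideanSpace ℝ (Fin n)) :
    0 < heatMass π t y := by
  have hi : Integrable (fun x => gaussianDensity n t (y - x)) π := by
    simpa using integrable_mul_gaussianDensity (π := π) ht (integrable_const 1) y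
  refine (integral_pos_iff_support_of_nonneg (fun x => (gaussianDensity_pos ht _).le) hi).2 ?_
  have : (Function.support fun x => gaussianDensity n t (y - x)) = univ :=
    eq_univ_of_forall fun x => (gaussianDensity_pos ht _).ne'
  rw [this]
  simp

/-- The derivative of `heatNum`. -/
lemma hasFDerivAt_heatNum {t : ℝ} (ht : 0 < t) {a : EuclideanSpace ℝ (Fin n) → ℝ}
    (ha : Integrable a π) (y : EuclideanSpace ℝ (Fin n)) :
    HasFDerivAt (heatNum π t a)
      (∫ x, (a x * gaussianDensity n t (y - x)) • (t⁻¹ • innerSL ℝ (x - y)) ∂π) y ∧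
    Integrable (fun x => (a x * gaussianDensity n t (y - x)) • (t⁻¹ • innerSL ℝ (x - y))) π ∧
    Continuous fun y => ∫ x, (a x * gaussianDensity n t (y - x)) • (t⁻¹ • innerSL ℝ (x - y)) ∂π := by
  set c := (2 * Real.pi * t) ^ (-(n : ℝ) / 2)
  set F' : EuclideanSpace ℝ (Fin n) → EuclideanSpace ℝ (Fin n) →
    (EuclideanSpace ℝ (Fin n) →L[ℝ] ℝ) := fun y x =>
    (a x * gaussianDensity n t (y - x)) • (t⁻¹ • innerSL ℝ (x - y)) with hF'
  -- The bound does not involve y, so a single dominating function serves for differentiation and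
  -- for continuity on the whole space.
  have hb : ∀ x y, ‖F' y x‖ ≤ |a x| * (t⁻¹ * (c * (2 * t + 1))) := by
    intro x y
    simp only [hF']
    rw [norm_smul, norm_smul, innerSL_apply_norm, norm_mul, Real.norm_eq_abs (a x),
      Real.norm_of_nonneg (gaussianDensity_pos ht _).le, Real.norm_of_nonneg (by positivity),
      norm_sub_rev x y, mul_assoc]
    refine mul_le_mul_of_nonneg_left ?_ (abs_nonneg _)
    rw [mul_left_comm]
    refine mul_le_mul_of_nonneg_left ?_ (by positivity)
    rw [mul_comm]
    exact norm_mul_gaussianDensity_le n ht (y - x)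
  have hgc : Continuous (gaussianDensity n t) := continuous_gaussianDensity n t
  have hm : ∀ y, AEStronglyMeasurable (F' y) π := fun y => by
    refine AEStronglyMeasurable.smul (ha.aestronglyMeasurable.mul ?_) ?_
    · exact (hgc.comp (by fun_prop)).aestronglyMeasurable
    · exact Continuous.aestronglyMeasurable (by fun_prop)
  have hbi : Integrable (fun x => |a x| * (t⁻¹ * (c * (2 * t + 1)))) π := ha.abs.mul_const _
  refine ⟨?_, hbi.mono' (hm y) (ae_of_all _ fun x => hb x y), ?_⟩
  · refine hasFDerivAt_integral_of_dominated_of_fderiv_le (s := univ) (F' := F')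
      (bound := fun x => |a x| * (t⁻¹ * (c * (2 * t + 1)))) univ_mem
      (Eventually.of_forall fun y => (integrable_mul_gaussianDensity ht ha y).aestronglyMeasurable)
      (integrable_mul_gaussianDensity ht ha y) (hm y) (ae_of_all _ fun x z _ => hb x z) hbi
      (ae_of_all _ fun x z _ => ?_)
    have h1 : HasFDerivAt (fun z : EuclideanSpace ℝ (Fin n) => ‖z - x‖ ^ 2)
        (2 • innerSL ℝ (z - x)) z := by
      have := (hasStrictFDerivAt_norm_sq (z - x)).hasFDerivAt.comp z
        ((hasFDerivAt_id z).sub_const x)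
      simpa [Function.comp_def] using this
    have h1' : HasFDerivAt (fun z : EuclideanSpace ℝ (Fin n) => -‖z - x‖ ^ 2)
        (-(2 • innerSL ℝ (z - x))) z := h1.neg
    have h2 := (((h1'.mul_const (2 * t)⁻¹).exp).const_mul c).const_mul (a x)
    have e1 : (fun z : EuclideanSpace ℝ (Fin n) => a x * gaussianDensity n t (z - x)) =
        fun z => a x * (c * Real.exp (-‖z - x‖ ^ 2 * (2 * t)⁻¹)) := by
      ext w
      simp only [gaussianDensity, div_eq_mul_inv, c]
    rw [e1]
    refine h2.congr_fderiv ?_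
    ext v
    simp only [hF', gaussianDensity, _root_.smul_apply, innerSL_apply_apply,
      smul_eq_mul, _root_.neg_apply, div_eq_mul_inv, nsmul_eq_mul]
    rw [← neg_sub z x, inner_neg_left]
    simp only [c, div_eq_mul_inv]
    push_cast
    field_simp
  · refine continuous_of_dominated hm (fun y => ae_of_all _ fun x => hb x y) hbi
      (ae_of_all _ fun x => ?_)
    exact (continuous_const.mul (hgc.comp (by fun_prop))).smul (by fun_prop)

lemma continuous_heatNum {t : ℝ} (ht : 0 < t) {a : EuclideanSpace ℝ (Fin n) → ℝ}
    (ha : Integrable a π) : Continuous (heatNum π t a) :=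
  continuous_iff_continuousAt.2 fun y => (hasFDerivAt_heatNum ht ha y).1.continuousAt

lemma contDiff_heatNum {t : ℝ} (ht : 0 < t) {a : EuclideanSpace ℝ (Fin n) → ℝ}
    (ha : Integrable a π) : ContDiff ℝ 1 (heatNum π t a) := by
  rw [contDiff_one_iff_fderiv]
  refine ⟨fun y => (hasFDerivAt_heatNum ht ha y).1.differentiableAt, ?_⟩
  have : fderiv ℝ (heatNum π t a) = fun y =>
      ∫ x, (a x * gaussianDensity n t (y - x)) • (t⁻¹ • innerSL ℝ (x - y)) ∂π :=
    funext fun y => (hasFDerivAt_heatNum ht ha y).1.fderiv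
  rw [this]
  exact (hasFDerivAt_heatNum ht ha 0).2.2

lemma fderiv_heatNum_apply {t : ℝ} (ht : 0 < t) {a : EuclideanSpace ℝ (Fin n) → ℝ}
    (ha : Integrable a π) (y v : EuclideanSpace ℝ (Fin n)) :
    fderiv ℝ (heatNum π t a) y v =
      t⁻¹ * ∫ x, (a x * inner ℝ (x - y) v) * gaussianDensity n t (y - x) ∂π := by
  obtain ⟨h1, h2, -⟩ := hasFDerivAt_heatNum ht ha y
  rw [h1.fderiv, ContinuousLinearMap.integral_apply h2, ← integral_const_mul]
  refine integral_congr_ae (ae_of_all _ fun x => ?_)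
  simp only [_root_.smul_apply, innerSL_apply_apply, smul_eq_mul]
  ring

lemma heatFlow_eq_withDensity [IsProbabilityMeasure π] {t : ℝ} (ht : 0 < t) :
    heatFlow π t = volume.withDensity fun y => ENNReal.ofReal (heatMass π t y) := by
  set k := gaussianDensity n t
  have hkc : Continuous k := continuous_gaussianDensity n t
  have hkm : Measurable fun z => ENNReal.ofReal (k z) := hkc.measurable.ennreal_ofReal
  have hDE : ∀ y, ENNReal.ofReal (heatMass π t y) = ∫⁻ x, ENNReal.ofReal (k (y - x)) ∂π := fun y =>
    ofReal_integral_eq_lintegral_ofReal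
      (by simpa using integrable_mul_gaussianDensity (π := π) ht (integrable_const 1) y)
      (ae_of_all _ fun x => (gaussianDensity_pos ht _).le)
  ext s hs
  rw [← lintegral_indicator_one hs, heatFlow, Measure.lintegral_conv
    (measurable_one.indicator hs), withDensity_apply _ hs, ← lintegral_indicator hs]
  have : ∀ x, ∫⁻ z, s.indicator (1 : EuclideanSpace ℝ (Fin n) → ENNReal) (x + z)
      ∂(gaussian n t) = ∫⁻ y, ENNReal.ofReal (k (y - x)) * s.indicator 1 y := by
    intro x
    rw [gaussian_eq_withDensity ht, lintegral_withDensity_eq_lintegral_mul _ hkm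
      (g := fun z => s.indicator 1 (x + z))
      ((measurable_one.indicator hs).comp (measurable_const_add x)),
      ← lintegral_add_left_eq_self (fun y => ENNReal.ofReal (k (y - x)) * s.indicator 1 y) x]
    simp [k]
  simp_rw [this]
  rw [lintegral_lintegral_swap]
  · congr 1 with y
    rw [lintegral_mul_const _ (by fun_prop), ← hDE]
    by_cases hy : y ∈ s <;> simp [hy]
  · refine (Measurable.mul (by fun_prop) ?_).aemeasurable
    exact (measurable_one.indicator hs).comp measurable_snd

lemma continuous_heatMass [IsProbabilityMeasure π] {t : ℝ} (ht : 0 < t) :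
    Continuous (heatMass π t) := by
  have := continuous_heatNum (π := π) ht (integrable_const 1)
  exact this.congr fun y => heatNum_one π t y

lemma integral_heatFlow [IsProbabilityMeasure π] {F : Type*} [NormedAddCommGroup F]
    [NormedSpace ℝ F] {t : ℝ} (ht : 0 < t)
    (g : EuclideanSpace ℝ (Fin n) → F) :
    ∫ y, g y ∂(heatFlow π t) = ∫ y, heatMass π t y • g y := by
  rw [heatFlow_eq_withDensity ht, integral_withDensity_eq_integral_toReal_smul
    (continuous_heatMass ht).measurable.ennreal_ofReal (by simp)]
  refine integral_congr_ae (ae_of_all _ fun y => ?_)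
  dsimp only
  rw [ENNReal.toReal_ofReal (heatMass_pos ht y).le]

lemma integrable_heatFlow_iff [IsProbabilityMeasure π] {F : Type*} [NormedAddCommGroup F]
    [NormedSpace ℝ F] {t : ℝ} (ht : 0 < t)
    {g : EuclideanSpace ℝ (Fin n) → F} :
    Integrable g (heatFlow π t) ↔ Integrable fun y => heatMass π t y • g y := by
  rw [heatFlow_eq_withDensity ht, integrable_withDensity_iff_integrable_smul'
    (continuous_heatMass ht).measurable.ennreal_ofReal (by simp)]
  refine integrable_congr (ae_of_all _ fun y => ?_)
  dsimp only
  rw [ENNReal.toReal_ofReal (heatMass_pos ht y).le]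

/-- The semigroup property of the adjoint heat flow. -/
lemma heatAdjoint_heatAdjoint [IsProbabilityMeasure π] {s t : ℝ} (hs : 0 ≤ s) (ht : 0 ≤ t)
    {f : EuclideanSpace ℝ (Fin n) → ℝ} (hf : Integrable f π) :
    heatAdjoint (heatFlow π s) t (heatAdjoint π s f) = heatAdjoint π (s + t) f := by
  rcases hs.eq_or_lt with rfl | hs
  · have : heatAdjoint π 0 f = f := by ext y; simp [heatAdjoint]
    rw [this, heatFlow_zero, zero_add]
  rcases ht.eq_or_lt with rfl | ht
  · ext y; simp [heatAdjoint]
  ext y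
  rw [heatAdjoint_of_pos _ ht, heatAdjoint_of_pos _ (add_pos hs ht)]
  congr 1
  -- The density of π_s cancels the denominator of f_s, so the inner numerator is evolved as a plain
  -- convolution.
  · rw [heatNum, integral_heatFlow hs, ← integral_heatNum_mul hs ht hf]
    refine integral_congr_ae (ae_of_all _ fun z => ?_)
    have := (heatMass_pos (π := π) hs z).ne'
    simp only [heatAdjoint_of_pos _ hs, smul_eq_mul]
    field_simp
  · rw [heatMass, integral_heatFlow hs, ← heatNum_one, ← integral_heatNum_mul hs ht
      (integrable_const 1)]
    simp [heatNum_one]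

end Kernel

end

/-! ### Posterior laws: variance, covariance and the two energy estimates -/

section

section Variance

variable {α : Type*} [MeasurableSpace α] {μ : Measure α} [IsFiniteMeasure μ]

/-- Nonnegativity of the variance, in a product form that also covers the zero measure and needs no
normalisation of the posteriors. -/
lemma sq_integral_le_measureReal_mul {g : α → ℝ} (hg : MemLp g 2 μ) :
    (∫ x, g x ∂μ) ^ 2 ≤ μ.real univ * ∫ x, g x ^ 2 ∂μ := by
  set m := μ.real univ with hm
  have hm0 : 0 ≤ m := measureReal_nonneg
  rcases hm0.eq_or_lt with h0 | h0
  · have : μ = 0 := by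
      rw [← Measure.measure_univ_eq_zero]
      exact (measureReal_eq_zero_iff).1 h0.symm
    simp [this]
  have hi := hg.integrable (by norm_num : (1 : ℝ≥0∞) ≤ 2)
  have hi2 := hg.integrable_sq
  set c := (∫ x, g x ∂μ) / m with hc
  have h1 : 0 ≤ ∫ x, (g x - c) ^ 2 ∂μ := integral_nonneg fun x => sq_nonneg _
  have e : ∀ x, (g x - c) ^ 2 = g x ^ 2 - (2 * c) * g x + c ^ 2 := fun x => by ring
  simp_rw [e] at h1
  have hi3 : Integrable (fun x => g x ^ 2 - (2 * c) * g x) μ := hi2.sub (hi.const_mul _)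
  rw [integral_add hi3 (integrable_const _), integral_sub hi2 (hi.const_mul _), integral_const_mul,
    integral_const, smul_eq_mul, ← hm] at h1
  have h2 : ∫ x, g x ∂μ = c * m := (div_mul_cancel₀ _ h0.ne').symm
  rw [h2] at h1 ⊢
  have h3 : 0 ≤ ∫ x, g x ^ 2 ∂μ - c ^ 2 * m := by linarith
  have := mul_nonneg h0.le h3
  linarith

/-- The Cauchy–Schwarz inequality for covariances. -/
lemma sq_covariance_le {f l : α → ℝ} (hf : MemLp f 2 μ) (hl : MemLp l 2 μ) :
    (μ.real univ * ∫ x, f x * l x ∂μ - (∫ x, f x ∂μ) * ∫ x, l x ∂μ) ^ 2 ≤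
      (μ.real univ * ∫ x, f x ^ 2 ∂μ - (∫ x, f x ∂μ) ^ 2) *
        (μ.real univ * ∫ x, l x ^ 2 ∂μ - (∫ x, l x ∂μ) ^ 2) := by
  have hfi := hf.integrable (by norm_num : (1 : ℝ≥0∞) ≤ 2)
  have hli := hl.integrable (by norm_num : (1 : ℝ≥0∞) ≤ 2)
  have hfl : Integrable (fun x => f x * l x) μ := hf.integrable_mul hl
  set m := μ.real univ
  -- The unnormalised variance of f + s l is a nonnegative quadratic in s, so its discriminant is
  -- nonpositive.
  have key : ∀ s : ℝ, 0 ≤ (m * ∫ x, l x ^ 2 ∂μ - (∫ x, l x ∂μ) ^ 2) * (s * s) +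
      (2 * (m * ∫ x, f x * l x ∂μ - (∫ x, f x ∂μ) * ∫ x, l x ∂μ)) * s +
      (m * ∫ x, f x ^ 2 ∂μ - (∫ x, f x ∂μ) ^ 2) := by
    intro s
    have h := sq_integral_le_measureReal_mul (hf.add (hl.const_mul s))
    simp only [Pi.add_apply] at h
    have e : ∀ x, (f x + s * l x) ^ 2 = f x ^ 2 + (2 * s) * (f x * l x) + s ^ 2 * l x ^ 2 :=
      fun x => by ring
    simp_rw [e] at h
    have i1 : Integrable (fun x => f x ^ 2 + (2 * s) * (f x * l x)) μ :=
      hf.integrable_sq.add (hfl.const_mul _)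
    rw [integral_add hfi (hli.const_mul s), integral_add i1 (hl.integrable_sq.const_mul _),
      integral_add hf.integrable_sq (hfl.const_mul _), integral_const_mul, integral_const_mul,
      integral_const_mul] at h
    linarith
  have := discrim_le_zero key
  rw [discrim] at this
  nlinarith

end Variance

section Posterior

variable {n : ℕ} {π : Measure (EuclideanSpace ℝ (Fin n))}

/-- A marginal of a logconcave function is logconcave: ρ(x) γ_t(y − x) is logconcave jointly in (x,
y), and Prékopa–Leindler integrates out x. -/
lemma IsLogConcaveFun.heatMass {ρ : EuclideanSpace ℝ (Fin n) → ℝ} (hρ : IsLogConcaveFun ρ)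
    (hm : Measurable ρ) (hπ : π = volume.withDensity fun x => ENNReal.ofReal (ρ x))
    [IsProbabilityMeasure π] {t : ℝ} (ht : 0 < t) : IsLogConcaveFun (heatMass π t) := by
  refine ⟨fun y => (heatMass_pos ht y).le, fun y y' a b ha hb hab => ?_⟩
  have hgm : ∀ y, Measurable fun x => gaussianDensity n t (y - x) := fun y =>
    (continuous_gaussianDensity n t).measurable.comp (by fun_prop)
  have hE : ∀ y, ENNReal.ofReal (HeatAdjoint.heatMass π t y) =
      ∫⁻ x, ENNReal.ofReal (ρ x * gaussianDensity n t (y - x)) := by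
    intro y
    rw [HeatAdjoint.heatMass, ofReal_integral_eq_lintegral_ofReal
      (by simpa using integrable_mul_gaussianDensity (π := π) ht (integrable_const 1) y)
      (ae_of_all _ fun x => (gaussianDensity_pos ht _).le), hπ,
      lintegral_withDensity_eq_lintegral_mul _ hm.ennreal_ofReal (hgm y).ennreal_ofReal]
    refine lintegral_congr fun x => ?_
    rw [Pi.mul_apply, ENNReal.ofReal_mul (hρ.1 x)]
  have h := prekopaLeindler ha hb hab (hm.mul (hgm y)).ennreal_ofReal
    (hm.mul (hgm y')).ennreal_ofReal (hm.mul (hgm (a • y + b • y'))).ennreal_ofReal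
    fun x x' => by
      have p0 : ∀ y x, 0 ≤ ρ x * gaussianDensity n t (y - x) := fun y x =>
        mul_nonneg (hρ.1 x) (gaussianDensity_pos ht _).le
      simp only [Pi.mul_apply]
      rw [ENNReal.ofReal_rpow_of_nonneg (p0 _ _) ha.le, ENNReal.ofReal_rpow_of_nonneg (p0 _ _) hb.le,
        ← ENNReal.ofReal_mul (Real.rpow_nonneg (p0 _ _) _)]
      refine ENNReal.ofReal_le_ofReal ?_
      rw [Real.mul_rpow (hρ.1 _) (gaussianDensity_pos ht _).le,
        Real.mul_rpow (hρ.1 _) (gaussianDensity_pos ht _).le, mul_mul_mul_comm]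
      refine mul_le_mul (hρ.2 x x' a b ha hb hab) ?_
        (mul_nonneg (Real.rpow_nonneg (gaussianDensity_pos ht _).le _)
          (Real.rpow_nonneg (gaussianDensity_pos ht _).le _)) (hρ.1 _)
      unfold gaussianDensity
      set c := (2 * Real.pi * t) ^ (-(n : ℝ) / 2)
      have hc : 0 < c := by positivity
      rw [Real.mul_rpow hc.le (Real.exp_pos _).le, Real.mul_rpow hc.le (Real.exp_pos _).le,
        mul_mul_mul_comm, ← Real.rpow_add hc, hab, Real.rpow_one, ← Real.exp_mul, ← Real.exp_mul,
        ← Real.exp_add]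
      refine mul_le_mul_of_nonneg_left (Real.exp_le_exp.2 ?_) hc.le
      have e : a • y + b • y' - (a • x + b • x') = a • (y - x) + b • (y' - x') := by module
      rw [e]
      have hcx := ((convexOn_norm (convex_univ (𝕜 := ℝ) (E := EuclideanSpace ℝ (Fin n)))).pow
        (fun _ _ => norm_nonneg _) 2).2 (mem_univ (y - x)) (mem_univ (y' - x')) ha.le hb.le hab
      simp only [Pi.pow_apply, smul_eq_mul] at hcx
      have e2 : -‖y - x‖ ^ 2 / (2 * t) * a + -‖y' - x'‖ ^ 2 / (2 * t) * b =
          -(a * ‖y - x‖ ^ 2 + b * ‖y' - x'‖ ^ 2) / (2 * t) := by ring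
      rw [e2]
      gcongr
  simp only [Pi.mul_apply, ← hE] at h
  rw [ENNReal.ofReal_rpow_of_pos (heatMass_pos ht _), ENNReal.ofReal_rpow_of_pos (heatMass_pos ht _),
    ← ENNReal.ofReal_mul (Real.rpow_nonneg (heatMass_pos ht _).le _)] at h
  exact (ENNReal.ofReal_le_ofReal_iff (heatMass_pos ht _).le).1 h

lemma IsLogConcave.heatFlow (hπ : IsLogConcave π) [IsProbabilityMeasure π] {t : ℝ} (ht : 0 ≤ t) :
    IsLogConcave (heatFlow π t) := by
  rcases ht.eq_or_lt with rfl | ht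
  · rwa [heatFlow_zero]
  obtain ⟨ρ, hm, hρ, h⟩ := hπ
  exact ⟨heatMass π t, (continuous_heatMass ht).measurable, hρ.heatMass hm h ht,
    heatFlow_eq_withDensity ht⟩

variable (π) in
/-- The unnormalized law of the starting point given that the heat flow is at `y`. -/
def posterior (t : ℝ) (y : EuclideanSpace ℝ (Fin n)) : Measure (EuclideanSpace ℝ (Fin n)) :=
  π.withDensity fun x => ENNReal.ofReal (gaussianDensity n t (y - x))

lemma measurable_gaussianDensity_sub (t : ℝ) (y : EuclideanSpace ℝ (Fin n)) :
    Measurable fun x => gaussianDensity n t (y - x) :=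
  (continuous_gaussianDensity n t).measurable.comp (by fun_prop)

lemma posterior_le {t : ℝ} (ht : 0 < t) (y : EuclideanSpace ℝ (Fin n)) :
    posterior π t y ≤ ENNReal.ofReal ((2 * Real.pi * t) ^ (-(n : ℝ) / 2)) • π := by
  calc posterior π t y ≤ π.withDensity
        (ENNReal.ofReal ((2 * Real.pi * t) ^ (-(n : ℝ) / 2)) • 1) := by
        refine withDensity_mono (ae_of_all _ fun x => ?_)
        simp only [Pi.smul_apply, Pi.one_apply, smul_eq_mul, mul_one]
        exact ENNReal.ofReal_le_ofReal (gaussianDensity_le n ht _)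
    _ = _ := by rw [withDensity_smul _ measurable_one, withDensity_one]

lemma isFiniteMeasure_posterior [IsFiniteMeasure π] {t : ℝ} (ht : 0 < t)
    (y : EuclideanSpace ℝ (Fin n)) : IsFiniteMeasure (posterior π t y) := by
  refine ⟨lt_of_le_of_lt (posterior_le ht y univ) ?_⟩
  rw [Measure.smul_apply, smul_eq_mul]
  exact ENNReal.mul_lt_top ENNReal.ofReal_lt_top (measure_lt_top _ _)

lemma integral_posterior {t : ℝ} (ht : 0 < t) (y : EuclideanSpace ℝ (Fin n))
    (a : EuclideanSpace ℝ (Fin n) → ℝ) : ∫ x, a x ∂(posterior π t y) = heatNum π t a y := by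
  rw [posterior, integral_withDensity_eq_integral_toReal_smul
    (measurable_gaussianDensity_sub t y).ennreal_ofReal (by simp)]
  refine integral_congr_ae (ae_of_all _ fun x => ?_)
  dsimp only
  rw [ENNReal.toReal_ofReal (gaussianDensity_pos ht _).le, smul_eq_mul, mul_comm]

lemma measureReal_posterior [IsFiniteMeasure π] {t : ℝ} (ht : 0 < t)
    (y : EuclideanSpace ℝ (Fin n)) : (posterior π t y).real univ = heatMass π t y := by
  have := integral_posterior (π := π) ht y (fun _ => 1)
  rwa [heatNum_one, integral_const, smul_eq_mul, mul_one] at this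

lemma memLp_posterior {F : Type*} [NormedAddCommGroup F] {t : ℝ} (ht : 0 < t)
    (y : EuclideanSpace ℝ (Fin n)) {f : EuclideanSpace ℝ (Fin n) → F} (hf : MemLp f 2 π) :
    MemLp f 2 (posterior π t y) :=
  hf.of_measure_le_smul ENNReal.ofReal_ne_top (posterior_le ht y)

lemma memLp_inner_posterior [IsFiniteMeasure π] {t : ℝ} (ht : 0 < t)
    (y e : EuclideanSpace ℝ (Fin n)) :
    MemLp (fun x => inner ℝ (x - y) e) 2 (posterior π t y) := by
  rw [memLp_two_iff_integrable_sq (by fun_prop), posterior,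
    integrable_withDensity_iff_integrable_smul'
      (measurable_gaussianDensity_sub t y).ennreal_ofReal (by simp)]
  refine Integrable.of_bound
    (C := ((2 * Real.pi * t) ^ (-(n : ℝ) / 2) * (2 * t)) * ‖e‖ ^ 2) ?_ (ae_of_all _ fun x => ?_)
  · have := measurable_gaussianDensity_sub (n := n) t y
    exact Measurable.aestronglyMeasurable (by fun_prop)
  · rw [ENNReal.toReal_ofReal (gaussianDensity_pos ht _).le, smul_eq_mul, norm_mul,
      Real.norm_of_nonneg (gaussianDensity_pos ht _).le, Real.norm_of_nonneg (sq_nonneg _)]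
    have h1 : inner ℝ (x - y) e ^ 2 ≤ ‖x - y‖ ^ 2 * ‖e‖ ^ 2 := by
      rw [← mul_pow, ← sq_abs]
      gcongr
      exact abs_real_inner_le_norm _ _
    have h2 := norm_sq_mul_gaussianDensity_le n ht (y - x)
    rw [norm_sub_rev] at h2
    calc _ ≤ gaussianDensity n t (y - x) * (‖x - y‖ ^ 2 * ‖e‖ ^ 2) :=
          mul_le_mul_of_nonneg_left h1 (gaussianDensity_pos ht _).le
      _ = (‖x - y‖ ^ 2 * gaussianDensity n t (y - x)) * ‖e‖ ^ 2 := by ring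
      _ ≤ _ := mul_le_mul_of_nonneg_right h2 (sq_nonneg _)

/-- The Poincaré inequality for the posterior measures. -/
lemma poincare_posterior (hπ : IsLogConcave π) [IsProbabilityMeasure π] {t : ℝ} (ht : 0 < t)
    (y : EuclideanSpace ℝ (Fin n)) {f : EuclideanSpace ℝ (Fin n) → ℝ}
    {G : EuclideanSpace ℝ (Fin n) → EuclideanSpace ℝ (Fin n)} (hf : MemLp f 2 (posterior π t y))
    (hG : MemLp G 2 (posterior π t y)) (hfG : HasWeakGradient π f G) :
    heatMass π t y * heatNum π t (fun x => f x ^ 2) y - heatNum π t f y ^ 2 ≤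
      t * (heatMass π t y * heatNum π t (fun x => ‖G x‖ ^ 2) y) := by
  obtain ⟨ρ, hm, hρ, h⟩ := hπ
  have := isFiniteMeasure_posterior (π := π) ht y
  have hp : posterior π t y =
      volume.withDensity fun x => ENNReal.ofReal (ρ x * gaussianDensity n t (y - x)) := by
    rw [posterior, h, ← withDensity_mul _ hm.ennreal_ofReal
      (measurable_gaussianDensity_sub t y).ennreal_ofReal]
    congr 1
    ext x
    rw [Pi.mul_apply, ENNReal.ofReal_mul (hρ.1 x)]
  rw [h] at hfG
  have := poincare_H1 hρ hm ht y hp hf hG hfG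
  rwa [measureReal_posterior ht, integral_posterior ht, integral_posterior ht,
    integral_posterior ht] at this

/-- A linear function has constant gradient e, so the posterior Poincaré inequality gives normalised
variance at most t‖e‖². Both the gradient bound for the adjoint flow and the concavity of the log
density of π_t rest on this. -/
lemma variance_inner_posterior_le (hπ : IsLogConcave π) [IsProbabilityMeasure π] {t : ℝ}
    (ht : 0 < t) (y e : EuclideanSpace ℝ (Fin n)) :
    heatMass π t y * heatNum π t (fun x => inner ℝ (x - y) e ^ 2) y -
      heatNum π t (fun x => inner ℝ (x - y) e) y ^ 2 ≤ t * heatMass π t y ^ 2 * ‖e‖ ^ 2 := by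
  have := isFiniteMeasure_posterior (π := π) ht y
  have hw : HasWeakGradient π (fun x => inner ℝ (x - y) e) (fun _ => e) := by
    have hc : ContDiff ℝ 1 fun x : EuclideanSpace ℝ (Fin n) => inner ℝ (x - y) e :=
      (contDiff_id.sub contDiff_const).inner ℝ contDiff_const
    have hg : gradient (fun x : EuclideanSpace ℝ (Fin n) => inner ℝ (x - y) e) = fun _ => e := by
      ext1 x
      refine HasGradientAt.gradient ?_
      rw [hasGradientAt_iff_hasFDerivAt]
      have h1 := ((innerSL ℝ e).hasFDerivAt (x := x - y)).comp x ((hasFDerivAt_id x).sub_const y)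
      have e1 : (fun x : EuclideanSpace ℝ (Fin n) => inner ℝ (x - y) e) =
          (innerSL ℝ e) ∘ fun x => x - y := by
        ext x; simp [real_inner_comm]
      rw [e1]
      exact h1
    rw [← hg]
    exact hasWeakGradient_gradient π hc
  have h1 := poincare_posterior hπ ht y (memLp_inner_posterior ht y e) (memLp_const e) hw
  have h2 : heatNum π t (fun _ => ‖e‖ ^ 2) y = heatMass π t y * ‖e‖ ^ 2 := by
    simp only [heatNum, heatMass]
    rw [integral_const_mul, mul_comm]
  rw [h2] at h1
  linarith

/-- The derivative of the adjoint heat flow is a covariance. -/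
lemma hasFDerivAt_heatAdjoint [IsProbabilityMeasure π] {t : ℝ} (ht : 0 < t)
    {f : EuclideanSpace ℝ (Fin n) → ℝ} (hf : Integrable f π) (y v : EuclideanSpace ℝ (Fin n)) :
    DifferentiableAt ℝ (heatAdjoint π t f) y ∧
    fderiv ℝ (heatAdjoint π t f) y v = t⁻¹ * (heatMass π t y *
      heatNum π t (fun x => f x * inner ℝ (x - y) v) y - heatNum π t f y *
      heatNum π t (fun x => inner ℝ (x - y) v) y) / heatMass π t y ^ 2 := by
  have h1 : heatAdjoint π t f = fun y => heatNum π t f y / heatNum π t (fun _ => 1) y := by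
    ext y; rw [heatAdjoint_of_pos _ ht, heatNum_one]
  have hd := (hasFDerivAt_heatNum ht hf y).1
  have hd1 := (hasFDerivAt_heatNum (π := π) ht (integrable_const 1) y).1
  have hpos : heatNum π t (fun _ => 1) y ≠ 0 := by
    rw [heatNum_one]; exact (heatMass_pos ht y).ne'
  have h2 : HasFDerivAt (fun y => heatNum π t f y / heatNum π t (fun _ => 1) y) _ y :=
    hd.mul ((hasDerivAt_inv hpos).comp_hasFDerivAt y hd1)
  have e1 := fderiv_heatNum_apply ht hf y v
  have e2 := fderiv_heatNum_apply (π := π) ht (integrable_const 1) y v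
  rw [hd.fderiv] at e1
  rw [hd1.fderiv] at e2
  rw [h1]
  refine ⟨h2.differentiableAt, ?_⟩
  have h3 : fderiv ℝ (fun y => heatNum π t f y / heatNum π t (fun _ => 1) y) y = _ := h2.fderiv
  rw [h3]
  simp only [_root_.smul_apply, _root_.add_apply, smul_eq_mul, e1, e2]
  rw [heatNum_one]
  simp only [heatNum, one_mul]
  have := (heatMass_pos (π := π) ht y).ne'
  field_simp
  ring

lemma contDiff_heatAdjoint [IsProbabilityMeasure π] {t : ℝ} (ht : 0 < t)
    {f : EuclideanSpace ℝ (Fin n) → ℝ} (hf : Integrable f π) :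
    ContDiff ℝ 1 (heatAdjoint π t f) := by
  have h1 : heatAdjoint π t f = fun y => heatNum π t f y / heatNum π t (fun _ => 1) y := by
    ext y; rw [heatAdjoint_of_pos _ ht, heatNum_one]
  rw [h1]
  refine (contDiff_heatNum ht hf).div (contDiff_heatNum ht (integrable_const 1)) fun y => ?_
  rw [heatNum_one]; exact (heatMass_pos ht y).ne'

/-- The gradient of the adjoint heat flow is controlled by the posterior variance. -/
lemma norm_gradient_heatAdjoint_sq_le (hπ : IsLogConcave π) [IsProbabilityMeasure π] {t : ℝ}
    (ht : 0 < t) {f : EuclideanSpace ℝ (Fin n) → ℝ} (hf : MemLp f 2 π)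
    (y : EuclideanSpace ℝ (Fin n)) :
    t * (heatMass π t y * ‖gradient (heatAdjoint π t f) y‖ ^ 2) ≤
      heatNum π t (fun x => f x ^ 2) y - heatNum π t f y ^ 2 / heatMass π t y := by
  have hfi := hf.integrable (by norm_num : (1 : ℝ≥0∞) ≤ 2)
  have := isFiniteMeasure_posterior (π := π) ht y
  -- The covariance formula is tested in the direction e of the gradient itself. The covariance then
  -- equals q = t m² ‖e‖², which is also the bound on m times the linear variance, so Cauchy–Schwarz
  -- reads q² ≤ V q.
  set e := gradient (heatAdjoint π t f) y with he
  have h1 : ‖e‖ ^ 2 = fderiv ℝ (heatAdjoint π t f) y e := by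
    rw [← inner_gradient_left, ← he, real_inner_self_eq_norm_sq]
  have h2 := (hasFDerivAt_heatAdjoint ht hfi y e).2
  rw [← h1] at h2
  have h3 := sq_covariance_le (memLp_posterior ht y hf) (memLp_inner_posterior (π := π) ht y e)
  simp only [integral_posterior ht, measureReal_posterior ht] at h3
  have h4 := variance_inner_posterior_le hπ ht y e
  have hm := heatMass_pos (π := π) ht y
  set m := heatMass π t y
  set V := m * heatNum π t (fun x => f x ^ 2) y - heatNum π t f y ^ 2 with hV
  set c := m * heatNum π t (fun x => f x * inner ℝ (x - y) e) y - heatNum π t f y *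
      heatNum π t (fun x => inner ℝ (x - y) e) y
  have hV0 : 0 ≤ V := by
    have := sq_integral_le_measureReal_mul (memLp_posterior ht y hf)
    simp only [integral_posterior ht, measureReal_posterior ht] at this
    linarith
  have hc : c = t * m ^ 2 * ‖e‖ ^ 2 := by rw [h2]; field_simp
  have h5 : (t * m ^ 2 * ‖e‖ ^ 2) ^ 2 ≤ V * (t * m ^ 2 * ‖e‖ ^ 2) := by
    rw [← hc]
    refine h3.trans ?_
    rw [hc]
    exact mul_le_mul_of_nonneg_left h4 hV0
  have h6 : t * m ^ 2 * ‖e‖ ^ 2 ≤ V := by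
    rcases (by positivity : 0 ≤ t * m ^ 2 * ‖e‖ ^ 2).eq_or_lt with h0 | h0
    · rw [← h0]; exact hV0
    · rw [sq] at h5; exact le_of_mul_le_mul_right h5 h0
  have e1 : heatNum π t (fun x => f x ^ 2) y - heatNum π t f y ^ 2 / m = V / m := by
    rw [hV]; field_simp
  rw [e1, le_div_iff₀ hm]
  linarith

lemma heatNum_sq_div_le [IsProbabilityMeasure π] {t : ℝ} (ht : 0 < t)
    {f : EuclideanSpace ℝ (Fin n) → ℝ} (hf : MemLp f 2 π) (y : EuclideanSpace ℝ (Fin n)) :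
    heatNum π t f y ^ 2 / heatMass π t y ≤ heatNum π t (fun x => f x ^ 2) y := by
  have := isFiniteMeasure_posterior (π := π) ht y
  rw [div_le_iff₀ (heatMass_pos ht y)]
  have := sq_integral_le_measureReal_mul (memLp_posterior ht y hf)
  simp only [integral_posterior ht, measureReal_posterior ht] at this
  linarith

lemma integrable_heatNum_sq_div [IsProbabilityMeasure π] {t : ℝ} (ht : 0 < t)
    {f : EuclideanSpace ℝ (Fin n) → ℝ} (hf : MemLp f 2 π) :
    Integrable fun y => heatNum π t f y ^ 2 / heatMass π t y := by
  refine (integrable_heatNum ht hf.integrable_sq).mono' ?_ (ae_of_all _ fun y => ?_)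
  · have := continuous_heatNum ht (hf.integrable (by norm_num : (1 : ℝ≥0∞) ≤ 2))
    exact ((this.pow 2).div (continuous_heatMass ht)
      fun y => (heatMass_pos ht y).ne').aestronglyMeasurable
  · rw [Real.norm_of_nonneg (div_nonneg (sq_nonneg _) (heatMass_pos ht y).le)]
    exact heatNum_sq_div_le ht hf y

lemma heatMass_mul_heatAdjoint_sq [IsProbabilityMeasure π] {t : ℝ} (ht : 0 < t)
    (f : EuclideanSpace ℝ (Fin n) → ℝ) (y : EuclideanSpace ℝ (Fin n)) :
    heatMass π t y • heatAdjoint π t f y ^ 2 = heatNum π t f y ^ 2 / heatMass π t y := by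
  have := (heatMass_pos (π := π) ht y).ne'
  rw [heatAdjoint_of_pos _ ht, smul_eq_mul]
  field_simp

/-- The adjoint heat flow maps `L²(π)` to `L²(π_t)`. -/
lemma memLp_heatAdjoint [IsProbabilityMeasure π] {t : ℝ} (ht : 0 < t)
    {f : EuclideanSpace ℝ (Fin n) → ℝ} (hf : MemLp f 2 π) :
    MemLp (heatAdjoint π t f) 2 (heatFlow π t) := by
  have hc := (contDiff_heatAdjoint ht (hf.integrable (by norm_num : (1 : ℝ≥0∞) ≤ 2))).continuous
  rw [memLp_two_iff_integrable_sq hc.aestronglyMeasurable, integrable_heatFlow_iff ht]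
  simp_rw [heatMass_mul_heatAdjoint_sq ht]
  exact integrable_heatNum_sq_div ht hf

lemma integral_heatAdjoint_sq [IsProbabilityMeasure π] {t : ℝ} (ht : 0 < t)
    (f : EuclideanSpace ℝ (Fin n) → ℝ) :
    ∫ y, heatAdjoint π t f y ^ 2 ∂(heatFlow π t) =
      ∫ y, heatNum π t f y ^ 2 / heatMass π t y := by
  rw [integral_heatFlow ht]
  simp_rw [heatMass_mul_heatAdjoint_sq ht]

/-- The law of total variance: the integrand is the posterior variance of f times the posterior
mass. Pointwise variance bounds thereby become bounds on the decrease of the squared norm. -/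
lemma integrable_heatNum_variance [IsProbabilityMeasure π] {t : ℝ} (ht : 0 < t)
    {f : EuclideanSpace ℝ (Fin n) → ℝ} (hf : MemLp f 2 π) :
    Integrable (fun y => heatNum π t (fun x => f x ^ 2) y - heatNum π t f y ^ 2 / heatMass π t y) ∧
    ∫ y, (heatNum π t (fun x => f x ^ 2) y - heatNum π t f y ^ 2 / heatMass π t y) =
      ∫ x, f x ^ 2 ∂π - ∫ y, heatAdjoint π t f y ^ 2 ∂(heatFlow π t) := by
  have i1 := integrable_heatNum ht hf.integrable_sq
  have i2 := integrable_heatNum_sq_div ht hf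
  refine ⟨i1.sub i2, ?_⟩
  rw [integral_sub i1 i2, integral_heatNum ht hf.integrable_sq, integral_heatAdjoint_sq ht]

/-- The gradient of the adjoint heat flow is square integrable, with a bound by the decrease of
the `L²` norm. -/
lemma integral_norm_gradient_sq_le (hπ : IsLogConcave π) [IsProbabilityMeasure π] {t : ℝ}
    (ht : 0 < t) {f : EuclideanSpace ℝ (Fin n) → ℝ} (hf : MemLp f 2 π) :
    MemLp (gradient (heatAdjoint π t f)) 2 (heatFlow π t) ∧
    t * ∫ y, ‖gradient (heatAdjoint π t f) y‖ ^ 2 ∂(heatFlow π t) ≤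
      ∫ x, f x ^ 2 ∂π - ∫ y, heatAdjoint π t f y ^ 2 ∂(heatFlow π t) := by
  obtain ⟨iV, eV⟩ := integrable_heatNum_variance ht hf
  have hc := contDiff_heatAdjoint ht (hf.integrable (by norm_num : (1 : ℝ≥0∞) ≤ 2))
  have hgc : Continuous (gradient (heatAdjoint π t f)) :=
    (InnerProductSpace.toDual ℝ (EuclideanSpace ℝ (Fin n))).symm.continuous.comp
      (hc.continuous_fderiv (by norm_num))
  have hle := norm_gradient_heatAdjoint_sq_le hπ ht hf
  have i0 : Integrable fun y => t * (heatMass π t y * ‖gradient (heatAdjoint π t f) y‖ ^ 2) := by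
    refine iV.mono' (Continuous.aestronglyMeasurable ?_) (ae_of_all _ fun y => ?_)
    · have := continuous_heatMass (π := π) ht
      fun_prop
    · rw [Real.norm_of_nonneg]
      · exact hle y
      · have := heatMass_pos (π := π) ht y
        positivity
  have i1 : Integrable fun y => heatMass π t y * ‖gradient (heatAdjoint π t f) y‖ ^ 2 := by
    refine (i0.const_mul t⁻¹).congr (ae_of_all _ fun y => ?_)
    field_simp
  refine ⟨?_, ?_⟩
  · rw [memLp_two_iff_integrable_sq_norm hgc.aestronglyMeasurable, integrable_heatFlow_iff ht]
    simpa only [smul_eq_mul] using i1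
  · rw [integral_heatFlow ht, ← integral_const_mul, ← eV]
    exact integral_mono i0 iV hle

/-- The decrease of the `L²` norm is controlled by the gradient energy. -/
lemma integral_sq_sub_le (hπ : IsLogConcave π) [IsProbabilityMeasure π] {t : ℝ} (ht : 0 < t)
    {f : EuclideanSpace ℝ (Fin n) → ℝ}
    {G : EuclideanSpace ℝ (Fin n) → EuclideanSpace ℝ (Fin n)} (hf : MemLp f 2 π) (hG : MemLp G 2 π)
    (hfG : HasWeakGradient π f G) :
    ∫ x, f x ^ 2 ∂π - ∫ y, heatAdjoint π t f y ^ 2 ∂(heatFlow π t) ≤ t * ∫ x, ‖G x‖ ^ 2 ∂π := by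
  obtain ⟨iV, eV⟩ := integrable_heatNum_variance ht hf
  have hGi : Integrable (fun x => ‖G x‖ ^ 2) π := hG.integrable_norm_pow (by norm_num)
  -- Both sides become integrals over y, where the Poincaré inequality holds for each posterior with
  -- the same constant t.
  rw [← eV, ← integral_heatNum ht hGi, ← integral_const_mul]
  refine integral_mono iV ((integrable_heatNum ht hGi).const_mul t) fun y => ?_
  have h := poincare_posterior hπ ht y (memLp_posterior ht y hf) (memLp_posterior ht y hG) hfG
  have hm := heatMass_pos (π := π) ht y
  dsimp only
  have e1 : heatNum π t (fun x => f x ^ 2) y - heatNum π t f y ^ 2 / heatMass π t y =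
      (heatMass π t y * heatNum π t (fun x => f x ^ 2) y - heatNum π t f y ^ 2) /
        heatMass π t y := by field_simp
  rw [e1, div_le_iff₀ hm]
  linarith

end Posterior

end

/-! ### Uniqueness of weak gradients and difference bounds along the flow -/

section

variable {n : ℕ} {π : Measure (EuclideanSpace ℝ (Fin n))}

lemma volume_absolutelyContinuous_heatFlow [IsProbabilityMeasure π] {t : ℝ} (ht : 0 < t) :
    (volume : Measure (EuclideanSpace ℝ (Fin n))) ≪ heatFlow π t := by
  rw [heatFlow_eq_withDensity ht]
  refine withDensity_absolutelyContinuous'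
    (continuous_heatMass ht).measurable.ennreal_ofReal.aemeasurable (ae_of_all _ fun y => ?_)
  simpa using heatMass_pos ht y

lemma interior_support_heatFlow [IsProbabilityMeasure π] {t : ℝ} (ht : 0 < t) :
    interior (heatFlow π t).support = univ := by
  have h1 := (volume_absolutelyContinuous_heatFlow (π := π) ht).support_mono
  rw [Measure.support_eq_univ, univ_subset_iff] at h1
  rw [h1, interior_univ]

/-- At positive times the density is continuous and positive, so dividing by it preserves local
integrability. -/
lemma locallyIntegrable_of_memLp_heatFlow [IsProbabilityMeasure π] {F : Type*}
    [NormedAddCommGroup F] [NormedSpace ℝ F] {t : ℝ} (ht : 0 < t)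
    {G : EuclideanSpace ℝ (Fin n) → F} (hG : MemLp G 2 (heatFlow π t)) :
    LocallyIntegrable G := by
  have h1 := (integrable_heatFlow_iff ht).1 (hG.integrable (by norm_num : (1 : ℝ≥0∞) ≤ 2))
  have h2 : Continuous fun y => (heatMass π t y)⁻¹ :=
    (continuous_heatMass ht).inv₀ fun y => (heatMass_pos ht y).ne'
  refine (h1.locallyIntegrable.continuous_smul h2).congr (ae_of_all _ fun y => ?_)
  simp [smul_smul, inv_mul_cancel₀ (heatMass_pos (π := π) ht y).ne']

/-- Weak gradients with respect to `π_t` are unique. -/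
lemma HasWeakGradient.ae_eq_of_heatFlow [IsProbabilityMeasure π] {t : ℝ} (ht : 0 < t)
    {f : EuclideanSpace ℝ (Fin n) → ℝ}
    {G G' : EuclideanSpace ℝ (Fin n) → EuclideanSpace ℝ (Fin n)}
    (hG : MemLp G 2 (heatFlow π t)) (hG' : MemLp G' 2 (heatFlow π t))
    (hf : HasWeakGradient (heatFlow π t) f G) (hf' : HasWeakGradient (heatFlow π t) f G') :
    G =ᵐ[heatFlow π t] G' := by
  have h1 := locallyIntegrable_of_memLp_heatFlow ht hG
  have h2 := locallyIntegrable_of_memLp_heatFlow ht hG'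
  have hac : heatFlow π t ≪ volume := by
    rw [heatFlow_eq_withDensity ht]; exact withDensity_absolutelyContinuous _ _
  refine hac.ae_le (ae_eq_of_integral_contDiff_smul_eq h1 h2 fun φ hφ hc => ?_)
  have key : ∀ {H : EuclideanSpace ℝ (Fin n) → EuclideanSpace ℝ (Fin n)},
      LocallyIntegrable H → ∀ v, inner ℝ v (∫ x, φ x • H x) = ∫ x, φ x * inner ℝ (H x) v := by
    intro H hH v
    rw [← integral_inner (hH.integrable_smul_left_of_hasCompactSupport hφ.continuous hc)]
    refine integral_congr_ae (ae_of_all _ fun x => ?_)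
    dsimp only
    rw [inner_smul_right, real_inner_comm]
  refine ext_inner_left ℝ fun v => ?_
  rw [key h1, key h2]
  have hs : tsupport φ ⊆ interior (heatFlow π t).support := by
    rw [interior_support_heatFlow ht]; exact subset_univ _
  have e1 := hf φ hφ hc hs v
  have e2 := hf' φ hφ hc hs v
  linarith

lemma memLp_weakGradient {f : EuclideanSpace ℝ (Fin n) → ℝ} (hf : MemH1 π f) :
    MemLp (weakGradient π f) 2 π ∧ HasWeakGradient π f (weakGradient π f) := by
  unfold weakGradient
  rw [dif_pos hf.2]
  exact hf.2.choose_spec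

lemma heatAdjoint_zero (f : EuclideanSpace ℝ (Fin n) → ℝ) : heatAdjoint π 0 f = f := by
  ext y; simp [heatAdjoint]

/-- The heat adjoint of a square integrable function belongs to `H¹`. -/
lemma memH1_heatAdjoint_of_pos (hπ : IsLogConcave π) [IsProbabilityMeasure π] {t : ℝ}
    (ht : 0 < t) {f : EuclideanSpace ℝ (Fin n) → ℝ} (hf : MemLp f 2 π) :
    MemH1 (heatFlow π t) (heatAdjoint π t f) :=
  ⟨memLp_heatAdjoint ht hf, _, (integral_norm_gradient_sq_le hπ ht hf).1,
    hasWeakGradient_gradient _ (contDiff_heatAdjoint ht (hf.integrable (by norm_num)))⟩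

lemma memH1_heatAdjoint (hπ : IsLogConcave π) [IsProbabilityMeasure π] {t : ℝ}
    (ht : 0 ≤ t) {f : EuclideanSpace ℝ (Fin n) → ℝ} (hf : MemH1 π f) :
    MemH1 (heatFlow π t) (heatAdjoint π t f) := by
  rcases ht.eq_or_lt with rfl | ht
  · rwa [heatFlow_zero, heatAdjoint_zero]
  · exact memH1_heatAdjoint_of_pos hπ ht hf.1

/-- `weakGradient` is an arbitrary choice; uniqueness at positive times identifies it with the
classical gradient almost everywhere. -/
lemma gradEnergy_heatAdjoint (hπ : IsLogConcave π) [IsProbabilityMeasure π] {t : ℝ}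
    (ht : 0 < t) {f : EuclideanSpace ℝ (Fin n) → ℝ} (hf : MemLp f 2 π) :
    gradEnergy (heatFlow π t) (heatAdjoint π t f) =
      ∫ y, ‖gradient (heatAdjoint π t f) y‖ ^ 2 ∂(heatFlow π t) := by
  obtain ⟨h1, h2⟩ := memLp_weakGradient (memH1_heatAdjoint_of_pos hπ ht hf)
  have h3 := h2.ae_eq_of_heatFlow ht h1 (integral_norm_gradient_sq_le hπ ht hf).1
    (hasWeakGradient_gradient _ (contDiff_heatAdjoint ht (hf.integrable (by norm_num))))
  refine integral_congr_ae ?_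
  filter_upwards [h3] with y hy
  rw [hy]

lemma gradEnergy_nonneg (π : Measure (EuclideanSpace ℝ (Fin n)))
    (f : EuclideanSpace ℝ (Fin n) → ℝ) : 0 ≤ gradEnergy π f :=
  integral_nonneg fun _ => by positivity

variable (π) in
/-- The squared norm `‖Q_t^* f‖²` in `L²(π_t)`. -/
def adjointNormSq (f : EuclideanSpace ℝ (Fin n) → ℝ) (t : ℝ) : ℝ :=
  ∫ y, heatAdjoint π t f y ^ 2 ∂(heatFlow π t)

lemma adjointNormSq_nonneg (f : EuclideanSpace ℝ (Fin n) → ℝ) (t : ℝ) :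
    0 ≤ adjointNormSq π f t :=
  integral_nonneg fun _ => by positivity

lemma adjointNormSq_zero [SFinite π] (f : EuclideanSpace ℝ (Fin n) → ℝ) :
    adjointNormSq π f 0 = ∫ x, f x ^ 2 ∂π := by
  rw [adjointNormSq, heatFlow_zero, heatAdjoint_zero]

lemma memLp_heatAdjoint_of_nonneg [IsProbabilityMeasure π] {t : ℝ} (ht : 0 ≤ t)
    {f : EuclideanSpace ℝ (Fin n) → ℝ} (hf : MemLp f 2 π) :
    MemLp (heatAdjoint π t f) 2 (heatFlow π t) := by
  rcases ht.eq_or_lt with rfl | ht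
  · rwa [heatFlow_zero, heatAdjoint_zero]
  · exact memLp_heatAdjoint ht hf

variable (π) in
/-- The energy `∫ ‖∇ Q_t^* f‖² dπ_t`. -/
def adjointEnergy (f : EuclideanSpace ℝ (Fin n) → ℝ) (t : ℝ) : ℝ :=
  gradEnergy (heatFlow π t) (heatAdjoint π t f)

/-- Backward difference bound for the squared norm. -/
lemma mul_adjointEnergy_le (hπ : IsLogConcave π) [IsProbabilityMeasure π]
    {t h : ℝ} (ht : 0 ≤ t) (hh : 0 < h) {f : EuclideanSpace ℝ (Fin n) → ℝ} (hf : MemLp f 2 π) :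
    h * adjointEnergy π f (t + h) ≤ adjointNormSq π f t - adjointNormSq π f (t + h) := by
  have hfi : Integrable f π := hf.integrable (by norm_num)
  have h1 := memLp_heatAdjoint_of_nonneg ht hf
  -- The estimate from time zero is applied to π_t and f_t and transported by the semigroup laws.
  have h2 := (integral_norm_gradient_sq_le (hπ.heatFlow ht) hh h1).2
  rw [← gradEnergy_heatAdjoint (hπ.heatFlow ht) hh h1, heatAdjoint_heatAdjoint ht hh.le hfi,
    heatFlow_heatFlow _ ht hh.le] at h2
  exact h2

/-- Forward difference bound for the squared norm. -/
lemma adjointNormSq_sub_le (hπ : IsLogConcave π) [IsProbabilityMeasure π]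
    {t h : ℝ} (ht : 0 ≤ t) (hh : 0 < h) {f : EuclideanSpace ℝ (Fin n) → ℝ} (hf : MemLp f 2 π)
    (hft : MemH1 (heatFlow π t) (heatAdjoint π t f)) :
    adjointNormSq π f t - adjointNormSq π f (t + h) ≤ h * adjointEnergy π f t := by
  have hfi : Integrable f π := hf.integrable (by norm_num)
  obtain ⟨h1, h2⟩ := memLp_weakGradient hft
  have h3 := integral_sq_sub_le (hπ.heatFlow ht) hh hft.1 h1 h2
  rw [heatAdjoint_heatAdjoint ht hh.le hfi, heatFlow_heatFlow _ ht hh.le] at h3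
  exact h3

end

/-! ### Calculus of smooth functions with derivatives of polynomial growth -/

section

variable {n : ℕ}

/-- The directional derivative of `P` in direction `v`. -/
def dirDeriv (v : EuclideanSpace ℝ (Fin n)) (P : EuclideanSpace ℝ (Fin n) → ℝ)
    (x : EuclideanSpace ℝ (Fin n)) : ℝ := fderiv ℝ P x v

/-- Functions of polynomial growth. -/
def PolyGrowth (P : EuclideanSpace ℝ (Fin n) → ℝ) : Prop :=
  ∃ (C : ℝ) (K : ℕ), 0 ≤ C ∧ ∀ x, |P x| ≤ C * (1 + ‖x‖) ^ K

/-- Functions with `k` directional derivatives, all of polynomial growth. -/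
def TameOrder : ℕ → (EuclideanSpace ℝ (Fin n) → ℝ) → Prop
  | 0, P => Continuous P ∧ PolyGrowth P
  | k + 1, P => Differentiable ℝ P ∧ PolyGrowth P ∧ ∀ v, TameOrder k (dirDeriv v P)

/-- Smooth functions all of whose derivatives have polynomial growth. -/
def Tame (P : EuclideanSpace ℝ (Fin n) → ℝ) : Prop := ∀ k, TameOrder k P

variable {P Q : EuclideanSpace ℝ (Fin n) → ℝ}

lemma PolyGrowth.exists_common (hP : PolyGrowth P) (hQ : PolyGrowth Q) :
    ∃ (C : ℝ) (K : ℕ), 0 ≤ C ∧ (∀ x, |P x| ≤ C * (1 + ‖x‖) ^ K) ∧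
      ∀ x, |Q x| ≤ C * (1 + ‖x‖) ^ K := by
  obtain ⟨C, K, hC, h⟩ := hP
  obtain ⟨C', K', hC', h'⟩ := hQ
  have key : ∀ (x : EuclideanSpace ℝ (Fin n)) {a b : ℕ}, a ≤ b → (1 + ‖x‖) ^ a ≤ (1 + ‖x‖) ^ b :=
    fun x a b hab => pow_le_pow_right₀ (by linarith [norm_nonneg x]) hab
  refine ⟨max C C', max K K', hC.trans (le_max_left _ _), fun x => (h x).trans ?_,
    fun x => (h' x).trans ?_⟩
  · exact mul_le_mul (le_max_left _ _) (key x (le_max_left _ _)) (by positivity)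
      (hC.trans (le_max_left _ _))
  · exact mul_le_mul (le_max_right _ _) (key x (le_max_right _ _)) (by positivity)
      (hC.trans (le_max_left _ _))

lemma PolyGrowth.add (hP : PolyGrowth P) (hQ : PolyGrowth Q) : PolyGrowth fun x => P x + Q x := by
  obtain ⟨C, K, hC, h, h'⟩ := hP.exists_common hQ
  refine ⟨2 * C, K, by positivity, fun x => (abs_add_le _ _).trans ?_⟩
  linarith [h x, h' x]

lemma PolyGrowth.mul (hP : PolyGrowth P) (hQ : PolyGrowth Q) : PolyGrowth fun x => P x * Q x := by
  obtain ⟨C, K, hC, h, h'⟩ := hP.exists_common hQ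
  refine ⟨C * C, K + K, by positivity, fun x => ?_⟩
  rw [abs_mul, pow_add, mul_mul_mul_comm]
  exact mul_le_mul (h x) (h' x) (abs_nonneg _) (by positivity)

lemma PolyGrowth.of_bounded {C : ℝ} (h : ∀ x, |P x| ≤ C) : PolyGrowth P :=
  ⟨C, 0, (abs_nonneg _).trans (h 0), by simpa using h⟩

lemma polyGrowth_const (c : ℝ) : PolyGrowth fun _ : EuclideanSpace ℝ (Fin n) => c :=
  .of_bounded fun _ => le_rfl

lemma polyGrowth_inner (v : EuclideanSpace ℝ (Fin n)) : PolyGrowth fun x => inner ℝ x v := by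
  refine ⟨‖v‖, 1, norm_nonneg v, fun x => (abs_real_inner_le_norm x v).trans ?_⟩
  nlinarith [norm_nonneg x, norm_nonneg v]

lemma TameOrder.polyGrowth {k : ℕ} (h : TameOrder k P) : PolyGrowth P := by
  cases k with
  | zero => exact h.2
  | succ k => exact h.2.1

lemma TameOrder.continuous {k : ℕ} (h : TameOrder k P) : Continuous P := by
  cases k with
  | zero => exact h.1
  | succ k => exact h.1.continuous

lemma TameOrder.of_succ {k : ℕ} (h : TameOrder (k + 1) P) : TameOrder k P := by
  induction k generalizing P with
  | zero => exact ⟨h.continuous, h.polyGrowth⟩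
  | succ k ih => exact ⟨h.1, h.2.1, fun v => ih (h.2.2 v)⟩

lemma dirDeriv_add (v : EuclideanSpace ℝ (Fin n)) (hP : Differentiable ℝ P)
    (hQ : Differentiable ℝ Q) :
    dirDeriv v (fun x => P x + Q x) = fun x => dirDeriv v P x + dirDeriv v Q x := by
  ext x
  simp [dirDeriv, fderiv_fun_add (hP x) (hQ x)]

lemma dirDeriv_mul (v : EuclideanSpace ℝ (Fin n)) (hP : Differentiable ℝ P)
    (hQ : Differentiable ℝ Q) :
    dirDeriv v (fun x => P x * Q x) = fun x => P x * dirDeriv v Q x + dirDeriv v P x * Q x := by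
  ext x
  simp [dirDeriv, fderiv_fun_mul (hP x) (hQ x), mul_comm]

lemma dirDeriv_const (v : EuclideanSpace ℝ (Fin n)) (c : ℝ) :
    dirDeriv v (fun _ => c) = fun _ => 0 := by
  ext x
  simp [dirDeriv]

lemma dirDeriv_inner (v w : EuclideanSpace ℝ (Fin n)) :
    dirDeriv v (fun x => inner ℝ x w) = fun _ => inner ℝ v w := by
  ext x
  have h1 : HasFDerivAt (fun x : EuclideanSpace ℝ (Fin n) => inner ℝ x w) (innerSL ℝ w) x := by
    refine (innerSL ℝ w).hasFDerivAt.congr_of_eventuallyEq (Eventually.of_forall fun x => ?_)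
    simp [real_inner_comm]
  rw [dirDeriv, h1.fderiv, innerSL_apply_apply, real_inner_comm]

lemma TameOrder.add {k : ℕ} (hP : TameOrder k P) (hQ : TameOrder k Q) :
    TameOrder k fun x => P x + Q x := by
  induction k generalizing P Q with
  | zero => exact ⟨hP.1.add hQ.1, hP.2.add hQ.2⟩
  | succ k ih =>
    refine ⟨hP.1.add hQ.1, hP.2.1.add hQ.2.1, fun v => ?_⟩
    rw [dirDeriv_add v hP.1 hQ.1]
    exact ih (hP.2.2 v) (hQ.2.2 v)

lemma TameOrder.mul {k : ℕ} (hP : TameOrder k P) (hQ : TameOrder k Q) :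
    TameOrder k fun x => P x * Q x := by
  induction k generalizing P Q with
  | zero => exact ⟨hP.1.mul hQ.1, hP.2.mul hQ.2⟩
  | succ k ih =>
    refine ⟨hP.1.mul hQ.1, hP.2.1.mul hQ.2.1, fun v => ?_⟩
    rw [dirDeriv_mul v hP.1 hQ.1]
    exact (ih hP.of_succ (hQ.2.2 v)).add (ih (hP.2.2 v) hQ.of_succ)

lemma tameOrder_const (k : ℕ) (c : ℝ) :
    TameOrder k fun _ : EuclideanSpace ℝ (Fin n) => c := by
  induction k generalizing c with
  | zero => exact ⟨continuous_const, polyGrowth_const c⟩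
  | succ k ih =>
    refine ⟨differentiable_const c, polyGrowth_const c, fun v => ?_⟩
    rw [dirDeriv_const]
    exact ih 0

lemma Tame.polyGrowth (h : Tame P) : PolyGrowth P := (h 0).2
lemma Tame.continuous (h : Tame P) : Continuous P := (h 0).1
lemma Tame.differentiable (h : Tame P) : Differentiable ℝ P := (h 1).1
lemma Tame.dirDeriv (h : Tame P) (v : EuclideanSpace ℝ (Fin n)) : Tame (dirDeriv v P) :=
  fun k => (h (k + 1)).2.2 v
lemma Tame.add (hP : Tame P) (hQ : Tame Q) : Tame fun x => P x + Q x :=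
  fun k => (hP k).add (hQ k)
lemma Tame.mul (hP : Tame P) (hQ : Tame Q) : Tame fun x => P x * Q x :=
  fun k => (hP k).mul (hQ k)
lemma tame_const (c : ℝ) : Tame fun _ : EuclideanSpace ℝ (Fin n) => c :=
  fun k => tameOrder_const k c
lemma Tame.const_mul (hP : Tame P) (c : ℝ) : Tame fun x => c * P x := (tame_const c).mul hP
lemma Tame.sub (hP : Tame P) (hQ : Tame Q) : Tame fun x => P x - Q x := by
  have := hP.add (hQ.const_mul (-1))
  simpa [sub_eq_add_neg] using this
lemma Tame.sq (hP : Tame P) : Tame fun x => P x ^ 2 := by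
  simpa [_root_.sq] using hP.mul hP

lemma tame_inner (w : EuclideanSpace ℝ (Fin n)) : Tame fun x => inner ℝ x w := by
  intro k
  cases k with
  | zero => exact ⟨by fun_prop, polyGrowth_inner w⟩
  | succ k =>
    refine ⟨differentiable_id.inner ℝ (differentiable_const w), polyGrowth_inner w, fun v => ?_⟩
    rw [dirDeriv_inner]
    exact tameOrder_const k _

lemma Tame.sum {ι : Type*} (s : Finset ι) {P : ι → EuclideanSpace ℝ (Fin n) → ℝ}
    (hP : ∀ i, Tame (P i)) : Tame fun x => ∑ i ∈ s, P i x := by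
  classical
  induction s using Finset.induction_on with
  | empty => simpa using tame_const 0
  | insert a s ha ih =>
    simp_rw [Finset.sum_insert ha]
    exact (hP a).add ih

lemma dirDeriv_sum {ι : Type*} (s : Finset ι) {P : ι → EuclideanSpace ℝ (Fin n) → ℝ}
    (hP : ∀ i, Tame (P i)) (v : EuclideanSpace ℝ (Fin n)) :
    dirDeriv v (fun x => ∑ i ∈ s, P i x) = fun x => ∑ i ∈ s, dirDeriv v (P i) x := by
  ext x
  simp only [dirDeriv]
  rw [fderiv_fun_sum fun i _ => (hP i).differentiable x]
  simp

/-- The `i`-th partial derivative. -/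
def partialDeriv (i : Fin n) (P : EuclideanSpace ℝ (Fin n) → ℝ) :
    EuclideanSpace ℝ (Fin n) → ℝ := dirDeriv (EuclideanSpace.single i 1) P

lemma Tame.partialDeriv (h : Tame P) (i : Fin n) : Tame (partialDeriv i P) := h.dirDeriv _

lemma dirDeriv_eq_sum (v x : EuclideanSpace ℝ (Fin n)) :
    dirDeriv v P x = ∑ i, v i * partialDeriv i P x := by
  have h1 : v = ∑ i, v i • EuclideanSpace.single i (1 : ℝ) := by
    ext j
    simp [Finset.sum_apply, Pi.single_apply]
  conv_lhs => rw [dirDeriv, h1]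
  rw [map_sum]
  simp [HeatAdjoint.partialDeriv, dirDeriv]

lemma norm_gradient_sq_eq_sum (x : EuclideanSpace ℝ (Fin n)) :
    ‖gradient P x‖ ^ 2 = ∑ i, partialDeriv i P x ^ 2 := by
  rw [EuclideanSpace.norm_sq_eq]
  refine Finset.sum_congr rfl fun i _ => ?_
  have : gradient P x i = partialDeriv i P x := by
    have h := inner_gradient_left (f := P) (x := x) (y := EuclideanSpace.single i (1 : ℝ))
    rw [partialDeriv, dirDeriv, ← h, EuclideanSpace.inner_single_right]
    simp
  rw [this, Real.norm_eq_abs, sq_abs]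

/-- Differentiable partial derivatives make the full derivative differentiable, as a finite sum over
coordinates; symmetry of the second derivative then applies. -/
lemma Tame.partialDeriv_comm (h : Tame P) (i j : Fin n) :
    HeatAdjoint.partialDeriv i (HeatAdjoint.partialDeriv j P) =
      HeatAdjoint.partialDeriv j (HeatAdjoint.partialDeriv i P) := by
  have e1 : fderiv ℝ P = fun x => ∑ k, HeatAdjoint.partialDeriv k P x •
      (EuclideanSpace.proj k : EuclideanSpace ℝ (Fin n) →L[ℝ] ℝ) := by
    ext x v
    have := dirDeriv_eq_sum (P := P) v x
    rw [HeatAdjoint.dirDeriv] at this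
    rw [this]
    simp [mul_comm]
  have h1 : Differentiable ℝ (fderiv ℝ P) := by
    rw [e1]
    exact Differentiable.fun_sum fun k _ => (h.partialDeriv k).differentiable.smul_const _
  have key : ∀ (v w x : EuclideanSpace ℝ (Fin n)),
      HeatAdjoint.dirDeriv v (HeatAdjoint.dirDeriv w P) x = fderiv ℝ (fderiv ℝ P) x v w := by
    intro v w x
    have h2 : HasFDerivAt (HeatAdjoint.dirDeriv w P)
        ((ContinuousLinearMap.apply ℝ ℝ w).comp (fderiv ℝ (fderiv ℝ P) x)) x :=
      (ContinuousLinearMap.apply ℝ ℝ w).hasFDerivAt.comp x (h1 x).hasFDerivAt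
    rw [HeatAdjoint.dirDeriv, h2.fderiv]
    simp
  ext x
  simp only [HeatAdjoint.partialDeriv]
  rw [key, key]
  exact second_derivative_symmetric (fun y => (h.differentiable y).hasFDerivAt)
    (h1 x).hasFDerivAt _ _

/-- The Laplacian. -/
def lap (P : EuclideanSpace ℝ (Fin n) → ℝ) (x : EuclideanSpace ℝ (Fin n)) : ℝ :=
  ∑ i, partialDeriv i (partialDeriv i P) x

lemma Tame.lap (h : Tame P) : Tame (lap P) :=
  Tame.sum _ fun i => (h.partialDeriv i).partialDeriv i

/-- The product `⟨∇P, ∇Q⟩` of the gradients. -/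
def gradMul (P Q : EuclideanSpace ℝ (Fin n) → ℝ) (x : EuclideanSpace ℝ (Fin n)) : ℝ :=
  ∑ i, partialDeriv i P x * partialDeriv i Q x

lemma Tame.gradMul (hP : Tame P) (hQ : Tame Q) : Tame (gradMul P Q) :=
  Tame.sum _ fun i => (hP.partialDeriv i).mul (hQ.partialDeriv i)

lemma lap_add (hP : Tame P) (hQ : Tame Q) :
    lap (fun x => P x + Q x) = fun x => lap P x + lap Q x := by
  ext x
  simp only [lap, partialDeriv]
  rw [← Finset.sum_add_distrib]
  refine Finset.sum_congr rfl fun i _ => ?_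
  rw [dirDeriv_add _ hP.differentiable hQ.differentiable,
    dirDeriv_add _ (hP.dirDeriv _).differentiable (hQ.dirDeriv _).differentiable]

lemma lap_mul (hP : Tame P) (hQ : Tame Q) :
    lap (fun x => P x * Q x) = fun x => P x * lap Q x + Q x * lap P x + 2 * gradMul P Q x := by
  ext x
  simp only [lap, gradMul, partialDeriv]
  rw [Finset.mul_sum, Finset.mul_sum, Finset.mul_sum, ← Finset.sum_add_distrib,
    ← Finset.sum_add_distrib]
  refine Finset.sum_congr rfl fun i _ => ?_
  rw [dirDeriv_mul _ hP.differentiable hQ.differentiable,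
    dirDeriv_add _ (hP.mul (hQ.dirDeriv _)).differentiable
      ((hP.dirDeriv _).mul hQ).differentiable,
    dirDeriv_mul _ hP.differentiable (hQ.dirDeriv _).differentiable,
    dirDeriv_mul _ (hP.dirDeriv _).differentiable hQ.differentiable]
  ring

lemma lap_const_mul (hP : Tame P) (c : ℝ) : lap (fun x => c * P x) = fun x => c * lap P x := by
  rw [lap_mul (tame_const c) hP]
  ext x
  have h : ∀ i : Fin n, partialDeriv i (fun _ => c) = fun _ => 0 := fun i => dirDeriv_const _ c
  have h' : ∀ i : Fin n, partialDeriv i (fun _ : EuclideanSpace ℝ (Fin n) => (0 : ℝ)) = fun _ => 0 :=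
    fun i => dirDeriv_const _ 0
  simp [lap, gradMul, h, h']

end

/-! ### Regularity of the flow for boundedly supported measures -/

section

section Tame

variable {n : ℕ}

lemma integrable_add_norm_pow_gaussian (t c : ℝ) (K : ℕ) :
    Integrable (fun z => (c + ‖z‖) ^ K) (gaussian n t) := by
  have hG : IsGaussian (gaussian n t) := by unfold gaussian; infer_instance
  have h1 : MemLp (fun z => c + ‖z‖) K (gaussian n t) :=
    (memLp_const c).add (IsGaussian.memLp_id (gaussian n t) K (by simp)).norm
  refine h1.integrable_norm_pow'.mono (by fun_prop) (ae_of_all _ fun z => ?_)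
  simp

/-- Expressing every γ_t through one Gaussian moves the time dependence from the measure into the
integrand. -/
lemma gaussian_eq_map {t : ℝ} (ht : 0 ≤ t) :
    gaussian n t = (gaussian n 1).map (fun z => √t • z) := by
  have : IsProbabilityMeasure ((gaussian n 1).map (fun z => √t • z)) :=
    Measure.isProbabilityMeasure_map (by fun_prop)
  refine Measure.ext_of_charFun ?_
  ext x
  rw [charFun_map_smul]
  unfold gaussian
  rw [charFun_multivariateGaussian (Matrix.PosSemidef.one.smul ht),
    charFun_multivariateGaussian (Matrix.PosSemidef.one.smul zero_le_one)]
  simp only [inner_zero_right, Matrix.smul_mulVec, Matrix.one_mulVec, WithLp.ofLp_smul,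
    dotProduct_smul, smul_dotProduct, smul_eq_mul, one_mul]
  have e : (t : ℂ) = √t * √t := by rw [← Complex.ofReal_mul, Real.mul_self_sqrt ht]
  push_cast
  rw [e]
  ring_nf

lemma TameOrder.comp_add_smul {k : ℕ} {P : EuclideanSpace ℝ (Fin n) → ℝ} (hP : TameOrder k P)
    (x : EuclideanSpace ℝ (Fin n)) (s : ℝ) : TameOrder k fun z => P (x + s • z) := by
  have hpoly : ∀ {P : EuclideanSpace ℝ (Fin n) → ℝ}, PolyGrowth P →
      PolyGrowth fun z => P (x + s • z) := by
    rintro P ⟨C, K, hC, h⟩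
    refine ⟨C * (1 + ‖x‖ + |s|) ^ K, K, by positivity, fun z => (h _).trans ?_⟩
    rw [mul_assoc, ← mul_pow]
    gcongr
    have h1 := norm_add_le x (s • z)
    rw [norm_smul, Real.norm_eq_abs] at h1
    nlinarith [norm_nonneg x, norm_nonneg z, abs_nonneg s, mul_nonneg (norm_nonneg x) (norm_nonneg z)]
  induction k generalizing P with
  | zero => exact ⟨hP.1.comp (by fun_prop), hpoly hP.2⟩
  | succ k ih =>
    have hd : ∀ z, HasFDerivAt (fun z => P (x + s • z)) ((fderiv ℝ P (x + s • z)).comp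
        (s • ContinuousLinearMap.id ℝ (EuclideanSpace ℝ (Fin n)))) z := fun z =>
      (hP.1 (x + s • z)).hasFDerivAt.comp z
        (((hasFDerivAt_id (𝕜 := ℝ) z).const_smul s).const_add x)
    refine ⟨fun z => (hd z).differentiableAt, hpoly hP.2.1, fun v => ?_⟩
    have e : dirDeriv v (fun z => P (x + s • z)) = fun z => s * dirDeriv v P (x + s • z) := by
      ext z
      rw [dirDeriv, (hd z).fderiv]
      simp [dirDeriv]
    rw [e]
    exact (tameOrder_const k s).mul (ih (hP.2.2 v))

variable {π : Measure (EuclideanSpace ℝ (Fin n))} {R : ℝ}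

lemma memLp_top_inner (hR : ∀ᵐ x ∂π, ‖x‖ ≤ R) (v : EuclideanSpace ℝ (Fin n)) :
    MemLp (fun x => inner ℝ x v) ⊤ π := by
  refine memLp_top_of_bound (by fun_prop) (R * ‖v‖) ?_
  filter_upwards [hR] with x hx
  exact (norm_inner_le_norm x v).trans (by gcongr)

lemma MemLp.exists_bound {a : EuclideanSpace ℝ (Fin n) → ℝ} (ha : MemLp a ⊤ π) :
    ∃ C, 0 ≤ C ∧ ∀ᵐ x ∂π, |a x| ≤ C := by
  refine ⟨(eLpNorm a ⊤ π).toReal, ENNReal.toReal_nonneg, ?_⟩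
  rw [eLpNorm_exponent_top]
  filter_upwards [ae_le_eLpNormEssSup (f := a) (μ := π)] with x hx
  have h := ENNReal.toReal_mono (by simpa using ha.2.ne) hx
  simpa using h

/-- Integrability of functions of polynomial growth under the joint law of the heat flow. -/
lemma PolyGrowth.integrable_prod [IsProbabilityMeasure π] (hR : ∀ᵐ x ∂π, ‖x‖ ≤ R)
    {a : EuclideanSpace ℝ (Fin n) → ℝ} (ha : MemLp a ⊤ π) {P : EuclideanSpace ℝ (Fin n) → ℝ}
    (hP : PolyGrowth P) (hPc : Continuous P) (s t : ℝ) :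
    Integrable (fun p : EuclideanSpace ℝ (Fin n) × EuclideanSpace ℝ (Fin n) =>
      a p.1 * P (p.1 + s • p.2)) (π.prod (gaussian n t)) := by
  obtain ⟨C, K, hC, h⟩ := hP
  obtain ⟨A, hA, hbA⟩ := MemLp.exists_bound ha
  have h1 := ((integrable_add_norm_pow_gaussian (n := n) t (1 + |R|) K).comp_snd π).const_mul
    (A * (C * (1 + |s|) ^ K))
  refine h1.mono' ?_ ?_
  · exact (ha.1.comp_quasiMeasurePreserving Measure.quasiMeasurePreserving_fst).mul
      (hPc.comp (by fun_prop)).aestronglyMeasurable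
  · filter_upwards [Measure.quasiMeasurePreserving_fst.ae hR,
      Measure.quasiMeasurePreserving_fst.ae hbA] with p hp hp'
    rw [norm_mul, Real.norm_eq_abs, Real.norm_eq_abs, mul_assoc]
    refine mul_le_mul hp' ((h _).trans ?_) (abs_nonneg _) hA
    rw [mul_assoc, ← mul_pow]
    gcongr
    have h1 := norm_add_le p.1 (s • p.2)
    rw [norm_smul, Real.norm_eq_abs] at h1
    nlinarith [norm_nonneg p.2, abs_nonneg s, abs_nonneg R, le_abs_self R,
      mul_nonneg (abs_nonneg s) (abs_nonneg R)]

lemma PolyGrowth.integrable_heatFlow [IsProbabilityMeasure π] (hR : ∀ᵐ x ∂π, ‖x‖ ≤ R)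
    {P : EuclideanSpace ℝ (Fin n) → ℝ} (hP : PolyGrowth P) (hPc : Continuous P) (t : ℝ) :
    Integrable P (heatFlow π t) := by
  have h1 := hP.integrable_prod hR (memLp_top_const 1) hPc 1 t
  unfold heatFlow Measure.conv
  rw [integrable_map_measure hPc.aestronglyMeasurable (by fun_prop)]
  exact h1.congr (ae_of_all _ fun p => by simp)

lemma Tame.integrable_heatFlow [IsProbabilityMeasure π] (hR : ∀ᵐ x ∂π, ‖x‖ ≤ R)
    {P : EuclideanSpace ℝ (Fin n) → ℝ} (hP : Tame P) (t : ℝ) :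
    Integrable P (heatFlow π t) := hP.polyGrowth.integrable_heatFlow hR hP.continuous t

lemma Tame.memLp_heatFlow [IsProbabilityMeasure π] (hR : ∀ᵐ x ∂π, ‖x‖ ≤ R)
    {P : EuclideanSpace ℝ (Fin n) → ℝ} (hP : Tame P) (t : ℝ) :
    MemLp P 2 (heatFlow π t) := by
  rw [memLp_two_iff_integrable_sq hP.continuous.aestronglyMeasurable]
  exact hP.sq.integrable_heatFlow hR t

lemma abs_heatAdjoint_le [IsProbabilityMeasure π] {t : ℝ} (ht : 0 < t)
    {a : EuclideanSpace ℝ (Fin n) → ℝ} {C : ℝ} (ha : ∀ᵐ x ∂π, |a x| ≤ C)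
    (y : EuclideanSpace ℝ (Fin n)) : |heatAdjoint π t a y| ≤ C := by
  rw [heatAdjoint_of_pos _ ht, abs_div, abs_of_pos (heatMass_pos ht y),
    div_le_iff₀ (heatMass_pos ht y)]
  unfold heatNum heatMass
  rw [← integral_const_mul]
  have h1 : Integrable (fun x => gaussianDensity n t (y - x)) π := by
    simpa using integrable_mul_gaussianDensity (π := π) ht (integrable_const 1) y
  rw [← Real.norm_eq_abs]
  refine norm_integral_le_of_norm_le (h1.const_mul C) ?_
  filter_upwards [ha] with x hx
  rw [norm_mul, Real.norm_of_nonneg (gaussianDensity_pos ht _).le]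
  exact mul_le_mul_of_nonneg_right hx (gaussianDensity_pos ht _).le

lemma heatNum_mul_inner_sub [IsProbabilityMeasure π] (hR : ∀ᵐ x ∂π, ‖x‖ ≤ R) {t : ℝ} (ht : 0 < t)
    {a : EuclideanSpace ℝ (Fin n) → ℝ} (ha : MemLp a ⊤ π) (y v : EuclideanSpace ℝ (Fin n)) :
    heatNum π t (fun x => a x * inner ℝ (x - y) v) y =
      heatNum π t (fun x => a x * inner ℝ x v) y - inner ℝ y v * heatNum π t a y := by
  unfold heatNum
  have i1 : Integrable (fun x => a x * inner ℝ x v) π :=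
    ((memLp_top_inner hR v).mul ha (r := ⊤)).integrable le_top
  have i2 := integrable_mul_gaussianDensity ht i1 y
  have i3 := (integrable_mul_gaussianDensity ht (ha.integrable le_top) y).const_mul (inner ℝ y v)
  rw [← integral_const_mul, ← integral_sub i2 i3]
  refine integral_congr_ae (ae_of_all _ fun x => ?_)
  dsimp only
  rw [inner_sub_left]
  ring

/-- The derivative of the posterior mean is a posterior covariance. -/
lemma dirDeriv_heatAdjoint [IsProbabilityMeasure π] (hR : ∀ᵐ x ∂π, ‖x‖ ≤ R) {t : ℝ} (ht : 0 < t)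
    {a : EuclideanSpace ℝ (Fin n) → ℝ} (ha : MemLp a ⊤ π) (v : EuclideanSpace ℝ (Fin n)) :
    dirDeriv v (heatAdjoint π t a) = fun y => t⁻¹ * (heatAdjoint π t (fun x => a x * inner ℝ x v) y
      - heatAdjoint π t a y * heatAdjoint π t (fun x => inner ℝ x v) y) := by
  ext y
  rw [dirDeriv, (hasFDerivAt_heatAdjoint ht (ha.integrable le_top) y v).2,
    heatNum_mul_inner_sub hR ht ha]
  have h1 := heatNum_mul_inner_sub hR ht (memLp_top_const 1) y v
  simp only [one_mul] at h1
  rw [h1, heatNum_one]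
  simp only [heatAdjoint_of_pos _ ht]
  have := (heatMass_pos (π := π) ht y).ne'
  field_simp
  ring

/-- A derivative of a posterior mean is a posterior covariance, hence a polynomial in posterior
means. On a bounded support, multiplying by ⟨x, v⟩ preserves boundedness, so the induction closes.
-/
lemma tame_heatAdjoint [IsProbabilityMeasure π] (hR : ∀ᵐ x ∂π, ‖x‖ ≤ R) {t : ℝ} (ht : 0 < t)
    {a : EuclideanSpace ℝ (Fin n) → ℝ} (ha : MemLp a ⊤ π) : Tame (heatAdjoint π t a) := by
  intro k
  induction k generalizing a with
  | zero =>
    obtain ⟨C, -, hC⟩ := MemLp.exists_bound ha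
    exact ⟨(contDiff_heatAdjoint ht (ha.integrable le_top)).continuous,
      .of_bounded (abs_heatAdjoint_le ht hC)⟩
  | succ k ih =>
    refine ⟨fun y => (hasFDerivAt_heatAdjoint ht (ha.integrable le_top) y 0).1,
      (ih ha).polyGrowth, fun v => ?_⟩
    rw [dirDeriv_heatAdjoint hR ht ha]
    have h1 : MemLp (fun x => a x * inner ℝ x v) ⊤ π := (memLp_top_inner hR v).mul ha
    have h2 := (ih h1).add ((tameOrder_const k (-1)).mul
      ((ih ha).mul (ih (memLp_top_inner hR v))))
    have h3 := (tameOrder_const k t⁻¹).mul h2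
    refine cast (congrArg _ ?_) h3
    ext y
    ring

variable (π) in
/-- The directional derivative of the logarithm of the density of the heat flow. -/
def score (t : ℝ) (v y : EuclideanSpace ℝ (Fin n)) : ℝ :=
  t⁻¹ * (heatAdjoint π t (fun x => inner ℝ x v) y - inner ℝ y v)

lemma tame_score [IsProbabilityMeasure π] (hR : ∀ᵐ x ∂π, ‖x‖ ≤ R) {t : ℝ} (ht : 0 < t)
    (v : EuclideanSpace ℝ (Fin n)) : Tame (score π t v) :=
  ((tame_heatAdjoint hR ht (memLp_top_inner hR v)).sub (tame_inner v)).const_mul _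

lemma hasFDerivAt_heatMass [IsProbabilityMeasure π] (hR : ∀ᵐ x ∂π, ‖x‖ ≤ R) {t : ℝ} (ht : 0 < t)
    (y v : EuclideanSpace ℝ (Fin n)) :
    DifferentiableAt ℝ (heatMass π t) y ∧
      fderiv ℝ (heatMass π t) y v = heatMass π t y * score π t v y := by
  have e : heatMass π t = heatNum π t (fun _ => 1) := funext fun y => (heatNum_one π t y).symm
  rw [e]
  refine ⟨(hasFDerivAt_heatNum ht (integrable_const 1) y).1.differentiableAt, ?_⟩
  have h1 := heatNum_mul_inner_sub hR ht (memLp_top_const 1) y v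
  rw [fderiv_heatNum_apply ht (integrable_const 1)]
  change t⁻¹ * heatNum π t (fun x => 1 * inner ℝ (x - y) v) y = _
  rw [h1, score, heatAdjoint_of_pos _ ht]
  simp only [one_mul]
  rw [heatNum_one]
  have := (heatMass_pos (π := π) ht y).ne'
  field_simp

/-- Integration by parts with respect to the heat flow. -/
lemma integral_dirDeriv_heatFlow [IsProbabilityMeasure π] (hR : ∀ᵐ x ∂π, ‖x‖ ≤ R) {t : ℝ}
    (ht : 0 < t) {P : EuclideanSpace ℝ (Fin n) → ℝ} (hP : TameOrder 1 P)
    (v : EuclideanSpace ℝ (Fin n)) :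
    ∫ y, dirDeriv v P y ∂(heatFlow π t) = - ∫ y, P y * score π t v y ∂(heatFlow π t) := by
  have hs := tame_score hR ht v
  have i1 := (integrable_heatFlow_iff ht).1
    ((hP.2.2 v).polyGrowth.integrable_heatFlow hR (hP.2.2 v).continuous t)
  have i2 := (integrable_heatFlow_iff ht).1
    ((hP.polyGrowth.mul hs.polyGrowth).integrable_heatFlow hR (hP.continuous.mul hs.continuous) t)
  have i3 := (integrable_heatFlow_iff ht).1
    (hP.polyGrowth.integrable_heatFlow hR hP.continuous t)
  rw [integral_heatFlow ht, integral_heatFlow ht]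
  have h := integral_mul_fderiv_eq_neg_fderiv_mul_of_integrable (μ := volume)
    (f := heatMass π t) (g := P) (v := v) ?_ i1 i3
    (fun y _ => (hasFDerivAt_heatMass hR ht y v).1) (fun y _ => hP.1 y)
  · simp only [smul_eq_mul]
    rw [show (∫ y, heatMass π t y * dirDeriv v P y) = ∫ y, heatMass π t y * fderiv ℝ P y v from rfl,
      h]
    congr 1
    refine integral_congr_ae (ae_of_all _ fun y => ?_)
    dsimp only
    rw [(hasFDerivAt_heatMass hR ht y v).2]
    ring
  · refine i2.congr (ae_of_all _ fun y => ?_)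
    dsimp only
    rw [(hasFDerivAt_heatMass hR ht y v).2, smul_eq_mul]
    ring

/-- Stein's identity, as a special case: γ_1 is the heat flow of the Dirac mass at time one, and its
score in direction v is −⟨z, v⟩. -/
lemma integral_inner_mul_gaussian {P : EuclideanSpace ℝ (Fin n) → ℝ} (hP : TameOrder 1 P)
    (v : EuclideanSpace ℝ (Fin n)) :
    ∫ z, inner ℝ z v * P z ∂(gaussian n 1) = ∫ z, dirDeriv v P z ∂(gaussian n 1) := by
  have h0 : ∀ᵐ x ∂(Measure.dirac (0 : EuclideanSpace ℝ (Fin n))), ‖x‖ ≤ 0 := by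
    rw [ae_dirac_eq]; simp
  have h := integral_dirDeriv_heatFlow h0 one_pos hP v
  have e : heatFlow (Measure.dirac (0 : EuclideanSpace ℝ (Fin n))) 1 = gaussian n 1 := by
    rw [heatFlow, Measure.dirac_zero_conv]
  rw [e] at h
  rw [h, ← integral_neg]
  refine integral_congr_ae (ae_of_all _ fun z => ?_)
  simp only [score, heatAdjoint_of_pos _ one_pos, heatNum, integral_dirac]
  simp
  ring

end Tame

end

/-! ### The heat equation in weak form -/

section

section FlowPair

variable {n : ℕ} {π : Measure (EuclideanSpace ℝ (Fin n))} {R : ℝ}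

variable (π) in
/-- The pairing `⟨Q_t^* a, P⟩` in `L²(π_t)`. -/
def flowPair (a P : EuclideanSpace ℝ (Fin n) → ℝ) (t : ℝ) : ℝ :=
  ∫ y, heatAdjoint π t a y * P y ∂(heatFlow π t)

/-- Duality removes the adjoint and scaling fixes the measure. Time enters only through x + √t z
inside the smooth P, so no regularity of a is needed to differentiate. -/
lemma flowPair_eq_integral_prod [IsProbabilityMeasure π] (hR : ∀ᵐ x ∂π, ‖x‖ ≤ R)
    {a P : EuclideanSpace ℝ (Fin n) → ℝ} (ha : MemLp a ⊤ π) (hP : Tame P) {t : ℝ} (ht : 0 ≤ t) :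
    flowPair π a P t = ∫ p, a p.1 * P (p.1 + √t • p.2) ∂(π.prod (gaussian n 1)) := by
  rw [flowPair, ← integral_mul_heatSemigroup π ht a P (ha.mono_exponent le_top)
    (hP.memLp_heatFlow hR t),
    integral_prod _ (hP.polyGrowth.integrable_prod hR ha hP.continuous (√t) 1)]
  refine integral_congr_ae (ae_of_all _ fun x => ?_)
  dsimp only
  rw [integral_const_mul, heatSemigroup, gaussian_eq_map ht,
    integral_map (f := fun z => P (x + z)) (by fun_prop)
      (hP.continuous.comp (by fun_prop)).aestronglyMeasurable]

/-- Differentiation in s produces the factors z_i; Gaussian integration by parts replaces each by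
∂/∂z_i, which contributes s and a second derivative of P. -/
lemma hasDerivAt_integral_prod [IsProbabilityMeasure π] (hR : ∀ᵐ x ∂π, ‖x‖ ≤ R)
    {a P : EuclideanSpace ℝ (Fin n) → ℝ} (ha : MemLp a ⊤ π) (hP : Tame P) (s : ℝ) :
    HasDerivAt (fun s : ℝ => ∫ p, a p.1 * P (p.1 + s • p.2) ∂(π.prod (gaussian n 1)))
      (s * ∫ p, a p.1 * lap P (p.1 + s • p.2) ∂(π.prod (gaussian n 1))) s := by
  set μ := π.prod (gaussian n 1)
  -- the derivative of the integrand
  set F' : ℝ → EuclideanSpace ℝ (Fin n) × EuclideanSpace ℝ (Fin n) → ℝ := fun s p =>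
    a p.1 * dirDeriv p.2 P (p.1 + s • p.2) with hF'
  have hF'sum : ∀ s p, F' s p = ∑ i, a p.1 * (p.2 i * partialDeriv i P (p.1 + s • p.2)) := by
    intro s p
    rw [hF']
    dsimp only
    rw [dirDeriv_eq_sum, Finset.mul_sum]
  have ham : AEStronglyMeasurable (fun p : EuclideanSpace ℝ (Fin n) × EuclideanSpace ℝ (Fin n) =>
      a p.1) μ := ha.1.comp_quasiMeasurePreserving Measure.quasiMeasurePreserving_fst
  have hpm : ∀ (i : Fin n) (s : ℝ), Continuous fun p : EuclideanSpace ℝ (Fin n) ×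
      EuclideanSpace ℝ (Fin n) => p.2 i * partialDeriv i P (p.1 + s • p.2) := by
    intro i s
    have := (hP.partialDeriv i).continuous
    fun_prop
  obtain ⟨A, hA, hbA⟩ := MemLp.exists_bound ha
  choose C K hC hCK using fun i => (hP.partialDeriv i).polyGrowth
  -- the dominating function
  set bd : EuclideanSpace ℝ (Fin n) × EuclideanSpace ℝ (Fin n) → ℝ := fun p =>
    ∑ i, A * C i * (1 + |R| + |s|) ^ K i * (2 + ‖p.2‖) ^ (K i + 1) with hbd
  have hbdi : Integrable bd μ := by
    refine integrable_finsetSum _ fun i _ => ?_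
    exact ((integrable_add_norm_pow_gaussian (n := n) 1 2 (K i + 1)).comp_snd π).const_mul _
  have hbound : ∀ᵐ p ∂μ, ∀ s' ∈ Metric.ball s 1, ∀ i,
      |a p.1 * (p.2 i * partialDeriv i P (p.1 + s' • p.2))| ≤
        A * C i * (1 + |R| + |s|) ^ K i * (2 + ‖p.2‖) ^ (K i + 1) := by
    filter_upwards [Measure.quasiMeasurePreserving_fst.ae hR,
      Measure.quasiMeasurePreserving_fst.ae hbA] with p hp hp' s' hs' i
    have h1 : |p.2 i| ≤ 2 + ‖p.2‖ := by
      have := PiLp.norm_apply_le p.2 i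
      rw [Real.norm_eq_abs] at this
      linarith
    have h2 : 1 + ‖p.1 + s' • p.2‖ ≤ (1 + |R| + |s|) * (2 + ‖p.2‖) := by
      have h3 := norm_add_le p.1 (s' • p.2)
      rw [norm_smul, Real.norm_eq_abs] at h3
      have h4 : |s'| ≤ |s| + 1 := by
        rw [Metric.mem_ball, Real.dist_eq] at hs'
        have := abs_sub_abs_le_abs_sub s' s
        linarith
      nlinarith [norm_nonneg p.2, abs_nonneg s, abs_nonneg R, le_abs_self R,
        mul_nonneg (abs_nonneg R) (norm_nonneg p.2),
        mul_le_mul_of_nonneg_right h4 (norm_nonneg p.2)]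
    rw [abs_mul, abs_mul, pow_succ]
    have h5 := (hCK i (p.1 + s' • p.2)).trans
      (mul_le_mul_of_nonneg_left (pow_le_pow_left₀ (by positivity) h2 (K i)) (hC i))
    rw [mul_pow] at h5
    calc |a p.1| * (|p.2 i| * |partialDeriv i P (p.1 + s' • p.2)|)
        ≤ A * ((2 + ‖p.2‖) * (C i * ((1 + |R| + |s|) ^ K i * (2 + ‖p.2‖) ^ K i))) := by
          gcongr
      _ = _ := by ring
  have hF'bd : ∀ᵐ p ∂μ, ∀ s' ∈ Metric.ball s 1, ‖F' s' p‖ ≤ bd p := by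
    filter_upwards [hbound] with p hp s' hs'
    rw [hF'sum]
    exact (norm_sum_le _ _).trans (Finset.sum_le_sum fun i _ => hp s' hs' i)
  have hint : ∀ i s', s' ∈ Metric.ball s 1 →
      Integrable (fun p => a p.1 * (p.2 i * partialDeriv i P (p.1 + s' • p.2))) μ := by
    intro i s' hs'
    refine (((integrable_add_norm_pow_gaussian (n := n) 1 2 (K i + 1)).comp_snd π).const_mul
      (A * C i * (1 + |R| + |s|) ^ K i)).mono' (ham.mul (hpm i s').aestronglyMeasurable) ?_
    filter_upwards [hbound] with p hp
    exact hp s' hs' i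
  have hs : s ∈ Metric.ball s 1 := Metric.mem_ball_self one_pos
  have hmeas : ∀ s' : ℝ, AEStronglyMeasurable (fun p => a p.1 * P (p.1 + s' • p.2)) μ := fun s' =>
    (hP.polyGrowth.integrable_prod hR ha hP.continuous s' 1).1
  have key := (hasDerivAt_integral_of_dominated_loc_of_deriv_le (μ := μ) (bound := bd)
    (F := fun s' p => a p.1 * P (p.1 + s' • p.2)) (F' := F') (Metric.ball_mem_nhds s one_pos)
    (Eventually.of_forall hmeas) (hP.polyGrowth.integrable_prod hR ha hP.continuous s 1)
    (by
      have e : F' s = fun p => ∑ i, a p.1 * (p.2 i * partialDeriv i P (p.1 + s • p.2)) :=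
        funext fun p => hF'sum s p
      rw [e]
      exact (integrable_finsetSum _ fun i _ => hint i s hs).1)
    hF'bd hbdi (ae_of_all _ fun p s' _ => by
      have h1 : HasDerivAt (fun s' : ℝ => p.1 + s' • p.2) p.2 s' := by
        simpa using ((hasDerivAt_id s').smul_const p.2).const_add p.1
      exact ((hP.differentiable _).hasFDerivAt.comp_hasDerivAt s' h1).const_mul (a p.1))).2
  refine key.congr_deriv ?_
  simp_rw [hF'sum]
  rw [integral_finsetSum _ fun i _ => hint i s hs, ← integral_const_mul]
  have hlap : ∀ p : EuclideanSpace ℝ (Fin n) × EuclideanSpace ℝ (Fin n),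
      s * (a p.1 * lap P (p.1 + s • p.2)) =
        ∑ i, s * (a p.1 * partialDeriv i (partialDeriv i P) (p.1 + s • p.2)) := by
    intro p
    rw [lap, Finset.mul_sum, Finset.mul_sum]
  simp_rw [hlap]
  have hi2 : ∀ i, Integrable (fun p => s * (a p.1 *
      partialDeriv i (partialDeriv i P) (p.1 + s • p.2))) μ := fun i =>
    (((hP.partialDeriv i).partialDeriv i).polyGrowth.integrable_prod hR ha
      ((hP.partialDeriv i).partialDeriv i).continuous s 1).const_mul s
  rw [integral_finsetSum _ fun i _ => hi2 i]
  refine Finset.sum_congr rfl fun i _ => ?_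
  rw [integral_prod _ (hint i s hs), integral_prod _ (hi2 i)]
  refine integral_congr_ae (ae_of_all _ fun x => ?_)
  dsimp only
  rw [integral_const_mul, integral_const_mul, integral_const_mul, mul_left_comm s (a x)]
  congr 1
  have h1 := integral_inner_mul_gaussian (((hP.partialDeriv i) 1).comp_add_smul x s)
    (EuclideanSpace.single i 1)
  simp only [EuclideanSpace.inner_single_right, conj_trivial, one_mul] at h1
  rw [h1, ← integral_const_mul]
  refine integral_congr_ae (ae_of_all _ fun z => ?_)
  have hd : HasFDerivAt (fun z => partialDeriv i P (x + s • z))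
      ((fderiv ℝ (partialDeriv i P) (x + s • z)).comp
        (s • ContinuousLinearMap.id ℝ (EuclideanSpace ℝ (Fin n)))) z :=
    ((hP.partialDeriv i).differentiable (x + s • z)).hasFDerivAt.comp z
      (((hasFDerivAt_id (𝕜 := ℝ) z).const_smul s).const_add x)
  dsimp only
  rw [dirDeriv, hd.fderiv]
  simp [partialDeriv, dirDeriv]

/-- The heat equation, tested against smooth functions of polynomial growth. -/
lemma hasDerivAt_flowPair [IsProbabilityMeasure π] (hR : ∀ᵐ x ∂π, ‖x‖ ≤ R)
    {a P : EuclideanSpace ℝ (Fin n) → ℝ} (ha : MemLp a ⊤ π) (hP : Tame P) {t : ℝ} (ht : 0 < t) :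
    HasDerivAt (flowPair π a P) (flowPair π a (lap P) t / 2) t := by
  -- With s = √t, the factor s cancels against the derivative 1/(2√t), leaving one half of the
  -- Laplacian.
  have h1 := (hasDerivAt_integral_prod hR ha hP (√t)).comp t (Real.hasDerivAt_sqrt ht.ne')
  refine (h1.congr_deriv ?_).congr_of_eventuallyEq ?_
  · rw [flowPair_eq_integral_prod hR ha hP.lap ht.le]
    have := (Real.sqrt_pos.2 ht).ne'
    field_simp
  · filter_upwards [lt_mem_nhds ht] with s hs
    rw [flowPair_eq_integral_prod hR ha hP hs.le]
    rfl

end FlowPair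

end

/-! ### Logconcavity of the flow and the Bochner formula -/

section

section Curvature

variable {n : ℕ} {π : Measure (EuclideanSpace ℝ (Fin n))} {R : ℝ}
  {P Q : EuclideanSpace ℝ (Fin n) → ℝ}

variable (π) in
/-- The directional derivative of `Q` along the score of the heat flow. -/
def drift (t : ℝ) (Q : EuclideanSpace ℝ (Fin n) → ℝ) (y : EuclideanSpace ℝ (Fin n)) : ℝ :=
  ∑ i, score π t (EuclideanSpace.single i 1) y * partialDeriv i Q y

variable (π) in
/-- The generator of the Langevin diffusion with invariant measure `π_t`. -/
def generator (t : ℝ) (Q : EuclideanSpace ℝ (Fin n) → ℝ) (y : EuclideanSpace ℝ (Fin n)) : ℝ :=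
  lap Q y + drift π t Q y

lemma Tame.drift [IsProbabilityMeasure π] (hR : ∀ᵐ x ∂π, ‖x‖ ≤ R) {t : ℝ} (ht : 0 < t)
    (hQ : Tame Q) : Tame (drift π t Q) :=
  Tame.sum _ fun i => (tame_score hR ht _).mul (hQ.partialDeriv i)

lemma Tame.generator [IsProbabilityMeasure π] (hR : ∀ᵐ x ∂π, ‖x‖ ≤ R) {t : ℝ} (ht : 0 < t)
    (hQ : Tame Q) : Tame (generator π t Q) := hQ.lap.add (hQ.drift hR ht)

/-- The generator is symmetric: the integral of the gradient product. -/
lemma integral_gradMul_add [IsProbabilityMeasure π] (hR : ∀ᵐ x ∂π, ‖x‖ ≤ R) {t : ℝ} (ht : 0 < t)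
    (hP : Tame P) (hQ : Tame Q) :
    ∫ y, (gradMul P Q y + P y * generator π t Q y) ∂(heatFlow π t) = 0 := by
  -- The integrand is the divergence of P∇Q weighted by the density of π_t, expanded coordinate by
  -- coordinate.
  have e : ∀ y, gradMul P Q y + P y * generator π t Q y =
      ∑ i, (dirDeriv (EuclideanSpace.single i 1) (fun y => P y * partialDeriv i Q y) y +
        P y * partialDeriv i Q y * score π t (EuclideanSpace.single i 1) y) := by
    intro y
    rw [gradMul, generator, lap, drift, ← Finset.sum_add_distrib, Finset.mul_sum,
      ← Finset.sum_add_distrib]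
    refine Finset.sum_congr rfl fun i _ => ?_
    rw [dirDeriv_mul _ hP.differentiable (hQ.partialDeriv i).differentiable]
    simp only [partialDeriv]
    ring
  simp_rw [e]
  have ht' : ∀ i, Tame fun y => P y * partialDeriv i Q y := fun i => hP.mul (hQ.partialDeriv i)
  have i1 : ∀ i, Integrable (dirDeriv (EuclideanSpace.single i 1)
      (fun y => P y * partialDeriv i Q y)) (heatFlow π t) := fun i =>
    ((ht' i).dirDeriv _).integrable_heatFlow hR t
  have i2 : ∀ i, Integrable (fun y => P y * partialDeriv i Q y *
      score π t (EuclideanSpace.single i 1) y) (heatFlow π t) := fun i =>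
    ((ht' i).mul (tame_score hR ht _)).integrable_heatFlow hR t
  have i3 : ∀ i, Integrable (fun y => dirDeriv (EuclideanSpace.single i 1)
      (fun y => P y * partialDeriv i Q y) y + P y * partialDeriv i Q y *
      score π t (EuclideanSpace.single i 1) y) (heatFlow π t) := fun i => (i1 i).add (i2 i)
  rw [integral_finsetSum _ fun i _ => i3 i]
  refine Finset.sum_eq_zero fun i _ => ?_
  rw [integral_add (i1 i) (i2 i), integral_dirDeriv_heatFlow hR ht (ht' i 1), neg_add_cancel]

/-- Linearity in the direction is inherited from the derivative of the density, of which the score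
is the logarithmic derivative. -/
lemma score_eq_sum [IsProbabilityMeasure π] (hR : ∀ᵐ x ∂π, ‖x‖ ≤ R) {t : ℝ} (ht : 0 < t)
    (e y : EuclideanSpace ℝ (Fin n)) :
    score π t e y = ∑ i, e i * score π t (EuclideanSpace.single i 1) y := by
  have hm := (heatMass_pos (π := π) ht y).ne'
  have h1 := dirDeriv_eq_sum (P := heatMass π t) e y
  simp only [partialDeriv, dirDeriv, (hasFDerivAt_heatMass hR ht y _).2] at h1
  rw [← mul_right_inj' hm, h1, Finset.mul_sum]
  exact Finset.sum_congr rfl fun i _ => by ring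

/-- The heat flow is logconcave: the Hessian of the log density is nonpositive. -/
lemma dirDeriv_score_nonpos (hπ : IsLogConcave π) [IsProbabilityMeasure π]
    (hR : ∀ᵐ x ∂π, ‖x‖ ≤ R) {t : ℝ} (ht : 0 < t) (e y : EuclideanSpace ℝ (Fin n)) :
    dirDeriv e (score π t e) y ≤ 0 := by
  have ha := memLp_top_inner hR e
  have hm := heatMass_pos (π := π) ht y
  -- The second derivative of the log density along e is (V/t − ‖e‖²)/t, where V is the posterior
  -- variance of ⟨x, e⟩. The bound V ≤ t‖e‖² settles the sign.
  have h1 : dirDeriv e (score π t e) y = t⁻¹ * (dirDeriv e (heatAdjoint π t fun x => inner ℝ x e) y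
      - ‖e‖ ^ 2) := by
    have hd := (tame_heatAdjoint hR ht ha).differentiable
    have e1 : score π t e = fun y => t⁻¹ * (heatAdjoint π t (fun x => inner ℝ x e) y +
        (-1) * inner ℝ y e) := by ext y; rw [score]; ring
    have hd' : Differentiable ℝ fun y => heatAdjoint π t (fun x => inner ℝ x e) y +
        (-1) * inner ℝ y e := hd.add ((tame_inner e).const_mul _).differentiable
    rw [e1, dirDeriv_mul _ (differentiable_const _) hd', dirDeriv_add _ hd ((tame_inner e).const_mul _).differentiable,
      dirDeriv_mul _ (differentiable_const _) (tame_inner e).differentiable, dirDeriv_inner,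
      dirDeriv_const, dirDeriv_const, real_inner_self_eq_norm_sq]
    ring
  rw [h1, dirDeriv_heatAdjoint hR ht ha]
  refine mul_nonpos_of_nonneg_of_nonpos (inv_nonneg.2 ht.le) (sub_nonpos.2 ?_)
  have h2 := variance_inner_posterior_le hπ ht y e
  have h3 := heatNum_mul_inner_sub hR ht (memLp_top_const 1) y e
  have h4 := heatNum_mul_inner_sub hR ht ha y e
  have ha' : MemLp (fun x => inner ℝ (x - y) e) ⊤ π := by
    have : (fun x : EuclideanSpace ℝ (Fin n) => inner ℝ (x - y) e) =
        (fun x => inner ℝ x e) - fun _ => inner ℝ y e := by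
      ext x; simp [inner_sub_left]
    rw [this]
    exact ha.sub (memLp_top_const _)
  have h5 := heatNum_mul_inner_sub hR ht ha' y e
  simp only [one_mul] at h3
  simp only [← sq, mul_comm (inner ℝ (_ - y) e) (inner ℝ _ e), heatNum_one] at h2 h3 h4 h5
  rw [h5, h4, h3] at h2
  simp only [heatAdjoint_of_pos _ ht, ← sq]
  rw [inv_mul_le_iff₀ ht]
  have h6 : heatNum π t (fun x => inner ℝ x e ^ 2) y / heatMass π t y -
      heatNum π t (fun x => inner ℝ x e) y / heatMass π t y *
        (heatNum π t (fun x => inner ℝ x e) y / heatMass π t y) =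
      (heatMass π t y * heatNum π t (fun x => inner ℝ x e ^ 2) y -
        heatNum π t (fun x => inner ℝ x e) y ^ 2) / heatMass π t y ^ 2 := by
    field_simp
  rw [← sq] at h6
  rw [h6, div_le_iff₀ (by positivity)]
  nlinarith

variable (π) in
/-- The Hessian of the log density of the heat flow, applied to the gradient of `w`. -/
def logHessian (t : ℝ) (w : EuclideanSpace ℝ (Fin n) → ℝ) (y : EuclideanSpace ℝ (Fin n)) : ℝ :=
  ∑ j, ∑ i, partialDeriv j w y * partialDeriv i w y *
    partialDeriv j (score π t (EuclideanSpace.single i 1)) y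

lemma Tame.logHessian [IsProbabilityMeasure π] (hR : ∀ᵐ x ∂π, ‖x‖ ≤ R) {t : ℝ} (ht : 0 < t)
    (hQ : Tame Q) : Tame (logHessian π t Q) :=
  Tame.sum _ fun j => Tame.sum _ fun i => ((hQ.partialDeriv j).mul (hQ.partialDeriv i)).mul
    ((tame_score hR ht _).partialDeriv j)

/-- With e frozen at the value ∇w(y), the double sum is the second derivative of the log density
along e. -/
lemma logHessian_nonpos (hπ : IsLogConcave π) [IsProbabilityMeasure π]
    (hR : ∀ᵐ x ∂π, ‖x‖ ≤ R) {t : ℝ} (ht : 0 < t) (w : EuclideanSpace ℝ (Fin n) → ℝ)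
    (y : EuclideanSpace ℝ (Fin n)) : logHessian π t w y ≤ 0 := by
  set e : EuclideanSpace ℝ (Fin n) := WithLp.toLp 2 fun i => partialDeriv i w y with he
  refine le_of_eq_of_le ?_ (dirDeriv_score_nonpos hπ hR ht e y)
  rw [dirDeriv_eq_sum, logHessian]
  refine Finset.sum_congr rfl fun j _ => ?_
  have h1 : score π t e = fun y => ∑ i, e i * score π t (EuclideanSpace.single i 1) y :=
    funext fun y => score_eq_sum hR ht e y
  have h2 : partialDeriv j (fun y => ∑ i, e i * score π t (EuclideanSpace.single i 1) y) =
      fun y => ∑ i, dirDeriv (EuclideanSpace.single j 1)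
        (fun y => e i * score π t (EuclideanSpace.single i 1) y) y :=
    dirDeriv_sum _ (fun i => (tame_score hR ht _).const_mul _) _
  rw [h1, h2, Finset.mul_sum]
  refine Finset.sum_congr rfl fun i _ => ?_
  rw [dirDeriv_mul _ (differentiable_const _) (tame_score hR ht _).differentiable, dirDeriv_const]
  simp only [he, partialDeriv]
  ring

/-- The drift part of Bochner's formula: after the product rule the second derivatives of P match by
symmetry, and differentiating the score leaves the Hessian of the log density. -/
lemma drift_gradMul [IsProbabilityMeasure π] (hR : ∀ᵐ x ∂π, ‖x‖ ≤ R) {t : ℝ} (ht : 0 < t)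
    (hP : Tame P) (y : EuclideanSpace ℝ (Fin n)) :
    drift π t (gradMul P P) y / 2 = gradMul (drift π t P) P y - logHessian π t P y := by
  have hB := fun i => tame_score (n := n) (π := π) hR ht (EuclideanSpace.single i 1)
  have h1 : ∀ i, partialDeriv i (gradMul P P) y =
      ∑ j, 2 * (partialDeriv j P y * partialDeriv i (partialDeriv j P) y) := by
    intro i
    unfold gradMul
    rw [partialDeriv, dirDeriv_sum _ fun j => (hP.partialDeriv j).mul (hP.partialDeriv j)]
    refine Finset.sum_congr rfl fun j _ => ?_
    rw [dirDeriv_mul _ (hP.partialDeriv j).differentiable (hP.partialDeriv j).differentiable]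
    simp only [partialDeriv]
    ring
  have h2 : ∀ j, partialDeriv j (drift π t P) y =
      ∑ i, (score π t (EuclideanSpace.single i 1) y * partialDeriv j (partialDeriv i P) y +
        partialDeriv j (score π t (EuclideanSpace.single i 1)) y * partialDeriv i P y) := by
    intro j
    have e : drift π t P = fun y =>
      ∑ i, score π t (EuclideanSpace.single i 1) y * partialDeriv i P y := rfl
    rw [e, partialDeriv, dirDeriv_sum _ fun i => (hB i).mul (hP.partialDeriv i)]
    refine Finset.sum_congr rfl fun i _ => ?_
    rw [dirDeriv_mul _ (hB i).differentiable (hP.partialDeriv i).differentiable]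
    simp only [partialDeriv]
  rw [gradMul, logHessian, drift, ← Finset.sum_sub_distrib]
  simp_rw [h1, h2, Finset.mul_sum, Finset.sum_mul, ← Finset.sum_sub_distrib]
  rw [Finset.sum_comm, Finset.sum_div]
  refine Finset.sum_congr rfl fun j _ => ?_
  rw [Finset.sum_div]
  refine Finset.sum_congr rfl fun i _ => ?_
  rw [hP.partialDeriv_comm j i]
  ring

lemma gradMul_comm (P Q : EuclideanSpace ℝ (Fin n) → ℝ) (y : EuclideanSpace ℝ (Fin n)) :
    gradMul P Q y = gradMul Q P y :=
  Finset.sum_congr rfl fun _ _ => mul_comm _ _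

/-- A Bochner type formula. -/
lemma integral_second_variation [IsProbabilityMeasure π] (hR : ∀ᵐ x ∂π, ‖x‖ ≤ R) {t : ℝ}
    (ht : 0 < t) {w ψ : EuclideanSpace ℝ (Fin n) → ℝ} (hw : Tame w)
    (hψ : ψ = fun y => generator π t w y - 2⁻¹ * lap w y) :
    ∫ y, (w y * lap (lap w) y / 2 + 2 * (w y * lap ψ y) - lap (lap fun y => w y * w y) y / 4
      - 2 * lap (fun y => w y * ψ y) y - 2 * (ψ y * ψ y)) ∂(heatFlow π t) =
    ∫ y, (generator π t w y ^ 2 - logHessian π t w y) ∂(heatFlow π t) := by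
  have hL := hw.generator hR ht
  have hd := hw.drift hR ht
  have hψt : Tame ψ := by rw [hψ]; exact hL.sub (hw.lap.const_mul _)
  have hG := hw.gradMul hw
  have t1 : Tame fun y => gradMul (lap w) w y + lap w y * generator π t w y :=
    (hw.lap.gradMul hw).add (hw.lap.mul hL)
  have t2 : Tame fun y => gradMul ψ w y + ψ y * generator π t w y :=
    (hψt.gradMul hw).add (hψt.mul hL)
  have t3 : Tame fun y => gradMul (fun _ => 1) (gradMul w w) y +
      1 * generator π t (gradMul w w) y :=
    ((tame_const 1).gradMul hG).add ((tame_const 1).mul (hG.generator hR ht))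
  have t4 : Tame fun y => gradMul (drift π t w) w y + drift π t w y * generator π t w y :=
    (hd.gradMul hw).add (hd.mul hL)
  have z1 := integral_gradMul_add hR ht hw.lap hw
  have z2 := integral_gradMul_add hR ht hψt hw
  have z3 := integral_gradMul_add hR ht (tame_const 1) hG
  have z4 := integral_gradMul_add hR ht hd hw
  have i1 := t1.integrable_heatFlow hR t
  have i2 := (t2.integrable_heatFlow hR t).const_mul 4
  have i3 := (t3.integrable_heatFlow hR t).const_mul 2⁻¹
  have i4 := t4.integrable_heatFlow hR t
  have i5 := (hL.sq.sub (hw.logHessian hR ht)).integrable_heatFlow hR t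
  -- The correction terms have zero integral by symmetry of the generator, for the pairs (Δw, w),
  -- (ψ, w), (1, ‖∇w‖²) and (drift of w, w). Besides product rules, only `drift_gradMul` is used.
  have key : ∀ y, w y * lap (lap w) y / 2 + 2 * (w y * lap ψ y) -
      lap (lap fun y => w y * w y) y / 4 - 2 * lap (fun y => w y * ψ y) y - 2 * (ψ y * ψ y) =
      (generator π t w y ^ 2 - logHessian π t w y)
      - (gradMul (lap w) w y + lap w y * generator π t w y)
      - 4 * (gradMul ψ w y + ψ y * generator π t w y)
      - 2⁻¹ * (gradMul (fun _ => 1) (gradMul w w) y + 1 * generator π t (gradMul w w) y)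
      + (gradMul (drift π t w) w y + drift π t w y * generator π t w y) := by
    intro y
    have e1 : gradMul (fun _ => 1) (gradMul w w) y = 0 := by
      refine Finset.sum_eq_zero fun i _ => ?_
      rw [partialDeriv, dirDeriv_const, zero_mul]
    have e2 : (lap fun y => w y * w y) =
        fun y => 2 * (w y * lap w y) + 2 * gradMul w w y := by
      rw [lap_mul hw hw]; ext y; ring
    rw [e1, e2, lap_mul hw hψt, lap_add ((hw.mul hw.lap).const_mul 2) (hG.const_mul 2),
      lap_const_mul (hw.mul hw.lap), lap_const_mul hG, lap_mul hw hw.lap]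
    have e3 := drift_gradMul hR ht hw y
    have e4 : ψ y = generator π t w y - 2⁻¹ * lap w y := by rw [hψ]
    have e5 : generator π t w y = lap w y + drift π t w y := rfl
    have e6 : generator π t (gradMul w w) y = lap (gradMul w w) y + drift π t (gradMul w w) y := rfl
    dsimp only
    rw [gradMul_comm w ψ, gradMul_comm w (lap w), e6, e4, e5]
    linear_combination e3
  simp_rw [key]
  have j1 : Integrable (fun y => (generator π t w y ^ 2 - logHessian π t w y)
      - (gradMul (lap w) w y + lap w y * generator π t w y)) (heatFlow π t) := i5.sub i1
  have j2 : Integrable (fun y => (generator π t w y ^ 2 - logHessian π t w y)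
      - (gradMul (lap w) w y + lap w y * generator π t w y)
      - 4 * (gradMul ψ w y + ψ y * generator π t w y)) (heatFlow π t) := j1.sub i2
  have j3 : Integrable (fun y => (generator π t w y ^ 2 - logHessian π t w y)
      - (gradMul (lap w) w y + lap w y * generator π t w y)
      - 4 * (gradMul ψ w y + ψ y * generator π t w y)
      - 2⁻¹ * (gradMul (fun _ => 1) (gradMul w w) y + 1 * generator π t (gradMul w w) y))
      (heatFlow π t) := j2.sub i3
  rw [integral_add j3 i4, integral_sub j2 i3, integral_sub j1 i2, integral_sub i5 i1,
    integral_const_mul, integral_const_mul, z1, z2, z3, z4]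
  ring

end Curvature

end

/-! ### The second-order lower bound for the squared norm -/

section

/-- A one-sided Taylor estimate of second order. -/
lemma eventually_taylor_two_le {F F₁ : ℝ → ℝ} {c : ℝ}
    (hF : ∀ᶠ h in 𝓝 (0 : ℝ), HasDerivAt F (F₁ h) h) (hF₁ : HasDerivAt F₁ c 0) {ε : ℝ}
    (hε : 0 < ε) : ∀ᶠ h in 𝓝[>] (0 : ℝ), F 0 + F₁ 0 * h + (c - ε) * h ^ 2 / 2 ≤ F h := by
  have h1 := (hasDerivAt_iff_isLittleO.1 hF₁).def hε
  obtain ⟨δ, hδ, hb⟩ := Metric.eventually_nhds_iff.1 (hF.and h1)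
  filter_upwards [Ioo_mem_nhdsGT hδ] with h hh
  -- F minus the claimed quadratic has nonnegative derivative near zero, hence is monotone there.
  have hd : ∀ x ∈ Icc 0 h, HasDerivAt (fun x => F x - F₁ 0 * x - (c - ε) * x ^ 2 / 2)
      (F₁ x - F₁ 0 - (c - ε) * x) x := by
    intro x hx
    have hx' : dist x 0 < δ := by
      rw [Real.dist_eq, sub_zero, abs_of_nonneg hx.1]; exact hx.2.trans_lt hh.2
    have e1 := ((hb hx').1.sub ((hasDerivAt_id x).const_mul (F₁ 0))).sub
      (((hasDerivAt_pow 2 x).const_mul (c - ε)).div_const 2)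
    refine e1.congr_deriv ?_
    simp
    ring
  have hm := monotoneOn_of_deriv_nonneg (convex_Icc 0 h)
    (fun x hx => (hd x hx).continuousAt.continuousWithinAt)
    (fun x hx => (hd x (interior_subset hx)).differentiableAt.differentiableWithinAt)
    (fun x hx => by
      have hx' := interior_subset hx
      rw [(hd x hx').deriv]
      have e1 := (hb (y := x) (by
        rw [Real.dist_eq, sub_zero, abs_of_nonneg hx'.1]; exact hx'.2.trans_lt hh.2)).2
      simp only [sub_zero, smul_eq_mul, Real.norm_eq_abs, abs_of_nonneg hx'.1] at e1
      have := neg_abs_le (F₁ x - F₁ 0 - x * c)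
      nlinarith)
  have e2 := hm (left_mem_Icc.2 hh.1.le) (right_mem_Icc.2 hh.1.le) hh.1.le
  simp only at e2
  linarith

section SecondOrder

variable {n : ℕ} {π : Measure (EuclideanSpace ℝ (Fin n))} {R : ℝ}

lemma heatAdjoint_one [IsProbabilityMeasure π] {t : ℝ} (ht : 0 ≤ t)
    (y : EuclideanSpace ℝ (Fin n)) : heatAdjoint π t (fun _ => 1) y = 1 := by
  rcases ht.eq_or_lt with rfl | ht
  · rw [heatAdjoint_zero]
  · rw [heatAdjoint_of_pos _ ht, heatNum_one, div_self (heatMass_pos ht y).ne']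

lemma sq_integral_mul_le {α : Type*} {_ : MeasurableSpace α} {μ : Measure α} {f g : α → ℝ}
    (hf : MemLp f 2 μ) (hg : MemLp g 2 μ) :
    (∫ x, f x * g x ∂μ) ^ 2 ≤ (∫ x, f x ^ 2 ∂μ) * ∫ x, g x ^ 2 ∂μ := by
  have hfg : Integrable (fun x => f x * g x) μ := hf.integrable_mul hg
  have h := discrim_le_zero (a := ∫ x, g x ^ 2 ∂μ) (b := 2 * ∫ x, f x * g x ∂μ)
    (c := ∫ x, f x ^ 2 ∂μ) fun s => ?_
  · rw [discrim] at h
    nlinarith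
  · have e : ∫ x, (f x + s * g x) ^ 2 ∂μ = (∫ x, g x ^ 2 ∂μ) * (s * s) +
        2 * (∫ x, f x * g x ∂μ) * s + ∫ x, f x ^ 2 ∂μ := by
      have e1 : ∀ x, (f x + s * g x) ^ 2 = s * s * g x ^ 2 + 2 * s * (f x * g x) + f x ^ 2 :=
        fun x => by ring
      have i1 : Integrable (fun x => s * s * g x ^ 2 + 2 * s * (f x * g x)) μ :=
        (hg.integrable_sq.const_mul _).add (hfg.const_mul _)
      simp_rw [e1]
      rw [integral_add i1 hf.integrable_sq,
        integral_add (hg.integrable_sq.const_mul _) (hfg.const_mul _), integral_const_mul,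
        integral_const_mul]
      ring
    rw [← e]
    exact integral_nonneg fun x => by positivity

/-- The second order lower bound for the squared norm along the heat flow. -/
lemma exists_second_order_bound (hπ : IsLogConcave π) [IsProbabilityMeasure π]
    (hR : ∀ᵐ x ∂π, ‖x‖ ≤ R) {f : EuclideanSpace ℝ (Fin n) → ℝ} (hf : MemLp f ⊤ π) {t : ℝ}
    (ht : 0 < t) :
    ∃ S, 0 ≤ S ∧ adjointEnergy π f t ^ 2 ≤ adjointNormSq π f t * S ∧ ∀ ε > 0, ∀ᶠ h in 𝓝[>] (0 : ℝ),
      adjointNormSq π f t - h * adjointEnergy π f t + (S - ε) * h ^ 2 / 2 ≤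
        adjointNormSq π f (t + h) := by
  set w := heatAdjoint π t f with hwdef
  have hw : Tame w := tame_heatAdjoint hR ht hf
  -- This is Δw/2 plus the drift of w, the time derivative suggested by the heat equations for
  -- numerator and denominator. Thus w + hψ predicts f_{t+h} to first order.
  set ψ : EuclideanSpace ℝ (Fin n) → ℝ := fun y => generator π t w y - 2⁻¹ * lap w y with hψdef
  have hL := hw.generator hR ht
  have hψ : Tame ψ := hL.sub (hw.lap.const_mul _)
  have h1 : MemLp (fun _ : EuclideanSpace ℝ (Fin n) => (1 : ℝ)) ⊤ π := memLp_top_const 1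
  have hww := hw.mul hw
  have hwψ := hw.mul hψ
  have hψψ := hψ.mul hψ
  have hE : adjointEnergy π f t = ∫ y, gradMul w w y ∂(heatFlow π t) := by
    rw [adjointEnergy, gradEnergy_heatAdjoint hπ ht (hf.mono_exponent le_top)]
    refine integral_congr_ae (ae_of_all _ fun y => ?_)
    dsimp only
    rw [norm_gradient_sq_eq_sum]
    exact Finset.sum_congr rfl fun i _ => sq _
  have hN : adjointNormSq π f t = ∫ y, w y ^ 2 ∂(heatFlow π t) := rfl
  have hEL : adjointEnergy π f t = - ∫ y, w y * generator π t w y ∂(heatFlow π t) := by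
    have e := integral_gradMul_add hR ht hw hw
    rw [integral_add ((hw.gradMul hw).integrable_heatFlow hR t)
      ((hw.mul hL).integrable_heatFlow hR t)] at e
    linarith
  -- evaluation of the pairings
  have hJ : ∀ {P}, flowPair π f P t = ∫ y, w y * P y ∂(heatFlow π t) := rfl
  have hK : ∀ {P} {τ : ℝ}, 0 ≤ τ → flowPair π (fun _ => 1) P τ = ∫ y, P y ∂(heatFlow π τ) := by
    intro P τ hτ
    simp only [flowPair, heatAdjoint_one hτ, one_mul]
  -- F h is 2⟨f_{t+h}, g⟩ − ‖g‖² in L²(π_{t+h}) with g = w + hψ, hence at most ‖f_{t+h}‖². Pairings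
  -- with the constant one are integrals against the flow, so the weak heat equation differentiates
  -- every term.
  set F : ℝ → ℝ := fun h => 2 * flowPair π f w (t + h) + 2 * (h * flowPair π f ψ (t + h))
    - flowPair π (fun _ => 1) (fun y => w y * w y) (t + h)
    - 2 * (h * flowPair π (fun _ => 1) (fun y => w y * ψ y) (t + h))
    - h ^ 2 * flowPair π (fun _ => 1) (fun y => ψ y * ψ y) (t + h) with hF
  set F₁ : ℝ → ℝ := fun h => flowPair π f (lap w) (t + h) + 2 * flowPair π f ψ (t + h)
    + h * flowPair π f (lap ψ) (t + h)
    - flowPair π (fun _ => 1) (lap fun y => w y * w y) (t + h) / 2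
    - 2 * flowPair π (fun _ => 1) (fun y => w y * ψ y) (t + h)
    - h * flowPair π (fun _ => 1) (lap fun y => w y * ψ y) (t + h)
    - 2 * (h * flowPair π (fun _ => 1) (fun y => ψ y * ψ y) (t + h))
    - h ^ 2 * (flowPair π (fun _ => 1) (lap fun y => ψ y * ψ y) (t + h) / 2) with hF₁
  have hd : ∀ {a P : EuclideanSpace ℝ (Fin n) → ℝ}, MemLp a ⊤ π → Tame P → ∀ {h : ℝ}, 0 < t + h →
      HasDerivAt (fun h => flowPair π a P (t + h)) (flowPair π a (lap P) (t + h) / 2) h :=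
    fun ha hP h hh => (hasDerivAt_flowPair hR ha hP hh).comp_const_add t h
  have hFd : ∀ᶠ h in 𝓝 (0 : ℝ), HasDerivAt F (F₁ h) h := by
    filter_upwards [lt_mem_nhds (show -t < 0 by linarith)] with h hh
    have hth : 0 < t + h := by linarith
    have e1 := ((((hd hf hw hth).const_mul 2).add
      (((hasDerivAt_id h).mul (hd hf hψ hth)).const_mul 2)).sub (hd h1 hww hth)).sub
      (((hasDerivAt_id h).mul (hd h1 hwψ hth)).const_mul 2)
    have e2 := e1.sub ((hasDerivAt_pow 2 h).mul (hd h1 hψψ hth))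
    refine e2.congr_deriv ?_
    simp only [id, F₁]
    push_cast
    ring
  have ht0 : 0 < t + 0 := by simpa using ht
  set S := ∫ y, generator π t w y ^ 2 ∂(heatFlow π t) with hS
  set c := ∫ y, (generator π t w y ^ 2 - logHessian π t w y) ∂(heatFlow π t) with hc
  -- Logconcavity of π_t enters here: the Hessian term has a favourable sign and is dropped.
  have hSc : S ≤ c := by
    refine integral_mono (hL.sq.integrable_heatFlow hR t)
      ((hL.sq.sub (hw.logHessian hR ht)).integrable_heatFlow hR t) fun y => ?_
    dsimp only
    linarith [logHessian_nonpos hπ hR ht w y]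
  have hF₁d : HasDerivAt F₁ c 0 := by
    have e1 := ((((((hd hf hw.lap ht0).add ((hd hf hψ ht0).const_mul 2)).add
      ((hasDerivAt_id 0).mul (hd hf hψ.lap ht0))).sub ((hd h1 hww.lap ht0).div_const 2)).sub
      ((hd h1 hwψ ht0).const_mul 2)).sub ((hasDerivAt_id 0).mul (hd h1 hwψ.lap ht0))).sub
      (((hasDerivAt_id 0).mul (hd h1 hψψ ht0)).const_mul 2)
    have e2 := e1.sub ((hasDerivAt_pow 2 (0 : ℝ)).mul ((hd h1 hψψ.lap ht0).div_const 2))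
    refine e2.congr_deriv ?_
    have i1 := (hw.mul hw.lap.lap).integrable_heatFlow hR t
    have i2 := (hw.mul hψ.lap).integrable_heatFlow hR t
    have i3 := hww.lap.lap.integrable_heatFlow hR t
    have i4 := hwψ.lap.integrable_heatFlow hR t
    have i5 := hψψ.integrable_heatFlow hR t
    have j2 : Integrable (fun y => w y * lap (lap w) y / 2 + 2 * (w y * lap ψ y)) (heatFlow π t) :=
      (i1.div_const 2).add (i2.const_mul 2)
    have j3 : Integrable (fun y => w y * lap (lap w) y / 2 + 2 * (w y * lap ψ y) -
        lap (lap fun y => w y * w y) y / 4) (heatFlow π t) := j2.sub (i3.div_const 4)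
    have j4 : Integrable (fun y => w y * lap (lap w) y / 2 + 2 * (w y * lap ψ y) -
        lap (lap fun y => w y * w y) y / 4 - 2 * lap (fun y => w y * ψ y) y) (heatFlow π t) :=
      j3.sub (i4.const_mul 2)
    rw [hc, ← integral_second_variation hR ht hw hψdef, integral_sub j4 (i5.const_mul 2),
      integral_sub j3 (i4.const_mul 2), integral_sub j2 (i3.div_const 4),
      integral_add (i1.div_const 2) (i2.const_mul 2)]
    simp only [integral_const_mul, integral_div, id, add_zero, hJ, hK ht.le]
    simp
    ring
  have hF0 : F 0 = adjointNormSq π f t := by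
    simp only [hF, add_zero, hJ, hK ht.le, hN, ← sq]
    ring
  have hF₁0 : F₁ 0 = - adjointEnergy π f t := by
    have e1 : ∫ y, lap (fun y => w y * w y) y ∂(heatFlow π t) =
        2 * ∫ y, w y * lap w y ∂(heatFlow π t) + 2 * adjointEnergy π f t := by
      rw [hE, ← integral_const_mul, ← integral_const_mul,
        ← integral_add (((hw.mul hw.lap).integrable_heatFlow hR t).const_mul 2)
          (((hw.gradMul hw).integrable_heatFlow hR t).const_mul 2)]
      refine integral_congr_ae (ae_of_all _ fun y => ?_)
      dsimp only
      rw [lap_mul hw hw]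
      ring
    simp only [hF₁, add_zero, hJ, hK ht.le, e1]
    ring
  refine ⟨S, integral_nonneg fun y => sq_nonneg _, ?_, fun ε hε => ?_⟩
  · rw [hEL, neg_sq, hN]
    exact sq_integral_mul_le (hw.memLp_heatFlow hR t) (hL.memLp_heatFlow hR t)
  · filter_upwards [eventually_taylor_two_le hFd hF₁d hε, self_mem_nhdsWithin] with h hh hpos
    have hpos' : 0 < t + h := add_pos ht hpos
    have hle : F h ≤ adjointNormSq π f (t + h) := by
      have hφ : Tame (heatAdjoint π (t + h) f) := tame_heatAdjoint hR hpos' hf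
      have hg : Tame fun y => w y + h * ψ y := hw.add (hψ.const_mul h)
      have e1 : F h = ∫ y, (2 * (heatAdjoint π (t + h) f y * w y) +
          2 * (h * (heatAdjoint π (t + h) f y * ψ y)) - w y * w y - 2 * (h * (w y * ψ y)) -
          h ^ 2 * (ψ y * ψ y)) ∂(heatFlow π (t + h)) := by
        have i1 := ((hφ.mul hw).integrable_heatFlow hR (t + h)).const_mul 2
        have i2 := (((hφ.mul hψ).integrable_heatFlow hR (t + h)).const_mul h).const_mul 2
        have i3 := hww.integrable_heatFlow hR (t + h)
        have i4 := ((hwψ.integrable_heatFlow hR (t + h)).const_mul h).const_mul 2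
        have i5 := (hψψ.integrable_heatFlow hR (t + h)).const_mul (h ^ 2)
        have j2 : Integrable (fun y => 2 * (heatAdjoint π (t + h) f y * w y) +
          2 * (h * (heatAdjoint π (t + h) f y * ψ y))) (heatFlow π (t + h)) := i1.add i2
        have j3 : Integrable (fun y => 2 * (heatAdjoint π (t + h) f y * w y) +
          2 * (h * (heatAdjoint π (t + h) f y * ψ y)) - w y * w y) (heatFlow π (t + h)) := j2.sub i3
        have j4 : Integrable (fun y => 2 * (heatAdjoint π (t + h) f y * w y) +
          2 * (h * (heatAdjoint π (t + h) f y * ψ y)) - w y * w y - 2 * (h * (w y * ψ y)))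
          (heatFlow π (t + h)) := j3.sub i4
        rw [integral_sub j4 i5, integral_sub j3 i4, integral_sub j2 i3, integral_add i1 i2]
        simp only [integral_const_mul, hF, hK hpos'.le]
        rfl
      rw [e1]
      refine integral_mono ?_ (hφ.sq.integrable_heatFlow hR _) fun y => ?_
      · have := (((((hφ.mul hw).const_mul 2).add (((hφ.mul hψ).const_mul h).const_mul 2)).sub hww).sub
          ((hwψ.const_mul h).const_mul 2)).sub (hψψ.const_mul (h ^ 2))
        exact this.integrable_heatFlow hR _
      · dsimp only
        nlinarith [sq_nonneg (heatAdjoint π (t + h) f y - (w y + h * ψ y))]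
    rw [hF0, hF₁0] at hh
    nlinarith [sq_nonneg h]

end SecondOrder

end

/-! ### From one-sided Taylor bounds to log-convexity -/

section

/-- Two-sided difference bounds imply continuity. -/
lemma continuousOn_of_difference_bounds {M E : ℝ → ℝ} (hE : ∀ t, 0 < t → 0 ≤ E t)
    (h1 : ∀ t h, 0 < t → 0 < h → h * E (t + h) ≤ M t - M (t + h))
    (h2 : ∀ t h, 0 < t → 0 < h → M t - M (t + h) ≤ h * E t) : ContinuousOn M (Ioi 0) := by
  intro t ht
  have ht' : (0 : ℝ) < t := ht
  refine ContinuousAt.continuousWithinAt ?_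
  -- Both bounds together make E nonincreasing, so E(t/2) is a Lipschitz constant for M on (t/2, ∞).
  have hE2 : ∀ s, t / 2 < s → E s ≤ E (t / 2) := by
    intro s hs
    have e1 := h1 (t / 2) (s - t / 2) (by linarith) (by linarith)
    have e2 := h2 (t / 2) (s - t / 2) (by linarith) (by linarith)
    rw [add_sub_cancel] at e1 e2
    exact le_of_mul_le_mul_left (e1.trans e2) (by linarith)
  have hlt : ∀ s s', t / 2 < s → s < s' → |M s - M s'| ≤ E (t / 2) * (s' - s) := by
    intro s s' hs hss
    have e1 := h1 s (s' - s) (by linarith) (by linarith)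
    have e2 := h2 s (s' - s) (by linarith) (by linarith)
    rw [add_sub_cancel] at e1 e2
    have e3 := hE s' (by linarith)
    have e4 := hE2 s hs
    rw [abs_le]
    constructor <;> nlinarith
  have hL : LipschitzOnWith (E (t / 2)).toNNReal M (Ioi (t / 2)) := by
    refine LipschitzOnWith.of_dist_le_mul fun s hs s' hs' => ?_
    rw [Real.dist_eq, Real.dist_eq, Real.coe_toNNReal _ (hE _ (by linarith))]
    rcases lt_trichotomy s s' with h | h | h
    · rw [abs_sub_comm s s', abs_of_pos (sub_pos.2 h)]
      exact hlt s s' hs h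
    · simp [h]
    · rw [abs_sub_comm (M s), abs_of_pos (sub_pos.2 h)]
      exact hlt s' s hs' h
  exact hL.continuousOn.continuousAt (Ioi_mem_nhds (by linarith))

set_option maxHeartbeats 1000000 in
/-- A positive function with second order lower Taylor bounds is log-convex. -/
lemma convexOn_log_of_second_order {M E : ℝ → ℝ} (hM : ∀ t, 0 < t → 0 < M t)
    (hE : ∀ t, 0 < t → 0 ≤ E t)
    (h1 : ∀ t h, 0 < t → 0 < h → h * E (t + h) ≤ M t - M (t + h))
    (h2 : ∀ t h, 0 < t → 0 < h → M t - M (t + h) ≤ h * E t)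
    (h3 : ∀ t, 0 < t → ∃ S, E t ^ 2 ≤ M t * S ∧ ∀ ε > 0, ∀ᶠ h in 𝓝[>] (0 : ℝ),
      M t - h * E t + (S - ε) * h ^ 2 / 2 ≤ M (t + h)) :
    ConvexOn ℝ (Ioi 0) fun t => Real.log (M t) := by
  have hcont := continuousOn_of_difference_bounds hE h1 h2
  refine convexOn_of_slope_mono_adjacent (convex_Ioi 0) ?_
  intro x y z hx hz hxy hyz
  have hx' : (0 : ℝ) < x := hx
  set φ : ℝ → ℝ := fun t => Real.log (M t) with hφ
  set k := (φ z - φ x) / (z - x) with hk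
  have hzx : 0 < z - x := by linarith
  have hkz : k * (z - x) = φ z - φ x := by rw [hk]; field_simp
  suffices hy : φ y ≤ φ x + k * (y - x) by
    have e1 : (φ y - φ x) / (y - x) ≤ k := by
      rw [div_le_iff₀ (by linarith)]; linarith
    have e2 : k ≤ (φ z - φ y) / (z - y) := by
      rw [le_div_iff₀ (by linarith)]; linarith
    exact e1.trans e2
  refine le_of_forall_pos_le_add fun η hη => ?_
  set ε := η / ((y - x) * (z - y)) with hε
  have hyy : 0 < (y - x) * (z - y) := mul_pos (by linarith) (by linarith)
  have hεp : 0 < ε := by positivity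
  -- Maximum principle: g is log M minus its chord, lowered by ε(t − x)(z − t). If g were positive
  -- somewhere it would have an interior maximum, although the perturbation adds 2ε to its second
  -- derivative.
  set g : ℝ → ℝ := fun t => φ t - φ x - k * (t - x) + ε * ((t - x) * (t - z)) with hg
  suffices hgy : g y ≤ 0 by
    have e1 : ε * ((y - x) * (z - y)) = η := by rw [hε]; field_simp
    have e2 : ε * ((y - x) * (y - z)) = -η := by rw [← e1]; ring
    simp only [hg, e2] at hgy
    linarith
  have hsub : Icc x z ⊆ Ioi 0 := fun t ht => hx'.trans_le ht.1
  have hgc : ContinuousOn g (Icc x z) := by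
    have hφc : ContinuousOn φ (Icc x z) :=
      (hcont.mono hsub).log fun t ht => (hM t (hsub ht)).ne'
    fun_prop
  obtain ⟨t, ht, hmax⟩ := isCompact_Icc.exists_isMaxOn (nonempty_Icc.2 (by linarith : x ≤ z)) hgc
  have hgx : g x = 0 := by simp [hg]
  have hgz : g z = 0 := by simp only [hg, sub_self, mul_zero, hkz]; ring
  have hyt : g y ≤ g t := hmax ⟨hxy.le, hyz.le⟩
  rcases ht.1.eq_or_lt with rfl | hxt
  · linarith
  rcases ht.2.eq_or_lt with rfl | htz
  · linarith
  exfalso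
  have ht0 : 0 < t := hsub ht
  have hMt := hM t ht0
  set β := -k + ε * (2 * t - x - z) with hβ
  have hgd : ∀ h, g (t + h) - g t = φ (t + h) - φ t + β * h + ε * h ^ 2 := by
    intro h
    simp only [hg, hβ]
    ring
  -- the backward bound gives the slope at the maximum
  have hslope : E t / M t ≤ β := by
    have hlim : Tendsto (fun h => E t / (M t + h * E t)) (𝓝[>] 0) (𝓝 (E t / M t)) := by
      have : ContinuousAt (fun h => E t / (M t + h * E t)) 0 := by
        refine ContinuousAt.div (by fun_prop) (by fun_prop) (by simpa using hMt.ne')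
      have h0 := this.tendsto.mono_left (nhdsWithin_le_nhds (s := Ioi 0))
      simpa using h0
    refine le_of_tendsto hlim ?_
    filter_upwards [Ioo_mem_nhdsGT (show 0 < t - x by linarith)] with h hh
    have hth : 0 < t - h := by linarith [hh.2]
    have e1 := h1 (t - h) h hth hh.1
    rw [sub_add_cancel] at e1
    have e2 : g (t - h) ≤ g t := hmax ⟨by linarith [hh.2], by linarith [hh.1]⟩
    have e3 := hgd (-h)
    rw [← sub_eq_add_neg] at e3
    have hpos : 0 < M t + h * E t := by have := hE t ht0; have := hh.1; positivity
    have e4 : Real.log (M t + h * E t) ≤ φ (t - h) := Real.log_le_log hpos (by linarith)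
    have e5 := Real.one_sub_inv_le_log_of_pos (div_pos hpos hMt)
    rw [Real.log_div hpos.ne' hMt.ne', inv_div] at e5
    have e6 : 1 - M t / (M t + h * E t) = h * (E t / (M t + h * E t)) := by
      field_simp; ring
    rw [e6] at e5
    have e7 : h * (E t / (M t + h * E t)) ≤ h * β := by
      have e8 : φ t = Real.log (M t) := rfl
      have e9 : 0 ≤ ε * h ^ 2 := by positivity
      nlinarith
    exact le_of_mul_le_mul_left e7 hh.1
  -- the forward bound contradicts maximality
  obtain ⟨S, hS, hS'⟩ := h3 t ht0
  -- A slack ε M(t) in the Taylor coefficient costs ε in the second derivative of log M, and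
  -- expanding the logarithm costs ε/2. The total stays below the 2ε gained from the perturbation.
  set c := S - ε * M t with hc
  set F : ℝ → ℝ := fun h => M t - h * E t + c * h ^ 2 / 2 with hF
  have hFd : ∀ h, HasDerivAt F (-E t + c * h) h := by
    intro h
    have e := (((hasDerivAt_id h).mul_const (E t)).const_sub (M t)).add
      (((hasDerivAt_pow 2 h).const_mul c).div_const 2)
    refine e.congr_deriv ?_
    simp
    ring
  have hF0 : F 0 = M t := by simp [hF]
  have hFpos : ∀ᶠ h in 𝓝 (0 : ℝ), 0 < F h :=
    (hFd 0).continuousAt.eventually (lt_mem_nhds (by rw [hF0]; exact hMt))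
  have hlog : ∀ᶠ h in 𝓝 (0 : ℝ), HasDerivAt (fun h => Real.log (F h)) ((-E t + c * h) / F h) h := by
    filter_upwards [hFpos] with h hh
    exact (hFd h).log hh.ne'
  have hlog2 : HasDerivAt (fun h => (-E t + c * h) / F h) (c / M t - E t ^ 2 / M t ^ 2) 0 := by
    have e1 : HasDerivAt (fun h => -E t + c * h) c 0 := by
      simpa using ((hasDerivAt_id (0 : ℝ)).const_mul c).const_add (-E t)
    refine (e1.div (hFd 0) (by rw [hF0]; exact hMt.ne')).congr_deriv ?_
    rw [hF0]
    field_simp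
    ring
  have hev := eventually_taylor_two_le hlog hlog2 (half_pos hεp)
  obtain ⟨h, ⟨hh1, hh2, hh3⟩, hhpos, hhz⟩ := ((hev.and ((hS' _ (mul_pos hεp hMt)).and
    (hFpos.filter_mono nhdsWithin_le_nhds))).and
      (Ioo_mem_nhdsGT (show 0 < z - t by linarith))).exists
  have e1 : g (t + h) ≤ g t := hmax ⟨by linarith, by linarith⟩
  have e2 : Real.log (F h) ≤ φ (t + h) := Real.log_le_log hh3 hh2
  rw [hF0] at hh1
  have e3 := hgd h
  have e4 : -ε ≤ c / M t - E t ^ 2 / M t ^ 2 := by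
    rw [hc, div_sub_div _ _ hMt.ne' (by positivity), le_div_iff₀ (by positivity)]
    nlinarith [mul_nonneg hMt.le (sub_nonneg.2 hS)]
  have e5 : E t / M t * h ≤ β * h := mul_le_mul_of_nonneg_right hslope hhpos.le
  have e6 : (-E t + c * 0) / M t * h = -(E t / M t * h) := by ring
  have e7 : φ t = Real.log (M t) := rfl
  rw [e6] at hh1
  have e8 : 0 < ε * h ^ 2 := by positivity
  nlinarith [mul_le_mul_of_nonneg_right e4 (sq_nonneg h)]

end

/-! ### Removing the boundedness assumptions -/

section

section Approximation

variable {n : ℕ} {π : Measure (EuclideanSpace ℝ (Fin n))} {R : ℝ}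

/-- Log-convexity of the squared norm for bounded functions and boundedly supported measures. -/
lemma adjointNormSq_le_rpow_mul_of_bounded (hπ : IsLogConcave π) [IsProbabilityMeasure π]
    (hR : ∀ᵐ x ∂π, ‖x‖ ≤ R) {f : EuclideanSpace ℝ (Fin n) → ℝ} (hf : MemLp f ⊤ π)
    {x z a b : ℝ} (hx : 0 < x) (hz : 0 < z) (ha : 0 < a) (hb : 0 < b) (hab : a + b = 1) :
    adjointNormSq π f (a * x + b * z) ≤ adjointNormSq π f x ^ a * adjointNormSq π f z ^ b := by
  have hf2 : MemLp f 2 π := hf.mono_exponent le_top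
  -- Positivity of the norm is not yet known; adding δ makes the logarithm meaningful. Differences
  -- do not change, and E² ≤ N S survives because S ≥ 0.
  have key : ∀ δ : ℝ, 0 < δ → adjointNormSq π f (a * x + b * z) + δ ≤
      (adjointNormSq π f x + δ) ^ a * (adjointNormSq π f z + δ) ^ b := by
    intro δ hδ
    have hpos : ∀ t, 0 < adjointNormSq π f t + δ := fun t =>
      add_pos_of_nonneg_of_pos (adjointNormSq_nonneg f t) hδ
    have hcv := convexOn_log_of_second_order (M := fun t => adjointNormSq π f t + δ)
      (E := adjointEnergy π f) (fun t _ => hpos t) (fun t _ => gradEnergy_nonneg _ _)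
      (fun t h ht hh => by simpa using mul_adjointEnergy_le hπ ht.le hh hf2)
      (fun t h ht hh => by
        simpa using adjointNormSq_sub_le hπ ht.le hh hf2 (memH1_heatAdjoint_of_pos hπ ht hf2))
      (fun t ht => by
        obtain ⟨S, hS0, hS, hS'⟩ := exists_second_order_bound hπ hR hf ht
        refine ⟨S, by nlinarith, fun ε hε => ?_⟩
        filter_upwards [hS' ε hε] with h hh
        linarith)
    have h := hcv.2 (show x ∈ Ioi (0 : ℝ) from hx) (show z ∈ Ioi (0 : ℝ) from hz) ha.le hb.le hab
    simp only [smul_eq_mul] at h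
    rw [← Real.log_le_log_iff (hpos _) (mul_pos (Real.rpow_pos_of_pos (hpos _) _)
      (Real.rpow_pos_of_pos (hpos _) _)), Real.log_mul (Real.rpow_pos_of_pos (hpos _) _).ne'
      (Real.rpow_pos_of_pos (hpos _) _).ne', Real.log_rpow (hpos _), Real.log_rpow (hpos _)]
    exact h
  have h1 : Tendsto (fun δ : ℝ => adjointNormSq π f (a * x + b * z) + δ) (𝓝[>] 0)
      (𝓝 (adjointNormSq π f (a * x + b * z) + 0)) :=
    (Continuous.tendsto (by fun_prop) 0).mono_left nhdsWithin_le_nhds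
  have h2 : Tendsto (fun δ : ℝ => (adjointNormSq π f x + δ) ^ a * (adjointNormSq π f z + δ) ^ b)
      (𝓝[>] 0) (𝓝 ((adjointNormSq π f x + 0) ^ a * (adjointNormSq π f z + 0) ^ b)) := by
    refine (Continuous.tendsto ?_ 0).mono_left nhdsWithin_le_nhds
    exact ((continuous_const.add continuous_id).rpow_const fun _ => Or.inr ha.le).mul
      ((continuous_const.add continuous_id).rpow_const fun _ => Or.inr hb.le)
  have h3 := le_of_tendsto_of_tendsto h1 h2 (by
    filter_upwards [self_mem_nhdsWithin] with δ hδ using key δ hδ)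
  simpa using h3

/-- Conditioning on a convex set preserves logconcavity. -/
lemma IsLogConcave.cond (hπ : IsLogConcave π) [IsProbabilityMeasure π]
    {A : Set (EuclideanSpace ℝ (Fin n))} (hA : Convex ℝ A) (hAm : MeasurableSet A)
    (h0 : π A ≠ 0) : IsLogConcave (ProbabilityTheory.cond π A) := by
  obtain ⟨ρ, hρm, hρ, hπρ⟩ := hπ
  set c : ℝ := ((π A)⁻¹).toReal with hc
  have hctop : (π A)⁻¹ ≠ ⊤ := ENNReal.inv_ne_top.2 h0
  have hc0 : 0 < c := ENNReal.toReal_pos (ENNReal.inv_ne_zero.2 (measure_ne_top π A)) hctop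
  refine ⟨A.indicator fun x => c * ρ x, (hρm.const_mul c).indicator hAm, ⟨fun x =>
    indicator_nonneg (fun x _ => mul_nonneg hc0.le (hρ.1 x)) x, ?_⟩, ?_⟩
  · intro x y a b ha hb hab
    by_cases hx : x ∈ A
    · by_cases hy : y ∈ A
      · rw [indicator_of_mem hx, indicator_of_mem hy,
          indicator_of_mem (hA hx hy ha.le hb.le hab), Real.mul_rpow hc0.le (hρ.1 x),
          Real.mul_rpow hc0.le (hρ.1 y), mul_mul_mul_comm, ← Real.rpow_add hc0, hab, Real.rpow_one]
        exact mul_le_mul_of_nonneg_left (hρ.2 x y a b ha hb hab) hc0.le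
      · rw [indicator_of_notMem hy, Real.zero_rpow hb.ne', mul_zero]
        exact indicator_nonneg (fun x _ => mul_nonneg hc0.le (hρ.1 x)) _
    · rw [indicator_of_notMem hx, Real.zero_rpow ha.ne', zero_mul]
      exact indicator_nonneg (fun x _ => mul_nonneg hc0.le (hρ.1 x)) _
  · have e1 : (fun x => ENNReal.ofReal (A.indicator (fun x => c * ρ x) x)) =
        (π A)⁻¹ • A.indicator fun x => ENNReal.ofReal (ρ x) := by
      ext x
      by_cases hx : x ∈ A
      · simp only [indicator_of_mem hx, Pi.smul_apply, smul_eq_mul]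
        rw [ENNReal.ofReal_mul hc0.le, hc, ENNReal.ofReal_toReal hctop]
      · simp [indicator_of_notMem hx]
    rw [e1, withDensity_smul _ (hρm.ennreal_ofReal.indicator hAm), withDensity_indicator hAm,
      ProbabilityTheory.cond, ← restrict_withDensity hAm, ← hπρ]

lemma heatNum_cond {A : Set (EuclideanSpace ℝ (Fin n))} (hAm : MeasurableSet A) (t : ℝ)
    (g : EuclideanSpace ℝ (Fin n) → ℝ) (y : EuclideanSpace ℝ (Fin n)) :
    heatNum (ProbabilityTheory.cond π A) t g y = (π.real A)⁻¹ * heatNum π t (A.indicator g) y := by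
  rw [heatNum, ProbabilityTheory.cond, integral_smul_measure, ENNReal.toReal_inv, smul_eq_mul,
    ← integral_indicator hAm, heatNum]
  congr 2
  ext x
  by_cases hx : x ∈ A <;> simp [hx]

lemma tendsto_measureReal_closedBall [IsProbabilityMeasure π] :
    Tendsto (fun k : ℕ => π.real (Metric.closedBall 0 (k : ℝ))) atTop (𝓝 1) := by
  have h1 : Monotone fun k : ℕ => Metric.closedBall (0 : EuclideanSpace ℝ (Fin n)) (k : ℝ) :=
    fun i j hij => Metric.closedBall_subset_closedBall (by exact_mod_cast hij)
  have h2 := tendsto_measure_iUnion_atTop (μ := π) h1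
  rw [Metric.iUnion_closedBall_nat] at h2
  have h3 := (ENNReal.tendsto_toReal (measure_ne_top π univ)).comp h2
  simpa [Measure.real, Function.comp_def] using h3

lemma tendsto_heatNum_cond [IsProbabilityMeasure π] {t : ℝ} (ht : 0 < t)
    {g : EuclideanSpace ℝ (Fin n) → ℝ} {G : ℕ → EuclideanSpace ℝ (Fin n) → ℝ}
    (hg : Integrable g π) (hG : ∀ k, AEStronglyMeasurable (G k) π) (hGg : ∀ k x, |G k x| ≤ |g x|)
    (hlim : ∀ x, Tendsto (fun k => G k x) atTop (𝓝 (g x))) (y : EuclideanSpace ℝ (Fin n)) :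
    Tendsto (fun k : ℕ => heatNum (ProbabilityTheory.cond π (Metric.closedBall 0 (k : ℝ))) t
      (G k) y) atTop (𝓝 (heatNum π t g y)) := by
  simp_rw [heatNum_cond measurableSet_closedBall]
  have h1 := (tendsto_measureReal_closedBall (π := π)).inv₀ one_ne_zero
  rw [inv_one] at h1
  rw [← one_mul (heatNum π t g y)]
  refine h1.mul ?_
  unfold heatNum
  have hγ : Continuous fun x => gaussianDensity n t (y - x) :=
    (continuous_gaussianDensity n t).comp (by fun_prop)
  refine tendsto_integral_of_dominated_convergence (fun x => ‖g x * gaussianDensity n t (y - x)‖)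
    (fun k => ((hG k).indicator measurableSet_closedBall).mul hγ.aestronglyMeasurable)
    (integrable_mul_gaussianDensity ht hg y).norm (fun k => ae_of_all _ fun x => ?_)
    (ae_of_all _ fun x => ?_)
  · rw [norm_mul, norm_mul]
    gcongr
    exact (norm_indicator_le_norm_self _ _).trans (hGg k x)
  · refine Tendsto.mul_const _ ((hlim x).congr' ?_)
    filter_upwards [eventually_ge_atTop ⌈‖x‖⌉₊] with k hk
    rw [indicator_of_mem]
    rw [mem_closedBall_zero_iff]
    exact Nat.ceil_le.1 hk

/-- Once the ball has mass above 1/2, Cauchy–Schwarz under the conditioned posterior bounds the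
integrand by 2 `heatNum π t (fun x => f x ^ 2)`, which is integrable. Numerator and denominator
converge pointwise. -/
lemma tendsto_adjointNormSq_cond [IsProbabilityMeasure π] {t : ℝ} (ht : 0 < t)
    {f : EuclideanSpace ℝ (Fin n) → ℝ} {F : ℕ → EuclideanSpace ℝ (Fin n) → ℝ} (hf : MemLp f 2 π)
    (hF : ∀ k, AEStronglyMeasurable (F k) π) (hFf : ∀ k x, |F k x| ≤ |f x|)
    (hlim : ∀ x, Tendsto (fun k => F k x) atTop (𝓝 (f x))) :
    Tendsto (fun k : ℕ => adjointNormSq (ProbabilityTheory.cond π (Metric.closedBall 0 (k : ℝ)))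
      (F k) t) atTop (𝓝 (adjointNormSq π f t)) := by
  have hev : ∀ᶠ k : ℕ in atTop, 2⁻¹ < π.real (Metric.closedBall 0 (k : ℝ)) :=
    tendsto_measureReal_closedBall.eventually (lt_mem_nhds (by norm_num))
  have hprob : ∀ k : ℕ, 2⁻¹ < π.real (Metric.closedBall 0 (k : ℝ)) →
      IsProbabilityMeasure (ProbabilityTheory.cond π (Metric.closedBall 0 (k : ℝ))) := by
    intro k hk
    refine cond_isProbabilityMeasure fun h0 => ?_
    rw [Measure.real, h0] at hk
    norm_num at hk
  have hFk : ∀ k, MemLp (F k) 2 π := fun k => hf.mono (hF k) (ae_of_all _ fun x => hFf k x)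
  have hmemk : ∀ k : ℕ, 2⁻¹ < π.real (Metric.closedBall 0 (k : ℝ)) →
      MemLp (F k) 2 (ProbabilityTheory.cond π (Metric.closedBall 0 (k : ℝ))) := by
    intro k hk
    refine (((hFk k).restrict _)).smul_measure (ENNReal.inv_ne_top.2 fun h0 => ?_)
    rw [Measure.real, h0] at hk
    norm_num at hk
  have hsq := integrable_heatNum ht hf.integrable_sq
  have hlimit : Tendsto (fun k : ℕ => ∫ y,
      heatNum (ProbabilityTheory.cond π (Metric.closedBall 0 (k : ℝ))) t (F k) y ^ 2 /
        heatMass (ProbabilityTheory.cond π (Metric.closedBall 0 (k : ℝ))) t y) atTop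
      (𝓝 (∫ y, heatNum π t f y ^ 2 / heatMass π t y)) := by
    refine tendsto_integral_filter_of_dominated_convergence
      (fun y => 2 * heatNum π t (fun x => f x ^ 2) y) ?_ ?_ (hsq.const_mul 2) ?_
    · filter_upwards [hev] with k hk
      have := hprob k hk
      exact (integrable_heatNum_sq_div ht (hmemk k hk)).1
    · filter_upwards [hev] with k hk
      have := hprob k hk
      refine ae_of_all _ fun y => ?_
      rw [Real.norm_of_nonneg (div_nonneg (sq_nonneg _) (heatMass_pos ht y).le)]
      refine (heatNum_sq_div_le ht (hmemk k hk) y).trans ?_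
      rw [heatNum_cond measurableSet_closedBall]
      have h2 : (π.real (Metric.closedBall 0 (k : ℝ)))⁻¹ ≤ 2 := by
        rw [inv_le_comm₀ (by linarith) two_pos]; exact hk.le
      have h3 : heatNum π t ((Metric.closedBall 0 (k : ℝ)).indicator fun x => F k x ^ 2) y ≤
          heatNum π t (fun x => f x ^ 2) y := by
        refine integral_mono (integrable_mul_gaussianDensity ht
          ((hFk k).integrable_sq.indicator measurableSet_closedBall) y)
          (integrable_mul_gaussianDensity ht hf.integrable_sq y) fun x => ?_
        refine mul_le_mul_of_nonneg_right ?_ (gaussianDensity_pos ht _).le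
        refine (indicator_le_self' (fun x _ => sq_nonneg _) x).trans ?_
        exact sq_le_sq.2 (hFf k x)
      have h4 : 0 ≤ heatNum π t (fun x => f x ^ 2) y :=
        integral_nonneg fun x => mul_nonneg (sq_nonneg _) (gaussianDensity_pos ht _).le
      calc _ ≤ (π.real (Metric.closedBall 0 (k : ℝ)))⁻¹ * heatNum π t (fun x => f x ^ 2) y :=
            mul_le_mul_of_nonneg_left h3 (by positivity)
        _ ≤ _ := mul_le_mul_of_nonneg_right h2 h4
    · refine ae_of_all _ fun y => ?_
      have h1 := tendsto_heatNum_cond ht (hf.integrable (by norm_num)) hF hFf hlim y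
      have h2 := tendsto_heatNum_cond (π := π) ht (integrable_const (1 : ℝ))
        (G := fun _ _ => 1) (fun k => aestronglyMeasurable_const) (fun k x => le_rfl)
        (fun x => tendsto_const_nhds) y
      simp_rw [heatNum_one] at h2
      exact (h1.pow 2).div h2 (heatMass_pos ht y).ne'
  unfold adjointNormSq
  rw [integral_heatAdjoint_sq ht]
  refine hlimit.congr' ?_
  filter_upwards [hev] with k hk
  have := hprob k hk
  rw [integral_heatAdjoint_sq ht]

/-- Log-convexity of the squared norm along the heat flow, at positive times. -/
theorem adjointNormSq_le_rpow_mul (hπ : IsLogConcave π) [IsProbabilityMeasure π]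
    {f : EuclideanSpace ℝ (Fin n) → ℝ} (hf : MemLp f 2 π)
    {x z a b : ℝ} (hx : 0 < x) (hz : 0 < z) (ha : 0 < a) (hb : 0 < b) (hab : a + b = 1) :
    adjointNormSq π f (a * x + b * z) ≤ adjointNormSq π f x ^ a * adjointNormSq π f z ^ b := by
  -- Truncating f and conditioning on balls reduces to the bounded case. The multiplicative form of
  -- log-convexity passes to the limit without positivity of the norms.
  set F : ℕ → EuclideanSpace ℝ (Fin n) → ℝ := fun k x => max (min (f x) k) (-k) with hFdef
  have hF : ∀ k, AEStronglyMeasurable (F k) π := fun k =>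
    (hf.1.inf aestronglyMeasurable_const).sup aestronglyMeasurable_const
  have hFk : ∀ k x, |F k x| ≤ k := by
    intro k x
    have hk : (0 : ℝ) ≤ k := k.cast_nonneg
    exact abs_le.2 ⟨le_max_right _ _, max_le (min_le_right _ _) (by linarith)⟩
  have hFf : ∀ k x, |F k x| ≤ |f x| := by
    intro k x
    have hk : (0 : ℝ) ≤ k := k.cast_nonneg
    refine abs_le.2 ⟨le_max_of_le_left (le_min (neg_abs_le _) ?_),
      max_le ((min_le_left _ _).trans (le_abs_self _)) ?_⟩ <;> linarith [abs_nonneg (f x)]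
  have hlim : ∀ x, Tendsto (fun k => F k x) atTop (𝓝 (f x)) := by
    intro x
    refine tendsto_const_nhds.congr' ?_
    filter_upwards [eventually_ge_atTop ⌈|f x|⌉₊] with k hk
    have h1 := abs_le.1 (Nat.ceil_le.1 hk)
    rw [hFdef]
    dsimp only
    rw [min_eq_left h1.2, max_eq_left h1.1]
  have hpos : 0 < a * x + b * z := by positivity
  refine le_of_tendsto_of_tendsto (tendsto_adjointNormSq_cond hpos hf hF hFf hlim)
    (((tendsto_adjointNormSq_cond hx hf hF hFf hlim).rpow_const (Or.inr ha.le)).mul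
      ((tendsto_adjointNormSq_cond hz hf hF hFf hlim).rpow_const (Or.inr hb.le))) ?_
  have hev : ∀ᶠ k : ℕ in atTop, 2⁻¹ < π.real (Metric.closedBall 0 (k : ℝ)) :=
    tendsto_measureReal_closedBall.eventually (lt_mem_nhds (by norm_num))
  filter_upwards [hev] with k hk
  have h0 : π (Metric.closedBall 0 (k : ℝ)) ≠ 0 := by
    intro h0
    rw [Measure.real, h0] at hk
    norm_num at hk
  have := cond_isProbabilityMeasure h0
  refine adjointNormSq_le_rpow_mul_of_bounded (R := k)
    (hπ.cond (convex_closedBall _ _) measurableSet_closedBall h0) ?_ ?_ hx hz ha hb hab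
  · have h1 : ∀ᵐ x ∂(ProbabilityTheory.cond π (Metric.closedBall 0 (k : ℝ))),
        x ∈ Metric.closedBall (0 : EuclideanSpace ℝ (Fin n)) (k : ℝ) :=
      ae_cond_mem measurableSet_closedBall
    filter_upwards [h1] with x hx
    simpa using hx
  · exact memLp_top_of_bound ((hF k).mono_ac (cond_absolutelyContinuous)) k
      (ae_of_all _ fun x => hFk k x)

end Approximation

end

/-! ### Positivity, log-convexity up to time zero and the Rayleigh quotient -/

section

/-- Difference bounds for a log-convex function translate into bounds for its logarithm. -/
lemma log_sub_log_bounds {N E : ℝ → ℝ} (hN : ∀ t, 0 ≤ t → 0 < N t) (hE : ∀ t, 0 ≤ E t)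
    (h1 : ∀ t h, 0 ≤ t → 0 < h → h * E (t + h) ≤ N t - N (t + h))
    (h2 : ∀ t h, 0 ≤ t → 0 < h → N t - N (t + h) ≤ h * E t)
    (hc : ConvexOn ℝ (Ici 0) fun t => Real.log (N t)) {s t : ℝ} (hs : 0 ≤ s) (hst : s < t) :
    -(E s / N s) * (t - s) ≤ Real.log (N t) - Real.log (N s) ∧
      Real.log (N t) - Real.log (N s) ≤ -(E t / N t) * (t - s) := by
  have ht : 0 ≤ t := hs.trans hst.le
  have hts : 0 < t - s := sub_pos.2 hst
  have hNs := hN s hs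
  have hNt := hN t ht
  set m := (Real.log (N t) - Real.log (N s)) / (t - s) with hm
  suffices h : -(E s / N s) ≤ m ∧ m ≤ -(E t / N t) by
    rw [hm, le_div_iff₀ hts, div_le_iff₀ hts] at h
    exact h
  constructor
  -- By convexity the slope over [s, s + h] is at most m; by `h2` and log u ≥ 1 − 1/u it is at least
  -- −E(s)/(N(s) − hE(s)). The other half uses `h1` on [t − h, t] in the same way.
  · have hlim : Tendsto (fun h => -(E s / (N s - h * E s))) (𝓝[>] 0) (𝓝 (-(E s / N s))) := by
      have : ContinuousAt (fun h => -(E s / (N s - h * E s))) 0 :=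
        (ContinuousAt.div (by fun_prop) (by fun_prop) (by simpa using hNs.ne')).neg
      have h0 := this.tendsto.mono_left (nhdsWithin_le_nhds (s := Ioi 0))
      simpa using h0
    have hpos : ∀ᶠ h in 𝓝[>] (0 : ℝ), 0 < N s - h * E s := by
      have : ContinuousAt (fun h => N s - h * E s) 0 := by fun_prop
      exact (this.eventually (lt_mem_nhds (by simpa using hNs))).filter_mono nhdsWithin_le_nhds
    refine le_of_tendsto hlim ?_
    filter_upwards [hpos, Ioo_mem_nhdsGT hts] with h hp hh
    have e1 := hc.secant_mono (a := s) (x := s + h) (y := t) hs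
      (show 0 ≤ s + h by linarith [hh.1]) ht (by linarith [hh.1]) hst.ne' (by linarith [hh.2])
    rw [add_sub_cancel_left] at e1
    refine le_trans ?_ e1
    rw [le_div_iff₀ hh.1]
    have e2 : N s - h * E s ≤ N (s + h) := by linarith [h2 s h hs hh.1]
    have e3 := Real.log_le_log hp e2
    have e4 := Real.one_sub_inv_le_log_of_pos (div_pos hp hNs)
    rw [Real.log_div hp.ne' hNs.ne', inv_div] at e4
    have e5 : 1 - N s / (N s - h * E s) = -(E s / (N s - h * E s)) * h := by
      field_simp; ring
    linarith
  · have hlim : Tendsto (fun h => -(E t / (N t + h * E t))) (𝓝[>] 0) (𝓝 (-(E t / N t))) := by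
      have : ContinuousAt (fun h => -(E t / (N t + h * E t))) 0 :=
        (ContinuousAt.div (by fun_prop) (by fun_prop) (by simpa using hNt.ne')).neg
      have h0 := this.tendsto.mono_left (nhdsWithin_le_nhds (s := Ioi 0))
      simpa using h0
    refine ge_of_tendsto hlim ?_
    filter_upwards [Ioo_mem_nhdsGT hts] with h hh
    have hth : 0 ≤ t - h := by linarith [hh.2]
    have hp : 0 < N t + h * E t := add_pos_of_pos_of_nonneg hNt (mul_nonneg hh.1.le (hE t))
    have e1 := hc.secant_mono (a := t) (x := s) (y := t - h) ht hs hth hst.ne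
      (by linarith [hh.1]) (by linarith [hh.2])
    have e0 : m = (Real.log (N s) - Real.log (N t)) / (s - t) := by
      rw [hm, ← neg_sub (Real.log (N s)), ← neg_sub s t, neg_div_neg_eq]
    rw [e0]
    refine e1.trans ?_
    have e6 : t - h - t = -h := by ring
    rw [e6, div_neg, neg_le_neg_iff, le_div_iff₀ hh.1]
    have e2 := h1 (t - h) h hth hh.1
    rw [sub_add_cancel] at e2
    have e3 := Real.log_le_log hp (show N t + h * E t ≤ N (t - h) by linarith)
    have e4 := Real.one_sub_inv_le_log_of_pos (div_pos hp hNt)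
    rw [Real.log_div hp.ne' hNt.ne', inv_div] at e4
    have e5 : 1 - N t / (N t + h * E t) = E t / (N t + h * E t) * h := by
      field_simp; ring
    linarith

section Main

variable {n : ℕ} {π : Measure (EuclideanSpace ℝ (Fin n))} {f : EuclideanSpace ℝ (Fin n) → ℝ}

lemma adjointNormSq_zero_pos [IsProbabilityMeasure π] (hf : MemLp f 2 π) (h0 : ¬ f =ᵐ[π] 0) :
    0 < adjointNormSq π f 0 := by
  rw [adjointNormSq_zero]
  refine lt_of_le_of_ne (integral_nonneg fun x => sq_nonneg _) fun h => h0 ?_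
  have h1 := (integral_eq_zero_iff_of_nonneg (fun x => sq_nonneg (f x)) hf.integrable_sq).1 h.symm
  filter_upwards [h1] with x hx
  simpa using hx

/-- The adjoint heat flow of a nonzero function never vanishes. -/
lemma adjointNormSq_pos (hπ : IsLogConcave π) [IsProbabilityMeasure π] (hf : MemH1 π f)
    (h0 : ¬ f =ᵐ[π] 0) {t : ℝ} (ht : 0 ≤ t) : 0 < adjointNormSq π f t := by
  have hN0 := adjointNormSq_zero_pos hf.1 h0
  rcases ht.eq_or_lt with rfl | ht
  · exact hN0
  refine lt_of_le_of_ne (adjointNormSq_nonneg f t) fun hz => ?_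
  -- Each s in (0, t) is a convex combination of s/2 and t with positive weight on t, so the zero at
  -- t annihilates the log-convexity bound.
  have hzero : ∀ s ∈ Ioo 0 t, adjointNormSq π f s ≤ 0 := by
    intro s hs
    have hpos : 0 < t - s / 2 := by linarith [hs.1, hs.2]
    have hb : 0 < s / 2 / (t - s / 2) := div_pos (by linarith [hs.1]) hpos
    have ha : 0 < (t - s) / (t - s / 2) := div_pos (by linarith [hs.2]) hpos
    have h1 := adjointNormSq_le_rpow_mul hπ hf.1 (half_pos hs.1) ht ha hb
      (by rw [← add_div, div_eq_one_iff_eq hpos.ne']; ring)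
    have e : (t - s) / (t - s / 2) * (s / 2) + s / 2 / (t - s / 2) * t = s := by
      rw [div_mul_eq_mul_div, div_mul_eq_mul_div, ← add_div, div_eq_iff hpos.ne']; ring
    rwa [e, ← hz, Real.zero_rpow hb.ne', mul_zero] at h1
  have hft : MemH1 (heatFlow π 0) (heatAdjoint π 0 f) := memH1_heatAdjoint hπ le_rfl hf
  have h2 : ∀ h ∈ Ioo 0 t, adjointNormSq π f 0 ≤ h * adjointEnergy π f 0 := by
    intro h hh
    have e1 := adjointNormSq_sub_le hπ le_rfl hh.1 hf.1 hft
    rw [zero_add] at e1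
    linarith [hzero h hh]
  have hlim : Tendsto (fun h => h * adjointEnergy π f 0) (𝓝[>] 0) (𝓝 (0 * adjointEnergy π f 0)) :=
    (Continuous.tendsto (by fun_prop) 0).mono_left nhdsWithin_le_nhds
  rw [zero_mul] at hlim
  have := ge_of_tendsto hlim (by filter_upwards [Ioo_mem_nhdsGT ht] with h hh using h2 h hh)
  linarith

/-- The squared norm of the adjoint heat flow is log-convex. -/
lemma convexOn_log_adjointNormSq (hπ : IsLogConcave π) [IsProbabilityMeasure π] (hf : MemH1 π f)
    (h0 : ¬ f =ᵐ[π] 0) : ConvexOn ℝ (Ici 0) fun t => Real.log (adjointNormSq π f t) := by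
  have hpos := fun t (ht : 0 ≤ t) => adjointNormSq_pos hπ hf h0 ht
  have hcont : ContinuousOn (adjointNormSq π f) (Ioi 0) :=
    continuousOn_of_difference_bounds (E := adjointEnergy π f) (fun t _ => gradEnergy_nonneg _ _)
      (fun t h ht hh => mul_adjointEnergy_le hπ ht.le hh hf.1)
      (fun t h ht hh => adjointNormSq_sub_le hπ ht.le hh hf.1 (memH1_heatAdjoint hπ ht.le hf))
  have key : ∀ x z a b : ℝ, 0 < x → 0 < z → 0 < a → 0 < b → a + b = 1 →
      Real.log (adjointNormSq π f (a * x + b * z)) ≤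
        a * Real.log (adjointNormSq π f x) + b * Real.log (adjointNormSq π f z) := by
    intro x z a b hx hz ha hb hab
    have h1 := adjointNormSq_le_rpow_mul hπ hf.1 hx hz ha hb hab
    have h2 := Real.log_le_log (hpos _ (by positivity)) h1
    rwa [Real.log_mul (Real.rpow_pos_of_pos (hpos x hx.le) _).ne'
      (Real.rpow_pos_of_pos (hpos z hz.le) _).ne', Real.log_rpow (hpos x hx.le),
      Real.log_rpow (hpos z hz.le)] at h2
  -- Continuity at time zero is not needed: N(x) ≤ N(0) replaces the endpoint value on the right,
  -- and on the left x decreases to 0 using continuity at the positive time bz only.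
  have hanti : ∀ x, 0 < x → adjointNormSq π f x ≤ adjointNormSq π f 0 := by
    intro x hx
    have h1 := mul_adjointEnergy_le hπ le_rfl hx hf.1
    rw [zero_add] at h1
    have h2 : 0 ≤ x * adjointEnergy π f x := mul_nonneg hx.le (gradEnergy_nonneg _ _)
    linarith
  have key0 : ∀ z a b : ℝ, 0 < z → 0 < a → 0 < b → a + b = 1 →
      Real.log (adjointNormSq π f (a * 0 + b * z)) ≤
        a * Real.log (adjointNormSq π f 0) + b * Real.log (adjointNormSq π f z) := by
    intro z a b hz ha hb hab
    have hbz : 0 < a * 0 + b * z := by rw [mul_zero, zero_add]; positivity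
    have hlim : Tendsto (fun x => Real.log (adjointNormSq π f (a * x + b * z))) (𝓝[>] 0)
        (𝓝 (Real.log (adjointNormSq π f (a * 0 + b * z)))) := by
      have h1 : ContinuousAt (adjointNormSq π f) (a * 0 + b * z) :=
        hcont.continuousAt (Ioi_mem_nhds hbz)
      have h2 : ContinuousAt (fun x : ℝ => a * x + b * z) 0 := by fun_prop
      exact ((ContinuousAt.comp (f := fun x : ℝ => a * x + b * z) h1 h2).log
        (hpos _ hbz.le).ne').tendsto.mono_left nhdsWithin_le_nhds
    refine le_of_tendsto hlim ?_
    filter_upwards [self_mem_nhdsWithin] with x hx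
    have hx' : (0 : ℝ) < x := hx
    have h1 := key x z a b hx' hz ha hb hab
    have h2 := mul_le_mul_of_nonneg_left
      (Real.log_le_log (hpos x hx'.le) (hanti x hx')) ha.le
    linarith
  rw [convexOn_iff_forall_pos]
  refine ⟨convex_Ici 0, fun x hx z hz a b ha hb hab => ?_⟩
  simp only [smul_eq_mul]
  have hx' : (0 : ℝ) ≤ x := hx
  have hz' : (0 : ℝ) ≤ z := hz
  rcases hx'.eq_or_lt with rfl | hx'
  · rcases hz'.eq_or_lt with rfl | hz'
    · rw [← add_mul, ← add_mul, hab, one_mul, one_mul]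
    · exact key0 z a b hz' ha hb hab
  · rcases hz'.eq_or_lt with rfl | hz'
    · rw [add_comm (a * x), add_comm (a * _)]
      exact key0 x b a hx' hb ha (by linarith)
    · exact key x z a b hx' hz' ha hb hab

lemma l2Norm_heatAdjoint_sq (t : ℝ) :
    l2Norm (heatFlow π t) (heatAdjoint π t f) ^ 2 = adjointNormSq π f t :=
  Real.sq_sqrt (adjointNormSq_nonneg f t)

end Main

end

end HeatAdjoint

end

theorem mainTheorem10 (n : ℕ) (π : MeasureTheory.Measure (EuclideanSpace ℝ (Fin n)))
    [MeasureTheory.IsProbabilityMeasure π] (hπ : HeatAdjoint.IsLogConcave π)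
    (f : EuclideanSpace ℝ (Fin n) → ℝ) (hf : HeatAdjoint.MemH1 π f) :
    (∀ t : ℝ, 0 ≤ t →
      HeatAdjoint.MemH1 (HeatAdjoint.heatFlow π t) (HeatAdjoint.heatAdjoint π t f)) ∧
    (¬ f =ᵐ[π] 0 →
      (∀ t : ℝ, 0 ≤ t →
        0 < HeatAdjoint.l2Norm (HeatAdjoint.heatFlow π t) (HeatAdjoint.heatAdjoint π t f)) ∧
      AntitoneOn (HeatAdjoint.rayleigh π f) (Set.Ici 0) ∧
      ConvexOn ℝ (Set.Ici 0) (fun t : ℝ =>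
        Real.log (HeatAdjoint.l2Norm (HeatAdjoint.heatFlow π t)
          (HeatAdjoint.heatAdjoint π t f))) ∧
      ∀ h : ℝ, 0 < h →
        Real.exp (-h * HeatAdjoint.rayleigh π f 0) * HeatAdjoint.l2Norm π f ^ 2 ≤
          HeatAdjoint.l2Norm (HeatAdjoint.heatFlow π h) (HeatAdjoint.heatAdjoint π h f) ^ 2) ∧
    (∀ h : ℝ, 0 < h →
      HeatAdjoint.gradEnergy (HeatAdjoint.heatFlow π h) (HeatAdjoint.heatAdjoint π h f) ≤
        HeatAdjoint.gradEnergy π f) := by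
  have hpos := fun h0 t (ht : 0 ≤ t) => HeatAdjoint.adjointNormSq_pos hπ hf h0 ht
  have hft := fun t (ht : 0 ≤ t) => HeatAdjoint.memH1_heatAdjoint hπ ht hf
  have h1 := fun t h (ht : 0 ≤ t) (hh : 0 < h) => HeatAdjoint.mul_adjointEnergy_le hπ ht hh hf.1
  have h2 := fun t h (ht : 0 ≤ t) (hh : 0 < h) =>
    HeatAdjoint.adjointNormSq_sub_le hπ ht hh hf.1 (hft t ht)
  refine ⟨hft, fun h0 => ?_, fun h hh => ?_⟩
  · have hc := HeatAdjoint.convexOn_log_adjointNormSq hπ hf h0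
    have hb := fun (s t : ℝ) (hs : 0 ≤ s) (hst : s < t) =>
      HeatAdjoint.log_sub_log_bounds (N := HeatAdjoint.adjointNormSq π f)
        (E := HeatAdjoint.adjointEnergy π f) (hpos h0) (fun t => HeatAdjoint.gradEnergy_nonneg _ _) h1 h2 hc hs hst
    refine ⟨fun t ht => Real.sqrt_pos.2 (hpos h0 t ht), ?_, ?_, fun h hh => ?_⟩
    · intro s hs t ht hst
      rcases hst.eq_or_lt with rfl | hst
      · exact le_rfl
      -- The slope of log N over [s, t] separates minus the Rayleigh quotient at s from that at t.
      have hb' := hb s t hs hst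
      have h3 := hb'.1.trans hb'.2
      have h4 : HeatAdjoint.adjointEnergy π f t / HeatAdjoint.adjointNormSq π f t ≤
          HeatAdjoint.adjointEnergy π f s / HeatAdjoint.adjointNormSq π f s := by
        nlinarith [sub_pos.2 hst]
      exact h4
    · have h3 := hc.smul (show (0 : ℝ) ≤ 1 / 2 by norm_num)
      refine h3.congr fun t ht => ?_
      change 1 / 2 * Real.log (HeatAdjoint.adjointNormSq π f t) =
        Real.log (Real.sqrt (HeatAdjoint.adjointNormSq π f t))
      rw [Real.log_sqrt (hpos h0 t ht).le]
      ring
    · have h3 := (hb 0 h le_rfl hh).1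
      rw [HeatAdjoint.l2Norm_heatAdjoint_sq]
      have h4 : HeatAdjoint.l2Norm π f ^ 2 = HeatAdjoint.adjointNormSq π f 0 := by
        rw [← HeatAdjoint.l2Norm_heatAdjoint_sq, HeatAdjoint.heatFlow_zero,
          HeatAdjoint.heatAdjoint_zero]
      have hN0 := hpos h0 0 le_rfl
      have hNh := hpos h0 h hh.le
      rw [h4, ← Real.log_le_log_iff (by positivity) hNh, Real.log_mul (Real.exp_pos _).ne' hN0.ne',
        Real.log_exp]
      have h5 : HeatAdjoint.rayleigh π f 0 =
        HeatAdjoint.adjointEnergy π f 0 / HeatAdjoint.adjointNormSq π f 0 := rfl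
      rw [h5]
      linarith
  -- The decrease of the squared norm over [0, h] lies between h times the final energy and h times
  -- the initial energy.
  · have h3 := (h1 0 h le_rfl hh).trans (h2 0 h le_rfl hh)
    have h4 := le_of_mul_le_mul_left h3 hh
    rw [zero_add] at h4
    have h5 : HeatAdjoint.adjointEnergy π f 0 = HeatAdjoint.gradEnergy π f := by
      rw [HeatAdjoint.adjointEnergy, HeatAdjoint.heatFlow_zero, HeatAdjoint.heatAdjoint_zero]
    rwa [h5] at h4
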